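/- For $\omega>0$ let $Q_\omega(y)=\sqrt{\frac{4}{1+a_\omega\cosh 2y}}$ with $a_\omega=\sqrt{1+\frac{16}{3}\omega}$, and set $$L_+=-\partial_y^2+1-3Q_\omega^2-5\omega Q_\omega^4,\quad L_-=-\partial_y^2+1-Q_\omega^2-\omega Q_\omega^4,$$ $$M_+=-\partial_y^2+1+\tfrac{\omega}{3}Q_\omega^4,\quad M_-=-\partial_y^2+1-\omega Q_\omega^4,\quad S^*=-\partial_y-\frac{Q_\omega'}{Q_\omega},\quad \langle f,g\rangle=\int_{\mathbb R} fg .$$ There is $\omega_1>0$ such that for every $\omega\in(0,\omega_1)$ the following objects exist. (a) A number $\alpha\in(0,1)$ and smooth even real functions $W_1,W_2$ on $\mathbb R$ tending to $0$ at $\pm\infty$ with $M_+W_1=\lambda W_2$ and $M_-W_2=\lambda W_1$, where $\lambda=1-\alpha^2$, normalised by $\omega\int Q_\omega^4(3W_2-W_1)=12\alpha$. Put $V_1=(S^*)^2W_1$ and $V_2=\lambda^{-1}L_+V_1$. (b) Bounded smooth even real functions $h_1,h_2$ on $\mathbb R$ with $M_+h_1=2\lambda h_2$ and $M_-h_2=2\lambda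 h_1$, normalised by $h_1(0)+h_2(0)=-2$. Put $g_1=(S^*)^2h_1$ and $g_2=(2\lambda)^{-1}L_+g_1$. For every $\omega\in(0,\omega_1)$ and every choice of such objects, $L_+V_1=\lambda V_2$ and $L_-V_2=\lambda V_1$, and $(g_1,g_2)$ is a nontrivial bounded solution of $L_+g_1=2\lambda g_2$, $L_-g_2=2\lambda g_1$. Moreover, with $$G_1=V_1^2(3Q_\omega+10\omega Q_\omega^3)-V_2^2(Q_\omega+2\omega Q_\omega^3),\qquad G_2=2V_1V_2(Q_\omega+2\omega Q_\omega^3),$$ the pairings $\langle V_1,V_2\rangle$, $\langle G_1,V_1\rangle$, $\langle G_2,V_2\rangle$ converge absolutely, $\langle V_1,V_2\rangle\neq0$, and, setting $$G_1^\top=G_1-\frac{\langle G_1,V_1\rangle}{\langle V_1,V_2\rangle}V_2,\qquad G_2^\perp=G_2-\frac{\langle G_2,V_2\rangle}{\langle V_1,V_2\rangle}V_1,$$ the integral $\Gamma(\omega)=\int_{\mathbb R}(G_1^\top g_1+G_2^\perp g_2)$ converges absolutely and $$\Gamma(\omega)=\Gamma_0\,\omega+O(\omega^2),\qquad \Gamma_0=\frac{32\pi\sqrt2}{3\cosh(\pi/2)}>0,$$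 that is, $|\Gamma(\omega)-\Gamma_0\omega|\le C\omega^2$ with a constant $C$ independent of $\omega$ and of the choice of the objects in (a) and (b). -/

import Mathlib

open Filter Topology Set MeasureTheory

noncomputable section

namespace CubicQuintic

/-- The rescaled soliton profile `Q_ω`, the even positive solution of `Q'' - Q + Q³ + ω Q⁵ = 0`. -/
def Qw (ω : ℝ) (y : ℝ) : ℝ :=
  Real.sqrt (4 / (1 + Real.sqrt (1 + 16 / 3 * ω) * Real.cosh (2 * y)))

/-- `L₊ = -∂² + 1 - 3 Q² - 5 ω Q⁴`. -/
def Lplus (ω : ℝ) (f : ℝ → ℝ) (y : ℝ) : ℝ :=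
  -deriv (deriv f) y + f y - 3 * Qw ω y ^ 2 * f y - 5 * ω * Qw ω y ^ 4 * f y

/-- `L₋ = -∂² + 1 - Q² - ω Q⁴`. -/
def Lminus (ω : ℝ) (f : ℝ → ℝ) (y : ℝ) : ℝ :=
  -deriv (deriv f) y + f y - Qw ω y ^ 2 * f y - ω * Qw ω y ^ 4 * f y

/-- `M₊ = -∂² + 1 + (ω / 3) Q⁴`. -/
def Mplus (ω : ℝ) (f : ℝ → ℝ) (y : ℝ) : ℝ :=
  -deriv (deriv f) y + f y + ω / 3 * Qw ω y ^ 4 * f y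

/-- `M₋ = -∂² + 1 - ω Q⁴`. -/
def Mminus (ω : ℝ) (f : ℝ → ℝ) (y : ℝ) : ℝ :=
  -deriv (deriv f) y + f y - ω * Qw ω y ^ 4 * f y

/-- `S* = -∂ - Q' / Q`. -/
def Sstar (ω : ℝ) (f : ℝ → ℝ) (y : ℝ) : ℝ :=
  -deriv f y - deriv (Qw ω) y / Qw ω y * f y

/-- The (real) pairing `⟨f, g⟩ = ∫ f g`. -/
def pairing (f g : ℝ → ℝ) : ℝ := ∫ y, f y * g y

/-- The linearised spectral system `L₊ f₁ = ν f₂`, `L₋ f₂ = ν f₁`. -/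
def SolvesL (ω ν : ℝ) (f₁ f₂ : ℝ → ℝ) : Prop :=
  (∀ y, Lplus ω f₁ y = ν * f₂ y) ∧ ∀ y, Lminus ω f₂ y = ν * f₁ y

/-- The transformed spectral system `M₊ f₁ = ν f₂`, `M₋ f₂ = ν f₁`. -/
def SolvesM (ω ν : ℝ) (f₁ f₂ : ℝ → ℝ) : Prop :=
  (∀ y, Mplus ω f₁ y = ν * f₂ y) ∧ ∀ y, Mminus ω f₂ y = ν * f₁ y

/-- The frequency `λ = 1 - α²` of the internal mode. -/
def freq (α : ℝ) : ℝ := 1 - α ^ 2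

/-- `(W₁, W₂)` is the even eigenfunction of the transformed system for the eigenvalue `λ = 1 - α²`
in `(0, 1)`. The last field fixes the scalar multiple; it is the normalisation for which
`W₁` and `W₂` equal `1 + O(ω)` on compact sets. -/
structure IsInternalMode (ω α : ℝ) (W₁ W₂ : ℝ → ℝ) : Prop where
  alpha_mem : α ∈ Ioo (0 : ℝ) 1
  smooth₁ : ContDiff ℝ (⊤ : ℕ∞) W₁
  smooth₂ : ContDiff ℝ (⊤ : ℕ∞) W₂
  even₁ : Function.Even W₁
  even₂ : Function.Even W₂
  solves : SolvesM ω (freq α) W₁ W₂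
  decay₁ : Tendsto W₁ (cocompact ℝ) (𝓝 0)
  decay₂ : Tendsto W₂ (cocompact ℝ) (𝓝 0)
  normalised : ω * ∫ y, Qw ω y ^ 4 * (3 * W₂ y - W₁ y) = 12 * α

/-- `(h₁, h₂)` is the bounded even solution of the transformed system at frequency `2 λ`. The last
field fixes the scalar multiple; it is the normalisation for which `h₁` and `h₂` equal
`-cos (τ y) + O(ω)` with `τ = √(2 λ - 1)`. -/
structure IsBoundedSolution (ω α : ℝ) (h₁ h₂ : ℝ → ℝ) : Prop where
  smooth₁ : ContDiff ℝ (⊤ : ℕ∞) h₁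
  smooth₂ : ContDiff ℝ (⊤ : ℕ∞) h₂
  even₁ : Function.Even h₁
  even₂ : Function.Even h₂
  solves : SolvesM ω (2 * freq α) h₁ h₂
  bounded : ∃ M : ℝ, ∀ y, |h₁ y| ≤ M ∧ |h₂ y| ≤ M
  normalised : h₁ 0 + h₂ 0 = -2

/-- `f₁ = (S*)² k` for a first component `k` of a solution of the transformed system. -/
def fstComp (ω : ℝ) (k : ℝ → ℝ) : ℝ → ℝ := Sstar ω (Sstar ω k)

/-- `f₂ = ν⁻¹ L₊ f₁` with `f₁ = (S*)² k`. -/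
def sndComp (ω ν : ℝ) (k : ℝ → ℝ) : ℝ → ℝ := fun y => ν⁻¹ * Lplus ω (fstComp ω k) y

/-- `G₁ = V₁² (3 Q + 10 ω Q³) - V₂² (Q + 2 ω Q³)`. -/
def G₁ (ω : ℝ) (V₁ V₂ : ℝ → ℝ) (y : ℝ) : ℝ :=
  V₁ y ^ 2 * (3 * Qw ω y + 10 * ω * Qw ω y ^ 3) - V₂ y ^ 2 * (Qw ω y + 2 * ω * Qw ω y ^ 3)

/-- `G₂ = 2 V₁ V₂ (Q + 2 ω Q³)`. -/
def G₂ (ω : ℝ) (V₁ V₂ : ℝ → ℝ) (y : ℝ) : ℝ :=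
  2 * V₁ y * V₂ y * (Qw ω y + 2 * ω * Qw ω y ^ 3)

/-- `G₁^⊤ = G₁ - (⟨G₁, V₁⟩ / ⟨V₁, V₂⟩) V₂`. -/
def G₁top (ω : ℝ) (V₁ V₂ : ℝ → ℝ) (y : ℝ) : ℝ :=
  G₁ ω V₁ V₂ y - pairing (G₁ ω V₁ V₂) V₁ / pairing V₁ V₂ * V₂ y

/-- `G₂^⊥ = G₂ - (⟨G₂, V₂⟩ / ⟨V₁, V₂⟩) V₁`. -/
def G₂perp (ω : ℝ) (V₁ V₂ : ℝ → ℝ) (y : ℝ) : ℝ :=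
  G₂ ω V₁ V₂ y - pairing (G₂ ω V₁ V₂) V₂ / pairing V₁ V₂ * V₁ y

/-- The integrand `G₁^⊤ g₁ + G₂^⊥ g₂`. -/
def fermiIntegrand (ω : ℝ) (V₁ V₂ g₁ g₂ : ℝ → ℝ) (y : ℝ) : ℝ :=
  G₁top ω V₁ V₂ y * g₁ y + G₂perp ω V₁ V₂ y * g₂ y

/-- The quantity `Γ = ∫ (G₁^⊤ g₁ + G₂^⊥ g₂)`. -/
def Gam (ω : ℝ) (V₁ V₂ g₁ g₂ : ℝ → ℝ) : ℝ := ∫ y, fermiIntegrand ω V₁ V₂ g₁ g₂ y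

/-- The constant `Γ₀ = 32 π √2 / (3 cosh (π / 2))`. -/
def Gam₀ : ℝ := 32 * Real.pi * Real.sqrt 2 / (3 * Real.cosh (Real.pi / 2))

end CubicQuintic

end

open CubicQuintic

namespace CubicQuintic

open scoped BoundedContinuousFunction

/-! Put u = W₁ + W₂, v = W₁ − W₂ and R = Q'/Q. The transformed system reads u'' = α²u − (ω/3)Q⁴(u −
2v), v'' = (2 − α²)v + (ω/3)Q⁴(2u − v). The second equation has a coercive constant part, so a
maximum principle makes v of size ω times sup |u| (`SolvesM.diff_bounds`). The first describes a
slow exponential of rate α driven by a localised source of size ω. The normalisation says that this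
source has total mass 4α; testing against e^{−αz} then gives u(0) = 2 + O(ω), α = O(ω) and u = 2 +
O(ω(1 + |y|)) (`slow_mode_bounds`). In the same way h₁ + h₂ = −2 cos y + O(ω(1 + |y|)) and h₁ − h₂ =
O(ω). These estimates hold for every admissible choice of objects, so no uniqueness statement is
needed.

Since R² and R' are polynomials in Q, the operator (S*)² and all later identities become polynomial
identities in Q, R and first-order jets. In particular V and g have closed forms (`fstForm`,
`sndForm`) which solve the L-system.

The projections in Γ cost nothing: Green's identity gives two independent linear relations between
⟨V₂, g₁⟩ and ⟨V₁, g₂⟩, so both vanish. The pairing ⟨V₁, V₂⟩ is nonzero because λ⟨V₁, V₂⟩ is the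
integral of (V₂' − R V₂)², and V₂' = R V₂ would force L₋V₂ = 0, hence V₁ = 0.

The core is a normal form. There are explicit quadratic forms A, B in the jets of u, v such that
(G₁, G₂) = (L₊A − 2λB, L₋B − 2λA) plus an error of order ω. The bracketed part is orthogonal to (g₁,
g₂) by Green's identity, because (g₁, g₂) solves the system at frequency 2λ. Thus Γ has no term of
order zero, and Γ is exactly the pairing of the error with g (`integral_source_eq_integral_error`).
Inserting u ≈ 2, h₁ + h₂ ≈ −2 cos y, the error pairing is ω times an explicit combination of Q, R,
cos, sin, up to O(ω²). Modulo the derivative of a localised function and O(ω), that combination is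
(32/3) Q cos y (`hasDerivAt_leadPrimitive`). Finally Q = √2 / cosh y + O(ω e^{−|y|}), and the
integral of cos y / cosh y is π / cosh(π/2) by the Beta integral and the reflection formula.

Existence is obtained from integral equations on the half line, solved by inverting 1 − (small
operator). For the bounded solution this is direct. For the mode the Green function of α² − ∂² blows
up like 1/α; the matching condition α = (ω/2)∫₀^∞ Q²φ turns the singular part into the bounded
source 2e^{−α|y|}. The regularised equation is solved for every α, and the intermediate value
theorem selects an α satisfying the matching condition (`exists_slow_system`). -/

/-- The constant `a_ω`. -/
noncomputable def aw (ω : ℝ) : ℝ := Real.sqrt (1 + 16 / 3 * ω)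

/-! ### Calculus and size of the profile Q and of R = Q'/Q. -/

/-- The logarithmic derivative `Q' / Q` of the profile. -/
noncomputable def Rw (ω y : ℝ) : ℝ := -(aw ω * Real.sinh (2 * y)) / (1 + aw ω * Real.cosh (2 * y))

lemma aw_sq {ω : ℝ} (hω : 0 < ω) : aw ω ^ 2 = 1 + 16 / 3 * ω :=
  Real.sq_sqrt (by positivity)

lemma one_le_aw {ω : ℝ} (hω : 0 < ω) : 1 ≤ aw ω := by
  rw [aw, Real.one_le_sqrt]; linarith

lemma den_pos (ω y : ℝ) : 0 < 1 + aw ω * Real.cosh (2 * y) := by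
  have : 0 ≤ aw ω := Real.sqrt_nonneg _
  have := Real.cosh_pos (2 * y)
  positivity

lemma Qw_sq (ω y : ℝ) : Qw ω y ^ 2 = 4 / (1 + aw ω * Real.cosh (2 * y)) :=
  Real.sq_sqrt (div_nonneg (by norm_num) (den_pos ω y).le)

lemma Qw_pos (ω y : ℝ) : 0 < Qw ω y :=
  Real.sqrt_pos.2 (div_pos (by norm_num) (den_pos ω y))

lemma Qw_even (ω y : ℝ) : Qw ω (-y) = Qw ω y := by simp [Qw]

lemma Qw_abs (ω y : ℝ) : Qw ω |y| = Qw ω y := by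
  rcases abs_choice y with h | h <;> rw [h]; exact Qw_even ω y

lemma hasDerivAt_den (ω y : ℝ) :
    HasDerivAt (fun y => 1 + aw ω * Real.cosh (2 * y)) (2 * aw ω * Real.sinh (2 * y)) y := by
  have h := (((hasDerivAt_id y).const_mul 2).cosh.const_mul (aw ω)).const_add 1
  exact h.congr_deriv (by simp only [id, mul_one]; ring)

lemma hasDerivAt_Qw (ω y : ℝ) : HasDerivAt (Qw ω) (Rw ω y * Qw ω y) y := by
  have hd := den_pos ω y
  have h := (((hasDerivAt_const y (4 : ℝ)).div (hasDerivAt_den ω y) hd.ne')).sqrt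
    (div_pos (by norm_num) hd).ne'
  refine h.congr_deriv ?_
  have hq := Qw_pos ω y
  have hs := Qw_sq ω y
  change _ / (2 * Qw ω y) = _
  rw [div_eq_iff (by positivity), Rw]
  have : Qw ω y * Qw ω y = 4 / (1 + aw ω * Real.cosh (2 * y)) := by rw [← hs]; ring
  rw [show ∀ r : ℝ, r * Qw ω y * (2 * Qw ω y) = 2 * r * (Qw ω y * Qw ω y) by intro r; ring, this]
  field_simp
  ring

/-- The first integral of the profile equation, divided by Q². It is the only algebraic relation
between Q and R, and the verifications of differential identities below end by adding a multiple of
it. -/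
lemma Rw_sq {ω : ℝ} (hω : 0 < ω) (y : ℝ) :
    Rw ω y ^ 2 = 1 - Qw ω y ^ 2 / 2 - ω / 3 * Qw ω y ^ 4 := by
  have hd := (den_pos ω y).ne'
  have ha := aw_sq hω
  have hc := Real.cosh_sq (2 * y)
  rw [show Qw ω y ^ 4 = (Qw ω y ^ 2) ^ 2 by ring, Qw_sq, Rw]
  field_simp
  -- Trading ω for a leaves a polynomial identity in a, cosh 2y, sinh 2y modulo cosh² − sinh² = 1.
  have : ω = 3 / 16 * (aw ω ^ 2 - 1) := by rw [ha]; ring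
  generalize aw ω = a at *
  generalize Real.cosh (2 * y) = c at *
  generalize Real.sinh (2 * y) = s at *
  subst this
  linear_combination (-6 * a ^ 2) * hc

lemma hasDerivAt_Rw {ω : ℝ} (hω : 0 < ω) (y : ℝ) :
    HasDerivAt (Rw ω) (-(Qw ω y ^ 2) / 2 - 2 / 3 * ω * Qw ω y ^ 4) y := by
  have hd := den_pos ω y
  have h1 : HasDerivAt (fun y => -(aw ω * Real.sinh (2 * y)))
      (-(aw ω * (Real.cosh (2 * y) * 2))) y := by
    have h := (((hasDerivAt_id y).const_mul 2).sinh.const_mul (aw ω)).neg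
    exact h.congr_deriv (by simp only [id, mul_one])
  refine (h1.div (hasDerivAt_den ω y) hd.ne').congr_deriv ?_
  have ha := aw_sq hω
  have hc := Real.cosh_sq (2 * y)
  rw [show Qw ω y ^ 4 = (Qw ω y ^ 2) ^ 2 by ring, Qw_sq]
  have hd := hd.ne'
  field_simp
  have : ω = 3 / 16 * (aw ω ^ 2 - 1) := by rw [ha]; ring
  generalize aw ω = a at *
  generalize Real.cosh (2 * y) = c at *
  generalize Real.sinh (2 * y) = s at *
  subst this
  linear_combination (-12 * a ^ 2) * hc

lemma deriv_Qw_div (ω y : ℝ) : deriv (Qw ω) y / Qw ω y = Rw ω y := by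
  rw [(hasDerivAt_Qw ω y).deriv, mul_div_cancel_right₀ _ (Qw_pos ω y).ne']

lemma abs_Rw_le {ω : ℝ} (hω : 0 < ω) (y : ℝ) : |Rw ω y| ≤ 1 := by
  rw [← sq_le_one_iff_abs_le_one, Rw_sq hω]
  have := Qw_pos ω y
  have : 0 ≤ Qw ω y ^ 2 / 2 + ω / 3 * Qw ω y ^ 4 := by positivity
  linarith

lemma Qw_sq_le_two {ω : ℝ} (hω : 0 < ω) (y : ℝ) : Qw ω y ^ 2 ≤ 2 := by
  rw [Qw_sq, div_le_iff₀ (den_pos ω y)]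
  nlinarith [one_le_aw hω, Real.one_le_cosh (2 * y)]

lemma exp_le_two_cosh (y : ℝ) : Real.exp (2 * |y|) ≤ 2 * Real.cosh (2 * y) := by
  have h : Real.cosh (2 * y) = Real.cosh (2 * |y|) := by
    rw [← Real.cosh_abs (2 * y), abs_mul, abs_two]
  rw [h, Real.cosh_eq]
  have := Real.exp_pos (-(2 * |y|))
  linarith

lemma cosh_le_exp_two_abs (y : ℝ) : Real.cosh (2 * y) ≤ Real.exp (2 * |y|) := by
  have h : Real.cosh (2 * y) = Real.cosh (2 * |y|) := by
    rw [← Real.cosh_abs (2 * y), abs_mul, abs_two]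
  rw [h, Real.cosh_eq]
  have : Real.exp (-(2 * |y|)) ≤ Real.exp (2 * |y|) :=
    Real.exp_le_exp.2 (by have := abs_nonneg y; linarith)
  linarith

lemma Qw_sq_le_exp {ω : ℝ} (hω : 0 < ω) (y : ℝ) : Qw ω y ^ 2 ≤ 8 * Real.exp (-(2 * |y|)) := by
  rw [Qw_sq, div_le_iff₀ (den_pos ω y), Real.exp_neg]
  have h := exp_le_two_cosh y
  have he := Real.exp_pos (2 * |y|)
  rw [mul_assoc, inv_mul_eq_div, mul_div_assoc', le_div_iff₀ he]
  nlinarith [one_le_aw hω, Real.one_le_cosh (2 * y)]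

lemma Qw_le_exp {ω : ℝ} (hω : 0 < ω) (y : ℝ) : Qw ω y ≤ 3 * Real.exp (-|y|) := by
  refine le_of_sq_le_sq ?_ (by positivity)
  refine (Qw_sq_le_exp hω y).trans ?_
  rw [mul_pow, ← Real.exp_nat_mul]
  have : ((2 : ℕ) : ℝ) * -|y| = -(2 * |y|) := by push_cast; ring
  rw [this]
  have := Real.exp_pos (-(2 * |y|))
  linarith

lemma Qw_le_two {ω : ℝ} (hω : 0 < ω) (y : ℝ) : Qw ω y ≤ 2 := by
  nlinarith [Qw_sq_le_two hω y, Qw_pos ω y]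

lemma Qw_four_le {ω : ℝ} (hω : 0 < ω) (y : ℝ) : Qw ω y ^ 4 ≤ 4 := by
  nlinarith [Qw_sq_le_two hω y, sq_nonneg (Qw ω y)]

lemma Qw_four_le_exp {ω : ℝ} (hω : 0 < ω) (y : ℝ) :
    Qw ω y ^ 4 ≤ 64 * Real.exp (-(4 * |y|)) := by
  have h := pow_le_pow_left₀ (sq_nonneg _) (Qw_sq_le_exp hω y) 2
  rw [mul_pow, ← Real.exp_nat_mul] at h
  have h2 : ((2 : ℕ) : ℝ) * -(2 * |y|) = -(4 * |y|) := by push_cast; ring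
  rw [h2] at h
  calc Qw ω y ^ 4 = (Qw ω y ^ 2) ^ 2 := by ring
    _ ≤ _ := h
    _ = _ := by norm_num

/-- For ω ≤ 1 one has a ≤ 3, so the denominator is at most 4e^{2|y|}. This lower bound serves to
keep the matching integral of the existence proof away from zero. -/
lemma exp_le_Qw_sq {ω : ℝ} (hω1 : ω ≤ 1) (y : ℝ) :
    Real.exp (-(2 * |y|)) ≤ Qw ω y ^ 2 := by
  rw [Qw_sq, le_div_iff₀ (den_pos ω y), Real.exp_neg, inv_mul_le_iff₀ (Real.exp_pos _)]
  have ha : aw ω ≤ 3 := by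
    rw [aw, Real.sqrt_le_left (by norm_num)]; linarith
  have h1 := cosh_le_exp_two_abs y
  have h2 := Real.one_le_cosh (2 * y)
  nlinarith

lemma contDiff_Qw (ω : ℝ) : ContDiff ℝ (⊤ : ℕ∞) (Qw ω) := by
  unfold Qw
  refine ContDiff.sqrt (ContDiff.div contDiff_const ?_ fun y => (den_pos ω y).ne') fun y =>
    (div_pos (by norm_num) (den_pos ω y)).ne'
  exact contDiff_const.add (contDiff_const.mul (Real.contDiff_cosh.comp
    (contDiff_const.mul contDiff_id)))

lemma continuous_Qw (ω : ℝ) : Continuous (Qw ω) := (contDiff_Qw ω).continuous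

lemma continuous_Rw {ω : ℝ} (hω : 0 < ω) : Continuous (Rw ω) :=
  continuous_iff_continuousAt.2 fun y => (hasDerivAt_Rw hω y).continuousAt

/-! ### Closed forms of the transformed solutions and the L-system. -/

/-- Closed form of the first component of `(S*)² f₁` for a solution of the transformed system. -/
noncomputable def fstForm (ω ν : ℝ) (f₁ f₂ : ℝ → ℝ) (y : ℝ) : ℝ :=
  (2 - Qw ω y ^ 2 - 2 / 3 * ω * Qw ω y ^ 4) * f₁ y - ν * f₂ y + 2 * Rw ω y * deriv f₁ y

/-- The derivative of `fstForm`. -/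
noncomputable def fstForm' (ω ν : ℝ) (f₁ f₂ : ℝ → ℝ) (y : ℝ) : ℝ :=
  (2 - 2 * Qw ω y ^ 2 - 2 * ω * Qw ω y ^ 4) * (deriv f₁ y + Rw ω y * f₁ y)
    - ν * (deriv f₂ y + 2 * Rw ω y * f₂ y)

/-- Closed form of the second component belonging to `fstForm`. -/
noncomputable def sndForm (ω ν : ℝ) (f₁ f₂ : ℝ → ℝ) (y : ℝ) : ℝ :=
  (2 + 2 / 3 * ω * Qw ω y ^ 4) * f₂ y - ν * f₁ y + 2 * Rw ω y * deriv f₂ y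

/-- The derivative of `sndForm`. -/
noncomputable def sndForm' (ω ν : ℝ) (f₁ f₂ : ℝ → ℝ) (y : ℝ) : ℝ :=
  (2 + 2 / 3 * ω * Qw ω y ^ 4) * Rw ω y * f₂ y
    + (2 - Qw ω y ^ 2 - 2 / 3 * ω * Qw ω y ^ 4) * deriv f₂ y
    - ν * (deriv f₁ y + 2 * Rw ω y * f₁ y)

lemma hasDerivAt_of_smooth {f : ℝ → ℝ} (hf : ContDiff ℝ (⊤ : ℕ∞) f) (y : ℝ) :
    HasDerivAt f (deriv f y) y :=
  (hf.differentiable (by simp) y).hasDerivAt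

lemma contDiff_deriv_of_smooth {f : ℝ → ℝ} (hf : ContDiff ℝ (⊤ : ℕ∞) f) :
    ContDiff ℝ (⊤ : ℕ∞) (deriv f) :=
  (contDiff_infty_iff_deriv.1 hf).2

section Solution

variable {ω ν : ℝ} {f₁ f₂ : ℝ → ℝ}

lemma SolvesM.hasDerivAt_deriv_fst (h : SolvesM ω ν f₁ f₂) (h₁ : ContDiff ℝ (⊤ : ℕ∞) f₁) (y : ℝ) :
    HasDerivAt (deriv f₁) (f₁ y + ω / 3 * Qw ω y ^ 4 * f₁ y - ν * f₂ y) y := by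
  refine (hasDerivAt_of_smooth (contDiff_deriv_of_smooth h₁) y).congr_deriv ?_
  have := h.1 y
  rw [Mplus] at this
  linarith

lemma SolvesM.hasDerivAt_deriv_snd (h : SolvesM ω ν f₁ f₂) (h₂ : ContDiff ℝ (⊤ : ℕ∞) f₂) (y : ℝ) :
    HasDerivAt (deriv f₂) (f₂ y - ω * Qw ω y ^ 4 * f₂ y - ν * f₁ y) y := by
  refine (hasDerivAt_of_smooth (contDiff_deriv_of_smooth h₂) y).congr_deriv ?_
  have := h.2 y
  rw [Mminus] at this
  linarith

lemma hasDerivAt_fstForm (hω : 0 < ω) (h : SolvesM ω ν f₁ f₂) (h₁ : ContDiff ℝ (⊤ : ℕ∞) f₁)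
    (h₂ : ContDiff ℝ (⊤ : ℕ∞) f₂) (y : ℝ) :
    HasDerivAt (fstForm ω ν f₁ f₂) (fstForm' ω ν f₁ f₂ y) y := by
  have hQ := hasDerivAt_Qw ω y
  have hR := hasDerivAt_Rw hω y
  have d1 := hasDerivAt_of_smooth h₁ y
  have d2 := hasDerivAt_of_smooth h₂ y
  have e1 := h.hasDerivAt_deriv_fst h₁ y
  have H := (((((hQ.fun_pow 2).const_sub 2).sub ((hQ.fun_pow 4).const_mul (2 / 3 * ω))).mul d1).sub
    (d2.const_mul ν)).add ((hR.const_mul 2).mul e1)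
  refine H.congr_deriv ?_
  simp only [fstForm', Pi.sub_apply]
  push_cast
  ring

/-- This is the intertwining relation in disguise: reducing second derivatives by the M-system
leaves forms linear in the jets, and the coefficients agree modulo `Rw_sq`. Together with
`hasDerivAt_sndForm'` it gives both L-equations without operator algebra. -/
lemma hasDerivAt_fstForm' (hω : 0 < ω) (h : SolvesM ω ν f₁ f₂) (h₁ : ContDiff ℝ (⊤ : ℕ∞) f₁)
    (h₂ : ContDiff ℝ (⊤ : ℕ∞) f₂) (y : ℝ) :
    HasDerivAt (fstForm' ω ν f₁ f₂) (fstForm ω ν f₁ f₂ y - 3 * Qw ω y ^ 2 * fstForm ω ν f₁ f₂ y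
      - 5 * ω * Qw ω y ^ 4 * fstForm ω ν f₁ f₂ y - ν * sndForm ω ν f₁ f₂ y) y := by
  have hQ := hasDerivAt_Qw ω y
  have hR := hasDerivAt_Rw hω y
  have d1 := hasDerivAt_of_smooth h₁ y
  have d2 := hasDerivAt_of_smooth h₂ y
  have e1 := h.hasDerivAt_deriv_fst h₁ y
  have e2 := h.hasDerivAt_deriv_snd h₂ y
  have H := (((((hQ.fun_pow 2).const_mul 2).const_sub 2).sub ((hQ.fun_pow 4).const_mul (2 * ω))).mul
    (e1.add (hR.mul d1))).sub ((e2.add ((hR.const_mul 2).mul d2)).const_mul ν)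
  refine H.congr_deriv ?_
  have hRs := Rw_sq hω y
  simp only [fstForm, sndForm, Pi.sub_apply, Pi.mul_apply, Pi.add_apply]
  push_cast
  generalize Qw ω y = Q at *
  generalize Rw ω y = R at *
  linear_combination (-4 * Q ^ 2 - 8 * ω * Q ^ 4) * f₁ y * hRs

lemma hasDerivAt_sndForm (hω : 0 < ω) (h : SolvesM ω ν f₁ f₂) (h₁ : ContDiff ℝ (⊤ : ℕ∞) f₁)
    (h₂ : ContDiff ℝ (⊤ : ℕ∞) f₂) (y : ℝ) :
    HasDerivAt (sndForm ω ν f₁ f₂) (sndForm' ω ν f₁ f₂ y) y := by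
  have hQ := hasDerivAt_Qw ω y
  have hR := hasDerivAt_Rw hω y
  have d1 := hasDerivAt_of_smooth h₁ y
  have d2 := hasDerivAt_of_smooth h₂ y
  have e2 := h.hasDerivAt_deriv_snd h₂ y
  have H := (((((hQ.fun_pow 4).const_mul (2 / 3 * ω)).const_add 2).mul d2).sub
    (d1.const_mul ν)).add ((hR.const_mul 2).mul e2)
  refine H.congr_deriv ?_
  simp only [sndForm']
  push_cast
  ring

lemma hasDerivAt_sndForm' (hω : 0 < ω) (h : SolvesM ω ν f₁ f₂) (h₁ : ContDiff ℝ (⊤ : ℕ∞) f₁)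
    (h₂ : ContDiff ℝ (⊤ : ℕ∞) f₂) (y : ℝ) :
    HasDerivAt (sndForm' ω ν f₁ f₂) (sndForm ω ν f₁ f₂ y - Qw ω y ^ 2 * sndForm ω ν f₁ f₂ y
      - ω * Qw ω y ^ 4 * sndForm ω ν f₁ f₂ y - ν * fstForm ω ν f₁ f₂ y) y := by
  have hQ := hasDerivAt_Qw ω y
  have hR := hasDerivAt_Rw hω y
  have d1 := hasDerivAt_of_smooth h₁ y
  have d2 := hasDerivAt_of_smooth h₂ y
  have e1 := h.hasDerivAt_deriv_fst h₁ y
  have e2 := h.hasDerivAt_deriv_snd h₂ y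
  have H := (((((((hQ.fun_pow 4).const_mul (2 / 3 * ω)).const_add 2).mul hR).mul d2).add
    ((((hQ.fun_pow 2).const_sub 2).sub ((hQ.fun_pow 4).const_mul (2 / 3 * ω))).mul e2))).sub
    ((e1.add ((hR.const_mul 2).mul d1)).const_mul ν)
  refine H.congr_deriv ?_
  have hRs := Rw_sq hω y
  simp only [fstForm, sndForm, Pi.sub_apply, Pi.mul_apply]
  push_cast
  generalize Qw ω y = Q at *
  generalize Rw ω y = R at *
  linear_combination (8 / 3 * ω * Q ^ 4) * f₂ y * hRs

lemma fstComp_eq (hω : 0 < ω) (h : SolvesM ω ν f₁ f₂) (h₁ : ContDiff ℝ (⊤ : ℕ∞) f₁) :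
    fstComp ω f₁ = fstForm ω ν f₁ f₂ := by
  have hS : Sstar ω f₁ = fun y => -deriv f₁ y - Rw ω y * f₁ y := by
    funext y; rw [Sstar, deriv_Qw_div]
  funext y
  have hR := hasDerivAt_Rw hω y
  have d1 := hasDerivAt_of_smooth h₁ y
  have e1 := h.hasDerivAt_deriv_fst h₁ y
  have H := e1.fun_neg.fun_sub (hR.fun_mul d1)
  rw [fstComp, hS, Sstar, deriv_Qw_div, H.deriv, fstForm]
  have hRs := Rw_sq hω y
  linear_combination f₁ y * hRs

lemma deriv_deriv_eq {f f' f'' : ℝ → ℝ} (h : ∀ y, HasDerivAt f (f' y) y)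
    (h' : ∀ y, HasDerivAt f' (f'' y) y) (y : ℝ) : deriv (deriv f) y = f'' y := by
  have : deriv f = f' := funext fun y => (h y).deriv
  rw [this, (h' y).deriv]

/-- Applying L₊ to the first form produces ν times the second, so dividing by ν recovers an
expression containing only first derivatives. -/
lemma sndComp_eq (hω : 0 < ω) (hν : ν ≠ 0) (h : SolvesM ω ν f₁ f₂) (h₁ : ContDiff ℝ (⊤ : ℕ∞) f₁)
    (h₂ : ContDiff ℝ (⊤ : ℕ∞) f₂) : sndComp ω ν f₁ = sndForm ω ν f₁ f₂ := by
  funext y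
  rw [sndComp, fstComp_eq hω h h₁, Lplus, deriv_deriv_eq (hasDerivAt_fstForm hω h h₁ h₂)
    (hasDerivAt_fstForm' hω h h₁ h₂)]
  field_simp
  ring

lemma solvesL_forms (hω : 0 < ω) (h : SolvesM ω ν f₁ f₂) (h₁ : ContDiff ℝ (⊤ : ℕ∞) f₁)
    (h₂ : ContDiff ℝ (⊤ : ℕ∞) f₂) : SolvesL ω ν (fstForm ω ν f₁ f₂) (sndForm ω ν f₁ f₂) := by
  refine ⟨fun y => ?_, fun y => ?_⟩
  · rw [Lplus, deriv_deriv_eq (hasDerivAt_fstForm hω h h₁ h₂) (hasDerivAt_fstForm' hω h h₁ h₂)]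
    ring
  · rw [Lminus, deriv_deriv_eq (hasDerivAt_sndForm hω h h₁ h₂) (hasDerivAt_sndForm' hω h h₁ h₂)]
    ring

end Solution

/-! ### Maximum principles -/

/-- A positive second derivative would also make the point a local minimum; the function would then
be locally constant and its second derivative zero. -/
lemma second_deriv_nonpos_of_isLocalMax {w w' : ℝ → ℝ} {y b : ℝ}
    (h : ∀ᶠ x in 𝓝 y, HasDerivAt w (w' x) x) (h' : HasDerivAt w' b y) (hm : IsLocalMax w y) :
    b ≤ 0 := by
  by_contra! hb
  have hd : deriv w =ᶠ[𝓝 y] w' := h.mono fun x hx => hx.deriv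
  have hdd : deriv (deriv w) y = b := by rw [hd.deriv_eq, h'.deriv]
  have h0 : deriv w y = 0 := hm.deriv_eq_zero
  have hmin : IsLocalMin w y := isLocalMin_of_deriv_deriv_pos (by rw [hdd]; exact hb) h0
    h.self_of_nhds.continuousAt
  have hc : w =ᶠ[𝓝 y] fun _ => w y := by
    filter_upwards [hm, hmin] with x h1 h2 using le_antisymm h1 h2
  have hz : deriv w =ᶠ[𝓝 y] fun _ => 0 := by
    filter_upwards [hc.eventuallyEq_nhds] with x hx
    rw [hx.deriv_eq, deriv_const]
  rw [hz.deriv_eq, deriv_const] at hdd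
  exact hb.ne hdd

lemma tendsto_sq_cocompact : Tendsto (fun y : ℝ => y ^ 2) (cocompact ℝ) atTop := by
  have h := (tendsto_pow_atTop (two_ne_zero)).comp (tendsto_norm_cocompact_atTop (E := ℝ))
  refine h.congr fun y => ?_
  simp

/-- Subtracting εy² makes the maximum attained. There w'' ≤ 2ε, so the differential inequality
bounds w by (g + 2ε)/c at that point, and ε → 0 concludes. -/
lemma le_of_bounded_of_second_deriv {w w' w'' : ℝ → ℝ} {c g M : ℝ} (hc : 0 < c)
    (h : ∀ y, HasDerivAt w (w' y) y) (h' : ∀ y, HasDerivAt w' (w'' y) y)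
    (hM : ∀ y, w y ≤ M) (hg : ∀ y, c * w y - g ≤ w'' y) (x : ℝ) : w x ≤ g / c := by
  have key : ∀ ε > 0, w x ≤ g / c + ε * (x ^ 2 + 2 / c) := by
    intro ε hε
    let z : ℝ → ℝ := fun y => ε * (y ^ 2 + 2 / c) - w y
    have hz : ∀ y, HasDerivAt (fun y => -z y) (w' y - ε * (2 * y)) y := fun y => by
      have := (h y).sub ((((hasDerivAt_id y).pow 2).add_const (2 / c)).const_mul ε)
      refine (this.congr_deriv (by simp)).congr_of_eventuallyEq (Eventually.of_forall fun t => ?_)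
      simp [z]
    have hz' : ∀ y, HasDerivAt (fun y => w' y - ε * (2 * y)) (w'' y - ε * 2) y := fun y => by
      have := (h' y).sub (((hasDerivAt_id y).const_mul 2).const_mul ε)
      exact this.congr_deriv (by simp)
    have hcont : Continuous z := by
      have : Continuous w := continuous_iff_continuousAt.2 fun y => (h y).continuousAt
      fun_prop
    have htend : Tendsto z (cocompact ℝ) atTop := by
      refine tendsto_atTop_mono (f := fun y => ε * y ^ 2 + -M) (fun y => ?_) ?_
      · have : 0 ≤ ε * (2 / c) := by positivity
        have := hM y
        simp only [z]
        nlinarith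
      · exact tendsto_atTop_add_const_right _ _ (tendsto_sq_cocompact.const_mul_atTop hε)
    obtain ⟨ym, hm⟩ := hcont.exists_forall_le htend
    have hmax : IsLocalMax (fun y => -z y) ym := Eventually.of_forall fun y => neg_le_neg (hm y)
    have h2 := second_deriv_nonpos_of_isLocalMax (Eventually.of_forall hz) (hz' ym) hmax
    have h3 := hg ym
    have h4 : w ym ≤ g / c + ε * (2 / c) := by
      rw [show g / c + ε * (2 / c) = (g + ε * 2) / c by ring, le_div_iff₀ hc]
      linarith
    have h5 := hm x
    simp only [z] at h5
    nlinarith [sq_nonneg ym]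
  refine le_of_forall_pos_le_add fun δ hδ => ?_
  have hp : 0 < x ^ 2 + 2 / c := by positivity
  have := key (δ / (x ^ 2 + 2 / c)) (by positivity)
  rwa [div_mul_cancel₀ _ hp.ne'] at this

lemma abs_le_of_bounded_of_second_deriv {w w' w'' : ℝ → ℝ} {c g M : ℝ} (hc : 0 < c)
    (h : ∀ y, HasDerivAt w (w' y) y) (h' : ∀ y, HasDerivAt w' (w'' y) y)
    (hM : ∀ y, |w y| ≤ M) (hg : ∀ y, |w'' y - c * w y| ≤ g) (x : ℝ) : |w x| ≤ g / c := by
  refine abs_le.2 ⟨?_, ?_⟩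
  · have := le_of_bounded_of_second_deriv (w := fun y => -w y) (w'' := fun y => -w'' y) hc
      (fun y => (h y).neg) (fun y => (h' y).neg) (M := M) (g := g)
      (fun y => (neg_le_abs _).trans (hM y)) (fun y => by
        have := (abs_le.1 (hg y)).2
        linarith) x
    linarith
  · exact le_of_bounded_of_second_deriv hc h h' (fun y => (le_abs_self _).trans (hM y))
      (fun y => by have := (abs_le.1 (hg y)).1; linarith) x

/-- A positive value would force a positive maximum, which neither the origin nor infinity can
carry; at an interior maximum w'' ≤ 0, against `hw`. Applied to w minus a barrier, this gives the
pointwise bounds below. -/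
lemma nonpos_of_second_deriv_halfLine {w w' w'' : ℝ → ℝ} {l : ℝ}
    (h : ∀ y, HasDerivAt w (w' y) y) (h' : ∀ y, HasDerivAt w' (w'' y) y) (h0 : w 0 ≤ 0)
    (hl : l ≤ 0) (hlim : Tendsto w atTop (𝓝 l)) (hw : ∀ y > 0, 0 < w y → 0 < w'' y)
    {x : ℝ} (hx : 0 ≤ x) : w x ≤ 0 := by
  by_contra! hpos
  have hcont : Continuous w := continuous_iff_continuousAt.2 fun y => (h y).continuousAt
  obtain ⟨N, hN⟩ := eventually_atTop.1 (hlim.eventually (gt_mem_nhds (hl.trans_lt hpos)))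
  obtain ⟨ym, hym, hmax⟩ := (isCompact_Icc (a := (0 : ℝ)) (b := max N x)).exists_isMaxOn
    ⟨x, hx, le_max_right _ _⟩ hcont.continuousOn
  have hge : w x ≤ w ym := hmax ⟨hx, le_max_right _ _⟩
  have hym0 : 0 < ym := by
    rcases hym.1.eq_or_lt with h | h
    · rw [← h] at hge; linarith
    · exact h
  have hloc : IsLocalMax w ym := by
    filter_upwards [Ioi_mem_nhds hym0] with y hy
    rcases le_total y (max N x) with h | h
    · exact hmax ⟨le_of_lt hy, h⟩
    · exact ((hN y ((le_max_left _ _).trans h)).le).trans hge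
  have := second_deriv_nonpos_of_isLocalMax (Eventually.of_forall h) (h' ym) hloc
  exact absurd (hw ym hym0 (hpos.trans_le hge)) (not_lt.2 this)

lemma hasDerivAt_exp_neg_mul (b y : ℝ) :
    HasDerivAt (fun y => Real.exp (-(b * y))) (-b * Real.exp (-(b * y))) y := by
  have := ((hasDerivAt_id y).const_mul b).neg.exp
  exact this.congr_deriv (by simp only [id, mul_one, Pi.neg_apply]; ring)

lemma tendsto_exp_neg_mul {b : ℝ} (hb : 0 < b) :
    Tendsto (fun y => Real.exp (-(b * y))) atTop (𝓝 0) :=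
  Real.tendsto_exp_neg_atTop_nhds_zero.comp (tendsto_id.const_mul_atTop hb)

/-- The barrier |w 0| + F − F e^{−2y} has second derivative −4F e^{−2y}, which beats the source. The
bound does not involve c, which is essential since it is used with c = α² of order ω². -/
lemma abs_le_add_of_source_exp {w w' w'' : ℝ → ℝ} {c F : ℝ} (hc : 0 < c) (hF : 0 ≤ F)
    (h : ∀ y, HasDerivAt w (w' y) y) (h' : ∀ y, HasDerivAt w' (w'' y) y)
    (hlim : Tendsto w atTop (𝓝 0))
    (hw : ∀ y > 0, |w'' y - c * w y| ≤ F * Real.exp (-(2 * y))) {x : ℝ} (hx : 0 ≤ x) :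
    |w x| ≤ |w 0| + F := by
  have main : ∀ (w w' w'' : ℝ → ℝ), (∀ y, HasDerivAt w (w' y) y) → (∀ y, HasDerivAt w' (w'' y) y) →
      Tendsto w atTop (𝓝 0) → (∀ y > 0, |w'' y - c * w y| ≤ F * Real.exp (-(2 * y))) →
      w x ≤ |w 0| + F := by
    intro w w' w'' h h' hlim hw
    have e := hasDerivAt_exp_neg_mul 2
    have key := nonpos_of_second_deriv_halfLine
      (w := fun y => w y + (F * Real.exp (-(2 * y)) - (|w 0| + F)))
      (w' := fun y => w' y + F * (-2 * Real.exp (-(2 * y))))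
      (w'' := fun y => w'' y + F * (-2 * (-2 * Real.exp (-(2 * y))))) (l := -(|w 0| + F))
      (fun y => (h y).add (((e y).const_mul F).sub_const _))
      (fun y => (h' y).add (((e y).const_mul (-2)).const_mul F))
      (by simp [le_abs_self]) (by have := abs_nonneg (w 0); linarith)
      (by
        have := hlim.add (((tendsto_exp_neg_mul (b := 2) (by norm_num)).const_mul F).sub_const
          (|w 0| + F))
        simpa using this)
      (by
        intro y hy hpos
        have h1 := (abs_le.1 (hw y hy)).1
        have h2 := Real.exp_pos (-(2 * y))
        have h2' : Real.exp (-(2 * y)) ≤ 1 := Real.exp_le_one_iff.2 (by linarith)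
        have h3 := abs_nonneg (w 0)
        have h4 : 0 ≤ F * Real.exp (-(2 * y)) := by positivity
        have h5 : 0 < w y := by nlinarith
        have h6 : 0 < c * w y := by positivity
        nlinarith) hx
    have := Real.exp_pos (-(2 * x))
    have : 0 ≤ F * Real.exp (-(2 * x)) := by positivity
    linarith
  refine abs_le.2 ⟨?_, main w w' w'' h h' hlim hw⟩
  have := main (fun y => -w y) (fun y => -w' y) (fun y => -w'' y) (fun y => (h y).neg)
    (fun y => (h' y).neg) (by simpa using hlim.neg) (fun y hy => by
      have := hw y hy
      rwa [show -w'' y - c * -w y = -(w'' y - c * w y) by ring, abs_neg])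
  rw [abs_neg] at this
  linarith

/-- Comparison with A e^{−βy}, a strict supersolution once A(c − β²) exceeds F; the summand 1 in F +
1 supplies the strictness. -/
lemma abs_le_exp_of_source_exp {w w' w'' : ℝ → ℝ} {c F β : ℝ} (hβ : 0 < β) (hc : β ^ 2 < c)
    (hF : 0 ≤ F) (h : ∀ y, HasDerivAt w (w' y) y) (h' : ∀ y, HasDerivAt w' (w'' y) y)
    (hlim : Tendsto w atTop (𝓝 0))
    (hw : ∀ y > 0, |w'' y - c * w y| ≤ F * Real.exp (-(β * y))) {x : ℝ} (hx : 0 ≤ x) :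
    |w x| ≤ (|w 0| + (F + 1) / (c - β ^ 2)) * Real.exp (-(β * x)) := by
  set A := |w 0| + (F + 1) / (c - β ^ 2) with hA
  have hcβ : 0 < c - β ^ 2 := by linarith
  have hA0 : |w 0| ≤ A := by
    have : 0 ≤ (F + 1) / (c - β ^ 2) := by positivity
    linarith
  have hAF : F + 1 ≤ A * (c - β ^ 2) := by
    rw [hA, add_mul, div_mul_cancel₀ _ hcβ.ne']
    have := abs_nonneg (w 0)
    nlinarith
  have main : ∀ (w w' w'' : ℝ → ℝ), |w 0| ≤ A → (∀ y, HasDerivAt w (w' y) y) →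
      (∀ y, HasDerivAt w' (w'' y) y) → Tendsto w atTop (𝓝 0) →
      (∀ y > 0, |w'' y - c * w y| ≤ F * Real.exp (-(β * y))) →
      w x ≤ A * Real.exp (-(β * x)) := by
    intro w w' w'' hA0 h h' hlim hw
    have e := hasDerivAt_exp_neg_mul β
    have key := nonpos_of_second_deriv_halfLine
      (w := fun y => w y - A * Real.exp (-(β * y)))
      (w' := fun y => w' y - A * (-β * Real.exp (-(β * y))))
      (w'' := fun y => w'' y - A * (-β * (-β * Real.exp (-(β * y))))) (l := 0)
      (fun y => (h y).sub ((e y).const_mul A))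
      (fun y => (h' y).sub (((e y).const_mul (-β)).const_mul A))
      (by simpa using (le_abs_self _).trans hA0) le_rfl
      (by simpa using hlim.sub ((tendsto_exp_neg_mul hβ).const_mul A))
      (by
        intro y hy hpos
        have h1 := (abs_le.1 (hw y hy)).1
        have h2 := Real.exp_pos (-(β * y))
        have hc0 : 0 < c := by nlinarith [sq_nonneg β]
        have h3 : c * (A * Real.exp (-(β * y))) < c * w y := by
          apply mul_lt_mul_of_pos_left _ hc0
          linarith
        have h4 := mul_le_mul_of_nonneg_right hAF h2.le
        nlinarith) hx
    linarith
  refine abs_le.2 ⟨?_, main w w' w'' hA0 h h' hlim hw⟩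
  have := main (fun y => -w y) (fun y => -w' y) (fun y => -w'' y) (by simpa using hA0)
    (fun y => (h y).neg) (fun y => (h' y).neg) (by simpa using hlim.neg) (fun y hy => by
      have := hw y hy
      rwa [show -w'' y - c * -w y = -(w'' y - c * w y) by ring, abs_neg])
  linarith

/-- Interpolation on a unit interval: somewhere w' equals w(y + 1) − w(y), and w' moves by at most b
between that point and y. -/
lemma abs_deriv_le_of_bounds {w w' w'' : ℝ → ℝ} {a b y : ℝ} (h : ∀ y, HasDerivAt w (w' y) y)
    (h' : ∀ y, HasDerivAt w' (w'' y) y) (ha : ∀ z ∈ Icc y (y + 1), |w z| ≤ a)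
    (hb : ∀ z ∈ Icc y (y + 1), |w'' z| ≤ b) : |w' y| ≤ 2 * a + b := by
  obtain ⟨ξ, hξ, e1⟩ := exists_hasDerivAt_eq_slope w w' (lt_add_one y)
    (fun z _ => (h z).continuousAt.continuousWithinAt) (fun z _ => h z)
  obtain ⟨η, hη, e2⟩ := exists_hasDerivAt_eq_slope w' w'' hξ.1
    (fun z _ => (h' z).continuousAt.continuousWithinAt) (fun z _ => h' z)
  have h1 := ha y ⟨le_rfl, by linarith⟩
  have h2 := ha (y + 1) ⟨by linarith, le_rfl⟩
  have h3 := hb η ⟨hη.1.le, by linarith [hη.2, hξ.2]⟩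
  have hd : 0 < ξ - y := by linarith [hξ.1]
  rw [eq_div_iff hd.ne'] at e2
  have e1' : w' ξ = w (y + 1) - w y := by rw [e1]; simp
  have h4 : |w'' η * (ξ - y)| ≤ b := by
    rw [abs_mul, abs_of_pos hd]
    have : ξ - y ≤ 1 := by linarith [hξ.2]
    nlinarith [abs_nonneg (w'' η)]
  have : w' y = w (y + 1) - w y - w'' η * (ξ - y) := by rw [e2, e1']; ring
  rw [this]
  have := abs_sub (w (y + 1) - w y) (w'' η * (ξ - y))
  have := abs_sub (w (y + 1)) (w y)
  linarith

/-! ### Exponentially decaying functions -/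

/-- `f = O(e^{-β|y|})` on the whole line. -/
def ExpDecay (β : ℝ) (f : ℝ → ℝ) : Prop := ∃ K, ∀ y, |f y| ≤ K * Real.exp (-(β * |y|))

namespace ExpDecay

variable {β γ : ℝ} {f g : ℝ → ℝ}

lemma exists_nonneg (hf : ExpDecay β f) :
    ∃ K, 0 ≤ K ∧ ∀ y, |f y| ≤ K * Real.exp (-(β * |y|)) := by
  obtain ⟨K, hK⟩ := hf
  refine ⟨K, ?_, hK⟩
  have := (abs_nonneg _).trans (hK 0)
  simpa using this

lemma add (hf : ExpDecay β f) (hg : ExpDecay β g) : ExpDecay β fun y => f y + g y := by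
  obtain ⟨K, hK⟩ := hf
  obtain ⟨L, hL⟩ := hg
  refine ⟨K + L, fun y => (abs_add_le _ _).trans ?_⟩
  rw [add_mul]
  exact add_le_add (hK y) (hL y)

lemma neg (hf : ExpDecay β f) : ExpDecay β fun y => -f y := by
  obtain ⟨K, hK⟩ := hf
  exact ⟨K, fun y => by rw [abs_neg]; exact hK y⟩

lemma sub (hf : ExpDecay β f) (hg : ExpDecay β g) : ExpDecay β fun y => f y - g y := by
  simpa only [sub_eq_add_neg] using hf.add hg.neg

lemma mul (hf : ExpDecay β f) (hg : ExpDecay γ g) : ExpDecay (β + γ) fun y => f y * g y := by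
  obtain ⟨K, hK0, hK⟩ := hf.exists_nonneg
  obtain ⟨L, hL⟩ := hg
  refine ⟨K * L, fun y => ?_⟩
  rw [abs_mul]
  refine (mul_le_mul (hK y) (hL y) (abs_nonneg _) (by positivity)).trans_eq ?_
  rw [show -((β + γ) * |y|) = -(β * |y|) + -(γ * |y|) by ring, Real.exp_add]
  ring

lemma mul_bdd (hf : ExpDecay β f) (hg : ExpDecay 0 g) : ExpDecay β fun y => f y * g y := by
  simpa using hf.mul hg

lemma bdd_mul (hf : ExpDecay 0 f) (hg : ExpDecay β g) : ExpDecay β fun y => f y * g y := by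
  simpa using hf.mul hg

lemma mono (hf : ExpDecay β f) (h : γ ≤ β) : ExpDecay γ f := by
  obtain ⟨K, hK0, hK⟩ := hf.exists_nonneg
  refine ⟨K, fun y => (hK y).trans ?_⟩
  have := mul_le_mul_of_nonneg_right h (abs_nonneg y)
  gcongr

lemma const (c : ℝ) : ExpDecay 0 fun _ => c := ⟨|c|, fun y => by simp⟩

lemma of_bound {K : ℝ} (h : ∀ y, |f y| ≤ K) : ExpDecay 0 f := ⟨K, fun y => by simpa using h y⟩

lemma pow (hf : ExpDecay 0 f) (n : ℕ) : ExpDecay 0 fun y => f y ^ n := by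
  induction n with
  | zero => simpa using const 1
  | succ n ih => simpa only [pow_succ] using ih.mul_bdd hf

lemma bound (hf : ExpDecay 0 f) : ∃ K, ∀ y, |f y| ≤ K := by
  obtain ⟨K, hK⟩ := hf
  exact ⟨K, fun y => by simpa using hK y⟩

end ExpDecay

lemma integrable_exp_neg_abs {β : ℝ} (hβ : 0 < β) :
    Integrable fun y : ℝ => Real.exp (-(β * |y|)) := by
  rw [← integrableOn_univ, ← Iic_union_Ioi (a := (0 : ℝ))]
  refine IntegrableOn.union ?_ ?_
  · refine (integrableOn_exp_mul_Iic hβ 0).congr_fun (fun y hy => ?_) measurableSet_Iic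
    simp only [abs_of_nonpos (mem_Iic.1 hy)]
    ring_nf
  · refine (exp_neg_integrableOn_Ioi 0 hβ).congr_fun (fun y hy => ?_) measurableSet_Ioi
    simp only [abs_of_pos (mem_Ioi.1 hy)]
    ring_nf

lemma ExpDecay.integrable {β : ℝ} {f : ℝ → ℝ} (hf : ExpDecay β f) (hβ : 0 < β)
    (hc : Continuous f) : Integrable f := by
  obtain ⟨K, hK⟩ := hf
  exact ((integrable_exp_neg_abs hβ).const_mul K).mono' hc.aestronglyMeasurable
    (Eventually.of_forall fun y => by simpa using hK y)

lemma continuous_of_hasDerivAt {f f' : ℝ → ℝ} (h : ∀ y, HasDerivAt f (f' y) y) : Continuous f :=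
  continuous_iff_continuousAt.2 fun y => (h y).continuousAt

lemma integral_mul_deriv_of_expDecay {β : ℝ} (hβ : 0 < β) {f f' g g' : ℝ → ℝ}
    (hf : ∀ y, HasDerivAt f (f' y) y) (hg : ∀ y, HasDerivAt g (g' y) y)
    (cf' : Continuous f') (cg' : Continuous g') (df : ExpDecay β f) (df' : ExpDecay β f')
    (dg : ExpDecay 0 g) (dg' : ExpDecay 0 g') : ∫ y, f y * g' y = -∫ y, f' y * g y := by
  have cf := continuous_of_hasDerivAt hf
  have cg := continuous_of_hasDerivAt hg
  exact integral_mul_deriv_eq_deriv_mul_of_integrable (fun y _ => hf y) (fun y _ => hg y)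
    ((df.mul_bdd dg').integrable hβ (cf.mul cg')) ((df'.mul_bdd dg).integrable hβ (cf'.mul cg))
    ((df.mul_bdd dg).integrable hβ (cf.mul cg))

lemma integral_mul_second_deriv_comm {β : ℝ} (hβ : 0 < β) {f f' f'' g g' g'' : ℝ → ℝ}
    (hf : ∀ y, HasDerivAt f (f' y) y) (hf' : ∀ y, HasDerivAt f' (f'' y) y)
    (hg : ∀ y, HasDerivAt g (g' y) y) (hg' : ∀ y, HasDerivAt g' (g'' y) y)
    (cf'' : Continuous f'') (cg'' : Continuous g'') (df : ExpDecay β f) (df' : ExpDecay β f')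
    (df'' : ExpDecay β f'') (dg : ExpDecay 0 g) (dg' : ExpDecay 0 g') (dg'' : ExpDecay 0 g'') :
    ∫ y, f y * g'' y = ∫ y, f'' y * g y := by
  have cf' := continuous_of_hasDerivAt hf'
  have cg' := continuous_of_hasDerivAt hg'
  rw [integral_mul_deriv_of_expDecay hβ hf hg' cf' cg'' df df' dg' dg'',
    integral_mul_deriv_of_expDecay hβ hf' hg cf'' cg' df' df'' dg dg', neg_neg]

/-! ### Parity, suprema and half-line integrals. -/

lemma odd_of_hasDerivAt_even {u u' : ℝ → ℝ} (hu : ∀ y, HasDerivAt u (u' y) y)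
    (he : Function.Even u) (y : ℝ) : u' (-y) = -u' y := by
  have h1 : HasDerivAt (fun x => u (-x)) (u' (-y) * -1) y :=
    (hu (-y)).comp y (hasDerivAt_neg y)
  have h2 : (fun x => u (-x)) = u := funext he
  rw [h2] at h1
  linarith [h1.unique (hu y)]

lemma deriv_zero_of_hasDerivAt_even {u u' : ℝ → ℝ} (hu : ∀ y, HasDerivAt u (u' y) y)
    (he : Function.Even u) : u' 0 = 0 := by
  have := odd_of_hasDerivAt_even hu he 0
  rw [neg_zero] at this
  linarith

lemma even_apply_abs {u : ℝ → ℝ} (he : Function.Even u) (y : ℝ) : u |y| = u y := by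
  rcases abs_choice y with h | h <;> rw [h]
  exact he y

lemma bounded_of_tendsto_cocompact {u : ℝ → ℝ} (hc : Continuous u)
    (h : Tendsto u (cocompact ℝ) (𝓝 0)) : ∃ M, ∀ y, |u y| ≤ M := by
  have h1 : ∀ᶠ y in cocompact ℝ, |u y| < 1 := by
    have := h.abs
    rw [abs_zero] at this
    exact this.eventually (gt_mem_nhds one_pos)
  obtain ⟨K, hK, hKs⟩ := Filter.mem_cocompact.1 h1
  obtain ⟨C, hC⟩ := hK.exists_bound_of_continuousOn hc.continuousOn
  refine ⟨max C 1, fun y => ?_⟩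
  by_cases hy : y ∈ K
  · exact (hC y hy).trans (le_max_left _ _)
  · exact (le_of_lt (hKs hy)).trans (le_max_right _ _)

/-- The minimality clause lets a pointwise bound of the form a + cωM be read as an inequality for M
itself, in which cωM is absorbed. All a priori estimates close in this way. -/
lemma exists_sup_bound {u : ℝ → ℝ} (h : ∃ M, ∀ y, |u y| ≤ M) :
    ∃ M, 0 ≤ M ∧ (∀ y, |u y| ≤ M) ∧ ∀ M', (∀ y, |u y| ≤ M') → M ≤ M' := by
  obtain ⟨M, hM⟩ := h
  have hb : BddAbove (range fun y => |u y|) := ⟨M, by rintro _ ⟨y, rfl⟩; exact hM y⟩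
  exact ⟨⨆ y, |u y|, (abs_nonneg (u 0)).trans (le_ciSup hb 0), le_ciSup hb,
    fun M' h => ciSup_le h⟩

lemma integrableOn_exp_neg_mul {b : ℝ} (hb : 0 < b) (y : ℝ) :
    IntegrableOn (fun z => Real.exp (-(b * z))) (Ioi y) := by
  simpa only [neg_mul] using exp_neg_integrableOn_Ioi y hb

lemma integral_exp_neg_mul {b : ℝ} (hb : 0 < b) (y : ℝ) :
    ∫ z in Ioi y, Real.exp (-(b * z)) = Real.exp (-(b * y)) / b := by
  have := integral_exp_mul_Ioi (neg_neg_of_pos hb) y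
  simp only [neg_mul] at this
  rw [this, neg_div_neg_eq]

lemma integrableOn_of_le_exp {f : ℝ → ℝ} {F b y : ℝ} (hb : 0 < b)
    (hf : Continuous f) (h : ∀ z > y, |f z| ≤ F * Real.exp (-(b * z))) : IntegrableOn f (Ioi y) := by
  refine ((integrableOn_exp_neg_mul hb y).const_mul F).mono' hf.aestronglyMeasurable ?_
  exact (ae_restrict_mem measurableSet_Ioi).mono fun z hz => h z hz

lemma abs_integral_Ioi_le {f : ℝ → ℝ} {F b y : ℝ} (hb : 0 < b)
    (h : ∀ z > y, |f z| ≤ F * Real.exp (-(b * z))) :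
    |∫ z in Ioi y, f z| ≤ F * (Real.exp (-(b * y)) / b) := by
  rw [← integral_exp_neg_mul hb y, ← integral_const_mul]
  exact norm_integral_le_of_norm_le ((integrableOn_exp_neg_mul hb y).const_mul F)
    ((ae_restrict_mem measurableSet_Ioi).mono fun z hz => by rw [Real.norm_eq_abs]; exact h z hz)

/-! ### A priori estimates for the slow and the oscillating component. -/

/-- Even decaying solutions of `u'' = α² u - f` with small localised source of total mass `4 α`. -/
lemma slow_mode_bounds {u u' f : ℝ → ℝ} {α F : ℝ} (hα : 0 < α) (hF : 0 ≤ F)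
    (hu : ∀ y, HasDerivAt u (u' y) y) (hu' : ∀ y, HasDerivAt u' (α ^ 2 * u y - f y) y)
    (he : Function.Even u) (hlim : Tendsto u (cocompact ℝ) (𝓝 0)) (hf : Continuous f)
    (hfe : Function.Even f) (hfF : ∀ y, |f y| ≤ F * Real.exp (-(4 * |y|)))
    (hn : ∫ y, f y = 4 * α) :
    |u 0 - 2| ≤ F / 3 ∧ α ≤ F / 8 ∧ (∀ y, |u y| ≤ |u 0| + F) ∧
      ∀ y, |u' y| ≤ F / 4 + α * (|u 0| + F) := by
  have hfF' : ∀ y > 0, |f y| ≤ F * Real.exp (-(4 * y)) := fun y hy => by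
    simpa only [abs_of_pos hy] using hfF y
  have hutop : Tendsto u atTop (𝓝 0) := hlim.mono_left atTop_le_cocompact
  have hbd : ∀ y, |u y| ≤ |u 0| + F := by
    intro y
    rw [← even_apply_abs he y]
    refine abs_le_add_of_source_exp (pow_pos hα 2) hF hu hu' hutop (fun z hz => ?_) (abs_nonneg y)
    rw [show α ^ 2 * u z - f z - α ^ 2 * u z = -f z by ring, abs_neg]
    refine (hfF' z hz).trans (mul_le_mul_of_nonneg_left (Real.exp_le_exp.2 (by linarith)) hF)
  have hf1 : ∀ y, |f y| ≤ F := fun y => (hfF y).trans (mul_le_of_le_one_right hF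
    (Real.exp_le_one_iff.2 (by have := abs_nonneg y; linarith)))
  -- A crude bound, used solely to make the boundary term at infinity vanish in `hrep`.
  obtain ⟨S, hS⟩ : ∃ S, ∀ y, |u' y + α * u y| ≤ S := by
    refine ⟨2 * (|u 0| + F) + (α ^ 2 * (|u 0| + F) + F) + α * (|u 0| + F), fun y => ?_⟩
    have h1 := abs_deriv_le_of_bounds (y := y) hu hu' (fun z _ => hbd z)
      (b := α ^ 2 * (|u 0| + F) + F) (fun z _ => by
        refine (abs_sub _ _).trans (add_le_add ?_ (hf1 z))
        rw [abs_mul, abs_of_nonneg (sq_nonneg α)]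
        exact mul_le_mul_of_nonneg_left (hbd z) (sq_nonneg α))
    refine (abs_add_le _ _).trans (add_le_add h1 ?_)
    rw [abs_mul, abs_of_pos hα]
    exact mul_le_mul_of_nonneg_left (hbd y) hα.le
  have hexp : ∀ y z, 0 ≤ y → y < z → |f z * Real.exp (-(α * z))| ≤
      F * Real.exp (-(α * y)) * Real.exp (-(4 * z)) := by
    intro y z hy hz
    rw [abs_mul, abs_of_pos (Real.exp_pos _)]
    have h1 := hfF' z (hy.trans_lt hz)
    have h2 : Real.exp (-(α * z)) ≤ Real.exp (-(α * y)) := Real.exp_le_exp.2 (by nlinarith)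
    calc |f z| * Real.exp (-(α * z)) ≤ (F * Real.exp (-(4 * z))) * Real.exp (-(α * y)) := by
          gcongr
      _ = _ := by ring
  -- Factoring ∂² − α² as (∂ − α)(∂ + α): the decaying solution satisfies the first-order equation
  -- for u' + αu integrated from infinity. This avoids any division by α.
  have hrep : ∀ y ≥ 0, ∫ z in Ioi y, f z * Real.exp (-(α * z)) =
      (u' y + α * u y) * Real.exp (-(α * y)) := by
    intro y hy
    have hder : ∀ z, HasDerivAt (fun z => -((u' z + α * u z) * Real.exp (-(α * z))))
        (f z * Real.exp (-(α * z))) z := fun z =>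
      (((hu' z).add ((hu z).const_mul α)).mul (hasDerivAt_exp_neg_mul α z)).neg.congr_deriv
        (by simp only [Pi.add_apply]; ring)
    have hint : IntegrableOn (fun z => f z * Real.exp (-(α * z))) (Ioi y) :=
      integrableOn_of_le_exp (F := F * Real.exp (-(α * y))) (b := 4) (by norm_num)
        (by fun_prop) (fun z hz => hexp y z hy hz)
    have hto : Tendsto (fun z => -((u' z + α * u z) * Real.exp (-(α * z)))) atTop (𝓝 0) := by
      refine squeeze_zero_norm (a := fun z => S * Real.exp (-(α * z))) (fun z => ?_) ?_
      · rw [norm_neg, norm_mul, Real.norm_eq_abs, Real.norm_eq_abs, abs_of_pos (Real.exp_pos _)]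
        exact mul_le_mul_of_nonneg_right (hS z) (Real.exp_pos _).le
      · simpa using (tendsto_exp_neg_mul hα).const_mul S
    rw [integral_Ioi_of_hasDerivAt_of_tendsto' (fun z _ => hder z) hint hto]
    ring
  have hmass : ∫ z in Ioi (0 : ℝ), f z = 2 * α := by
    have := integral_comp_abs (f := f)
    simp only [even_apply_abs hfe] at this
    linarith
  have hfint : IntegrableOn f (Ioi 0) :=
    integrableOn_of_le_exp (b := 4) (by norm_num) hf hfF'
  have hs : ∀ y ≥ 0, |u' y + α * u y| ≤ F / 4 := by
    intro y hy
    have h1 := abs_integral_Ioi_le (b := 4) (y := y) (by norm_num) (fun z hz => hexp y z hy hz)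
    rw [hrep y hy, abs_mul, abs_of_pos (Real.exp_pos _)] at h1
    have h2 : Real.exp (-(4 * y)) ≤ 1 := Real.exp_le_one_iff.2 (by linarith)
    have h3 := Real.exp_pos (-(α * y))
    refine le_of_mul_le_mul_right (h1.trans ?_) h3
    have : 0 ≤ F * Real.exp (-(α * y)) := by positivity
    nlinarith
  refine ⟨?_, ?_, hbd, fun y => ?_⟩
  -- At the origin u' vanishes, so αu(0) is the integral of f e^{−αz} over the half line, while the
  -- mass of f there is 2α. Their difference carries a factor α from |e^{−αz} − 1| ≤ αz, and this
  -- factor cancels.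
  · have h0 := hrep 0 le_rfl
    rw [deriv_zero_of_hasDerivAt_even hu he, zero_add, mul_zero, neg_zero, Real.exp_zero,
      mul_one] at h0
    have hint0 : IntegrableOn (fun z => f z * Real.exp (-(α * z))) (Ioi 0) :=
      integrableOn_of_le_exp (b := 4) (by norm_num) (by fun_prop)
        (fun z hz => hexp 0 z le_rfl hz)
    have hdiff : ∫ z in Ioi (0 : ℝ), (f z * Real.exp (-(α * z)) - f z) = α * (u 0 - 2) := by
      rw [integral_sub hint0 hfint, h0, hmass]
      ring
    have h1 := abs_integral_Ioi_le (f := fun z => f z * Real.exp (-(α * z)) - f z) (F := F * α)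
      (b := 3) (y := 0) (by norm_num) (fun z hz => by
        have hz' : (0 : ℝ) < z := hz
        rw [show f z * Real.exp (-(α * z)) - f z = f z * (Real.exp (-(α * z)) - 1) by ring, abs_mul]
        have e1 := Real.add_one_le_exp (-(α * z))
        have e2 : Real.exp (-(α * z)) ≤ 1 := Real.exp_le_one_iff.2 (by nlinarith)
        have e3 : |Real.exp (-(α * z)) - 1| ≤ α * z := abs_le.2 ⟨by linarith, by nlinarith⟩
        have e4 : z ≤ Real.exp z := by linarith [Real.add_one_le_exp z]
        calc |f z| * |Real.exp (-(α * z)) - 1|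
            ≤ (F * Real.exp (-(4 * z))) * (α * Real.exp z) := by
              have := hfF' z hz'
              gcongr
              exact e3.trans (mul_le_mul_of_nonneg_left e4 hα.le)
          _ = F * α * (Real.exp (-(4 * z)) * Real.exp z) := by ring
          _ = _ := by rw [← Real.exp_add]; ring_nf)
    rw [hdiff, abs_mul, abs_of_pos hα] at h1
    simp only [mul_zero, neg_zero, Real.exp_zero] at h1
    refine le_of_mul_le_mul_left (h1.trans_eq ?_) hα
    ring
  · have h1 := abs_integral_Ioi_le (b := 4) (y := 0) (by norm_num) hfF'
    rw [hmass, abs_of_pos (by positivity)] at h1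
    simp only [mul_zero, neg_zero, Real.exp_zero] at h1
    linarith
  · have key : ∀ y ≥ 0, |u' y| ≤ F / 4 + α * (|u 0| + F) := fun y hy => by
      have h1 := hs y hy
      have h2 : |α * u y| ≤ α * (|u 0| + F) := by
        rw [abs_mul, abs_of_pos hα]
        exact mul_le_mul_of_nonneg_left (hbd y) hα.le
      have h3 := abs_sub (u' y + α * u y) (α * u y)
      rw [add_sub_cancel_right] at h3
      linarith
    rcases le_total 0 y with hy | hy
    · exact key y hy
    · rw [← abs_neg, ← odd_of_hasDerivAt_even hu he]
      exact key (-y) (by linarith)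

/-- Even solutions of `p'' = -τ² p - f` with `p 0 = -2` and a small localised source. -/
lemma oscillating_mode_bounds {p p' f : ℝ → ℝ} {τ F : ℝ} (hτ : 1 / 2 ≤ τ) (hF : 0 ≤ F)
    (hp : ∀ y, HasDerivAt p (p' y) y) (hp' : ∀ y, HasDerivAt p' (-τ ^ 2 * p y - f y) y)
    (he : Function.Even p) (h0 : p 0 = -2) (hfF : ∀ y, |f y| ≤ F * Real.exp (-(4 * |y|))) (y : ℝ) :
    |p y + 2 * Real.cos (τ * y)| ≤ F ∧ |p' y - 2 * τ * Real.sin (τ * y)| ≤ τ * F := by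
  have hτ0 : 0 < τ := by linarith
  have key : ∀ y ≥ 0, |p y + 2 * Real.cos (τ * y)| ≤ F ∧
      |p' y - 2 * τ * Real.sin (τ * y)| ≤ τ * F := by
    intro y hy
    have hcos : ∀ z, HasDerivAt (fun z => Real.cos (τ * z)) (-Real.sin (τ * z) * τ) z := fun z => by
      have := ((hasDerivAt_id z).const_mul τ).cos
      exact this.congr_deriv (by simp only [id, mul_one])
    have hsin : ∀ z, HasDerivAt (fun z => Real.sin (τ * z)) (Real.cos (τ * z) * τ) z := fun z => by
      have := ((hasDerivAt_id z).const_mul τ).sin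
      exact this.congr_deriv (by simp only [id, mul_one])
    -- Variation of constants: the two amplitudes of p + 2 cos(τ·) both start from 0 and are driven
    -- only by the source.
    have hda : ∀ z, HasDerivAt (fun z => p z * Real.cos (τ * z) - p' z * Real.sin (τ * z) / τ + 2)
        (f z * Real.sin (τ * z) / τ) z := fun z => by
      refine ((((hp z).mul (hcos z)).sub (((hp' z).mul (hsin z)).div_const τ)).add_const
        2).congr_deriv ?_
      field_simp
      ring
    have hdb : ∀ z, HasDerivAt (fun z => p z * Real.sin (τ * z) + p' z * Real.cos (τ * z) / τ)
        (-(f z * Real.cos (τ * z) / τ)) z := fun z => by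
      refine (((hp z).mul (hsin z)).add (((hp' z).mul (hcos z)).div_const τ)).congr_deriv ?_
      field_simp
      ring
    -- The primitive of 2F e^{−4z}, which dominates the amplitudes' speed because 1/τ ≤ 2.
    have hB : ∀ z, HasDerivAt (fun z => F / 2 * (1 - Real.exp (-(4 * z))))
        (2 * F * Real.exp (-(4 * z))) z := fun z =>
      (((hasDerivAt_exp_neg_mul 4 z).const_sub 1).const_mul (F / 2)).congr_deriv (by ring)
    have hbound : ∀ z ∈ Ico 0 y, ∀ t, |t| ≤ 1 → ‖f z * t / τ‖ ≤ 2 * F * Real.exp (-(4 * z)) := by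
      intro z hz t ht
      have h1 := hfF z
      rw [abs_of_nonneg hz.1] at h1
      rw [Real.norm_eq_abs, abs_div, abs_mul, abs_of_pos hτ0, div_le_iff₀ hτ0]
      have h2 := Real.exp_pos (-(4 * z))
      have h3 : |f z| * |t| ≤ |f z| := mul_le_of_le_one_right (abs_nonneg _) ht
      have h4 : 0 ≤ F * Real.exp (-(4 * z)) := by positivity
      nlinarith
    have hF2 : F / 2 * (1 - Real.exp (-(4 * y))) ≤ F / 2 := by
      have := Real.exp_pos (-(4 * y))
      nlinarith
    have ha := image_norm_le_of_norm_deriv_right_le_deriv_boundary (a := 0) (b := y)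
      (continuous_of_hasDerivAt hda).continuousOn (fun z _ => (hda z).hasDerivWithinAt)
      (by simp [h0]) hB
      (fun z hz => hbound z hz _ (Real.abs_sin_le_one _)) ⟨hy, le_rfl⟩
    have hb := image_norm_le_of_norm_deriv_right_le_deriv_boundary (a := 0) (b := y)
      (continuous_of_hasDerivAt hdb).continuousOn (fun z _ => (hdb z).hasDerivWithinAt)
      (by simp [deriv_zero_of_hasDerivAt_even hp he]) hB
      (fun z hz => by rw [norm_neg]; exact hbound z hz _ (Real.abs_cos_le_one _)) ⟨hy, le_rfl⟩
    rw [Real.norm_eq_abs] at ha hb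
    set a := p y * Real.cos (τ * y) - p' y * Real.sin (τ * y) / τ + 2 with hadef
    set b := p y * Real.sin (τ * y) + p' y * Real.cos (τ * y) / τ with hbdef
    have hcs := Real.sin_sq_add_cos_sq (τ * y)
    have e1 : p y + 2 * Real.cos (τ * y) = a * Real.cos (τ * y) + b * Real.sin (τ * y) := by
      rw [hadef, hbdef]
      linear_combination (-p y) * hcs
    have e2 : p' y - 2 * τ * Real.sin (τ * y) =
        τ * (b * Real.cos (τ * y) - a * Real.sin (τ * y)) := by
      rw [hadef, hbdef]
      field_simp
      linear_combination (-p' y) * hcs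
    have hmul : ∀ s t : ℝ, |s| ≤ F / 2 → |t| ≤ 1 → |s * t| ≤ F / 2 := fun s t hs ht => by
      rw [abs_mul]
      exact (mul_le_of_le_one_right (abs_nonneg _) ht).trans hs
    have ha' := ha.trans hF2
    have hb' := hb.trans hF2
    constructor
    · rw [e1]
      have := abs_add_le (a * Real.cos (τ * y)) (b * Real.sin (τ * y))
      have := hmul a _ ha' (Real.abs_cos_le_one (τ * y))
      have := hmul b _ hb' (Real.abs_sin_le_one (τ * y))
      linarith
    · rw [e2, abs_mul, abs_of_pos hτ0]
      refine mul_le_mul_of_nonneg_left ?_ hτ0.le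
      have := abs_sub (b * Real.cos (τ * y)) (a * Real.sin (τ * y))
      have := hmul a _ ha' (Real.abs_sin_le_one (τ * y))
      have := hmul b _ hb' (Real.abs_cos_le_one (τ * y))
      linarith
  rcases le_total 0 y with hy | hy
  · exact key y hy
  · have := key (-y) (by linarith)
    rw [he, odd_of_hasDerivAt_even hp he, mul_neg, Real.cos_neg, Real.sin_neg, mul_neg,
      sub_neg_eq_add, ← abs_neg (-p' y + _)] at this
    refine ⟨this.1, ?_⟩
    convert this.2 using 2
    ring

section SumDiff

variable {ω ν : ℝ} {f₁ f₂ : ℝ → ℝ}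

lemma SolvesM.hasDerivAt_add (h : SolvesM ω ν f₁ f₂) (h₁ : ContDiff ℝ (⊤ : ℕ∞) f₁)
    (h₂ : ContDiff ℝ (⊤ : ℕ∞) f₂) (y : ℝ) :
    HasDerivAt (fun y => deriv f₁ y + deriv f₂ y) ((1 - ν) * (f₁ y + f₂ y)
      - ω / 3 * Qw ω y ^ 4 * (f₁ y + f₂ y - 2 * (f₁ y - f₂ y))) y :=
  ((h.hasDerivAt_deriv_fst h₁ y).add (h.hasDerivAt_deriv_snd h₂ y)).congr_deriv (by ring)

lemma SolvesM.hasDerivAt_sub (h : SolvesM ω ν f₁ f₂) (h₁ : ContDiff ℝ (⊤ : ℕ∞) f₁)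
    (h₂ : ContDiff ℝ (⊤ : ℕ∞) f₂) (y : ℝ) :
    HasDerivAt (fun y => deriv f₁ y - deriv f₂ y) ((1 + ν) * (f₁ y - f₂ y)
      + ω / 3 * Qw ω y ^ 4 * (2 * (f₁ y + f₂ y) - (f₁ y - f₂ y))) y :=
  ((h.hasDerivAt_deriv_fst h₁ y).sub (h.hasDerivAt_deriv_snd h₂ y)).congr_deriv (by ring)

/-- The potential (ω/3)Q⁴ is both small and localised; the decay e^{−4|y|} leaves room for the
polynomial and exponential weights used in the estimates. -/
lemma abs_potential_le (hω : 0 < ω) (y t : ℝ) :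
    |ω / 3 * Qw ω y ^ 4 * t| ≤ 64 / 3 * ω * |t| * Real.exp (-(4 * |y|)) := by
  have hQ := Qw_pos ω y
  have h := Qw_four_le_exp hω y
  have hp : 0 ≤ ω / 3 * Qw ω y ^ 4 := by positivity
  rw [abs_mul, abs_of_nonneg hp]
  calc ω / 3 * Qw ω y ^ 4 * |t| ≤ ω / 3 * (64 * Real.exp (-(4 * |y|))) * |t| := by gcongr
    _ = _ := by ring

lemma abs_potential_le' (hω : 0 < ω) (y t : ℝ) : |ω / 3 * Qw ω y ^ 4 * t| ≤ 4 / 3 * ω * |t| := by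
  have hQ := Qw_pos ω y
  have h := Qw_four_le hω y
  have hp : 0 ≤ ω / 3 * Qw ω y ^ 4 := by positivity
  rw [abs_mul, abs_of_nonneg hp]
  calc ω / 3 * Qw ω y ^ 4 * |t| ≤ ω / 3 * 4 * |t| := by gcongr
    _ = _ := by ring

/-- The difference component is slaved to the sum component. -/
lemma SolvesM.diff_bounds (hω : 0 < ω) (hω1 : ω ≤ 1 / 8) (hν : 0 ≤ ν) (hν2 : ν ≤ 2)
    (h : SolvesM ω ν f₁ f₂) (h₁ : ContDiff ℝ (⊤ : ℕ∞) f₁) (h₂ : ContDiff ℝ (⊤ : ℕ∞) f₂)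
    (hb : ∃ M, ∀ y, |f₁ y - f₂ y| ≤ M) {M : ℝ} (hM : ∀ y, |f₁ y + f₂ y| ≤ M) (y : ℝ) :
    |f₁ y - f₂ y| ≤ 4 * ω * M ∧ |deriv f₁ y - deriv f₂ y| ≤ 24 * ω * M := by
  obtain ⟨N, hN0, hN, hNmin⟩ := exists_sup_bound hb
  have hM0 : 0 ≤ M := (abs_nonneg _).trans (hM 0)
  have hd : ∀ y, HasDerivAt (fun y => f₁ y - f₂ y) (deriv f₁ y - deriv f₂ y) y := fun y =>
    (hasDerivAt_of_smooth h₁ y).sub (hasDerivAt_of_smooth h₂ y)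
  have hd' := h.hasDerivAt_sub h₁ h₂
  have hsrc : ∀ y, |ω / 3 * Qw ω y ^ 4 * (2 * (f₁ y + f₂ y) - (f₁ y - f₂ y))| ≤
      4 / 3 * ω * (2 * M + N) := fun y => by
    refine (abs_potential_le' hω y _).trans (mul_le_mul_of_nonneg_left ?_ (by positivity))
    have := abs_sub (2 * (f₁ y + f₂ y)) (f₁ y - f₂ y)
    rw [abs_mul, abs_two] at this
    linarith [hM y, hN y]
  -- The maximum principle with constant c = 1 + ν ≥ 1; the term in N on the right is then absorbed.
  have h1 : N ≤ 4 / 3 * ω * (2 * M + N) := by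
    refine hNmin _ fun y => ?_
    have := abs_le_of_bounded_of_second_deriv (c := 1 + ν) (g := 4 / 3 * ω * (2 * M + N))
      (by linarith) hd hd' hN (fun y => by rw [add_sub_cancel_left]; exact hsrc y) y
    exact this.trans (div_le_self (by positivity) (by linarith))
  have hNM : N ≤ 4 * ω * M := by nlinarith [mul_nonneg hω.le hN0, mul_nonneg hω.le hM0]
  refine ⟨(hN y).trans hNM, ?_⟩
  have h2 := abs_deriv_le_of_bounds (y := y) hd hd' (fun z _ => (hN z).trans hNM)
    (b := 3 * (4 * ω * M) + 4 / 3 * ω * (2 * M + N)) (fun z _ => by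
      refine (abs_add_le _ _).trans (add_le_add ?_ (hsrc z))
      rw [abs_mul, abs_of_nonneg (by linarith)]
      exact mul_le_mul (by linarith) ((hN z).trans hNM) (abs_nonneg _) (by norm_num))
  nlinarith [mul_nonneg hω.le hM0, mul_nonneg hω.le hN0]

end SumDiff

/-- A priori bounds for the internal mode. -/
lemma IsInternalMode.bounds {ω α : ℝ} {W₁ W₂ : ℝ → ℝ} (hω : 0 < ω) (hω1 : ω ≤ 1 / 1000)
    (h : IsInternalMode ω α W₁ W₂) :
    α ≤ 18 * ω ∧ ∀ y, |W₁ y + W₂ y| ≤ 3 ∧ |W₁ y + W₂ y - 2| ≤ 100 * ω * (1 + |y|) ∧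
      |deriv W₁ y + deriv W₂ y| ≤ 100 * ω ∧ |W₁ y - W₂ y| ≤ 12 * ω ∧
      |deriv W₁ y - deriv W₂ y| ≤ 72 * ω := by
  obtain ⟨hα0, hα1⟩ := h.alpha_mem
  have c1 := h.smooth₁.continuous
  have c2 := h.smooth₂.continuous
  have limu : Tendsto (fun y => W₁ y + W₂ y) (cocompact ℝ) (𝓝 0) := by
    simpa using h.decay₁.add h.decay₂
  have limv : Tendsto (fun y => W₁ y - W₂ y) (cocompact ℝ) (𝓝 0) := by
    simpa using h.decay₁.sub h.decay₂
  obtain ⟨M, hM0, hM, hMmin⟩ := exists_sup_bound (u := fun y => W₁ y + W₂ y)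
    (bounded_of_tendsto_cocompact (c1.add c2) limu)
  have hlam : 0 ≤ freq α ∧ freq α ≤ 2 := by
    constructor <;> (unfold freq; nlinarith)
  have hv := h.solves.diff_bounds hω (by linarith) hlam.1 hlam.2 h.smooth₁ h.smooth₂
    (bounded_of_tendsto_cocompact (c1.sub c2) limv) hM
  have hd : ∀ y, HasDerivAt (fun y => W₁ y + W₂ y) (deriv W₁ y + deriv W₂ y) y := fun y =>
    (hasDerivAt_of_smooth h.smooth₁ y).add (hasDerivAt_of_smooth h.smooth₂ y)
  have hd' := h.solves.hasDerivAt_add h.smooth₁ h.smooth₂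
  have hcQ := continuous_Qw ω
  have hfF : ∀ y, |ω / 3 * Qw ω y ^ 4 * (W₁ y + W₂ y - 2 * (W₁ y - W₂ y))| ≤
      43 * ω * M * Real.exp (-(4 * |y|)) := fun y => by
    refine (abs_potential_le hω y _).trans (mul_le_mul_of_nonneg_right ?_ (Real.exp_pos _).le)
    have h1 := abs_sub (W₁ y + W₂ y) (2 * (W₁ y - W₂ y))
    rw [abs_mul, abs_two] at h1
    have h2 : |W₁ y + W₂ y - 2 * (W₁ y - W₂ y)| ≤ M * (1 + 8 * ω) := by
      linarith [hM y, (hv y).1]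
    have h3 : 64 / 3 * ω * |W₁ y + W₂ y - 2 * (W₁ y - W₂ y)| ≤
      64 / 3 * ω * (M * (1 + 8 * ω)) := by gcongr
    nlinarith [mul_nonneg hω.le hM0]
  obtain ⟨k1, k2, k3, k4⟩ := slow_mode_bounds (F := 43 * ω * M) (α := α) hα0 (by positivity) hd
    (fun y => (hd' y).congr_deriv (by rw [freq]; ring)) (fun y => by
      simp only [h.even₁ y, h.even₂ y]) limu
    (f := fun y => ω / 3 * Qw ω y ^ 4 * (W₁ y + W₂ y - 2 * (W₁ y - W₂ y))) (by fun_prop)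
    -- The normalisation of the mode, divided by 3: u − 2v = 3W₂ − W₁, so the source of u has mass
    -- 12α/3.
    (fun y => by simp only [h.even₁ y, h.even₂ y, Qw_even]) hfF (by
      have := h.normalised
      rw [← integral_const_mul] at this
      rw [show 4 * α = (1 / 3) * (12 * α) by ring, ← this, ← integral_const_mul]
      congr 1
      funext y
      ring)
  have hu0 : |W₁ 0 + W₂ 0| ≤ 2 + 43 * ω * M / 3 := by
    have := abs_add_le (W₁ 0 + W₂ 0 - 2) 2
    rw [sub_add_cancel, abs_two] at this
    linarith
  have hM3 : M ≤ 3 := by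
    have h1 : M ≤ 2 + 43 * ω * M / 3 + 43 * ω * M := hMmin _ fun y => by linarith [k3 y]
    nlinarith
  have hωM : ω * M ≤ 3 * ω := by nlinarith
  have hα18 : α ≤ 18 * ω := by nlinarith
  have hu' : ∀ y, |deriv W₁ y + deriv W₂ y| ≤ 100 * ω := fun y => by
    have h1 := k4 y
    have h2 : α * (|W₁ 0 + W₂ 0| + 43 * ω * M) ≤ 18 * ω * (2 + 43 * ω * M / 3 + 43 * ω * M) := by
      gcongr
    have h3 : 2 + 43 * ω * M / 3 + 43 * ω * M ≤ 3 := by nlinarith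
    have h4 := mul_le_mul_of_nonneg_left h3 (by positivity : 0 ≤ 18 * ω)
    nlinarith
  refine ⟨hα18, fun y => ⟨(hM y).trans hM3, ?_, hu' y, ?_, ?_⟩⟩
  · have h1 := Convex.norm_image_sub_le_of_norm_hasDerivWithin_le (f := fun y => W₁ y + W₂ y)
      (s := univ) (fun x _ => (hd x).hasDerivWithinAt) (fun x _ => hu' x) convex_univ
      (mem_univ 0) (mem_univ y)
    simp only [Real.norm_eq_abs, sub_zero] at h1
    have h2 := abs_add_le (W₁ y + W₂ y - (W₁ 0 + W₂ 0)) (W₁ 0 + W₂ 0 - 2)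
    rw [sub_add_sub_cancel] at h2
    nlinarith
  · have := (hv y).1; nlinarith
  · have := (hv y).2; nlinarith

/-- A priori bounds for the bounded solution. -/
lemma IsBoundedSolution.bounds {ω α : ℝ} {h₁ h₂ : ℝ → ℝ} (hω : 0 < ω) (hω1 : ω ≤ 1 / 1000)
    (hα0 : 0 < α) (hα : α ≤ 18 * ω) (h : IsBoundedSolution ω α h₁ h₂) (y : ℝ) :
    |h₁ y + h₂ y| ≤ 3 ∧ |deriv h₁ y + deriv h₂ y| ≤ 5 ∧
      |h₁ y + h₂ y + 2 * Real.cos y| ≤ 1000 * ω * (1 + |y|) ∧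
      |deriv h₁ y + deriv h₂ y - 2 * Real.sin y| ≤ 2000 * ω * (1 + |y|) ∧
      |h₁ y - h₂ y| ≤ 12 * ω ∧ |deriv h₁ y - deriv h₂ y| ≤ 72 * ω := by
  obtain ⟨M', hM'⟩ := h.bounded
  have hα2 : α ^ 2 ≤ 324 * ω ^ 2 := by nlinarith
  have hα3 : α ^ 2 ≤ 324 / 1000 * ω := by nlinarith
  obtain ⟨M, hM0, hM, hMmin⟩ := exists_sup_bound (u := fun y => h₁ y + h₂ y)
    ⟨M' + M', fun y => (abs_add_le _ _).trans (add_le_add (hM' y).1 (hM' y).2)⟩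
  have hlam : 0 ≤ 2 * freq α ∧ 2 * freq α ≤ 2 := by
    constructor <;> (unfold freq; nlinarith)
  have hv := h.solves.diff_bounds hω (by linarith) hlam.1 hlam.2 h.smooth₁ h.smooth₂
    ⟨M' + M', fun y => (abs_sub _ _).trans (add_le_add (hM' y).1 (hM' y).2)⟩ hM
  have hd : ∀ y, HasDerivAt (fun y => h₁ y + h₂ y) (deriv h₁ y + deriv h₂ y) y := fun y =>
    (hasDerivAt_of_smooth h.smooth₁ y).add (hasDerivAt_of_smooth h.smooth₂ y)
  have hd' := h.solves.hasDerivAt_add h.smooth₁ h.smooth₂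
  have hfF : ∀ y, |ω / 3 * Qw ω y ^ 4 * (h₁ y + h₂ y - 2 * (h₁ y - h₂ y))| ≤
      43 * ω * M * Real.exp (-(4 * |y|)) := fun y => by
    refine (abs_potential_le hω y _).trans (mul_le_mul_of_nonneg_right ?_ (Real.exp_pos _).le)
    have h1 := abs_sub (h₁ y + h₂ y) (2 * (h₁ y - h₂ y))
    rw [abs_mul, abs_two] at h1
    have h2 : |h₁ y + h₂ y - 2 * (h₁ y - h₂ y)| ≤ M * (1 + 8 * ω) := by
      linarith [hM y, (hv y).1]
    have h3 : 64 / 3 * ω * |h₁ y + h₂ y - 2 * (h₁ y - h₂ y)| ≤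
      64 / 3 * ω * (M * (1 + 8 * ω)) := by gcongr
    nlinarith [mul_nonneg hω.le hM0]
  set τ := Real.sqrt (1 - 2 * α ^ 2) with hτdef
  have hτs : τ ^ 2 = 1 - 2 * α ^ 2 := Real.sq_sqrt (by nlinarith)
  have hτ1 : τ ≤ 1 := by 
    exact Real.sqrt_le_iff.2 ⟨zero_le_one, by nlinarith⟩
  have hτ0 : 0 ≤ τ := Real.sqrt_nonneg _
  -- The frequency shift is of order α² = O(ω²), so replacing cos(τy) by cos y costs at most ω|y|.
  have hτ2 : 1 - τ ≤ ω := by nlinarith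
  have osc := oscillating_mode_bounds (τ := τ) (F := 43 * ω * M) (by nlinarith) (by positivity) hd
    (fun y => (hd' y).congr_deriv (by rw [neg_mul, hτs, freq]; ring))
    (fun y => by simp only [h.even₁ y, h.even₂ y]) h.normalised
    hfF
  have hM3 : M ≤ 3 := by
    have h1 : M ≤ 2 + 43 * ω * M := hMmin _ fun y => by
      have e1 := (osc y).1
      have e2 := abs_sub (h₁ y + h₂ y + 2 * Real.cos (τ * y)) (2 * Real.cos (τ * y))
      rw [add_sub_cancel_right, abs_mul, abs_two] at e2
      have := Real.abs_cos_le_one (τ * y)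
      linarith
    nlinarith
  have hωM : ω * M ≤ 3 * ω := by nlinarith
  have hty : |τ * y - y| ≤ ω * |y| := by
    rw [show τ * y - y = (τ - 1) * y by ring, abs_mul, abs_sub_comm, abs_of_nonneg (by linarith)]
    exact mul_le_mul_of_nonneg_right hτ2 (abs_nonneg y)
  have hcos : |Real.cos (τ * y) - Real.cos y| ≤ ω * |y| :=
    (Real.abs_cos_sub_cos_le _ _).trans hty
  have hsin : |Real.sin (τ * y) - Real.sin y| ≤ ω * |y| :=
    (Real.abs_sin_sub_sin_le _ _).trans hty
  obtain ⟨o1, o2⟩ := osc y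
  have hωy : 0 ≤ ω * |y| := by positivity
  have hp' : |deriv h₁ y + deriv h₂ y - 2 * Real.sin y| ≤ 129 * ω + 2 * ω + 2 * (ω * |y|) := by
    have e : deriv h₁ y + deriv h₂ y - 2 * Real.sin y =
        (deriv h₁ y + deriv h₂ y - 2 * τ * Real.sin (τ * y)) + (2 * (τ - 1) * Real.sin (τ * y)
          + 2 * (Real.sin (τ * y) - Real.sin y)) := by ring
    rw [e]
    refine (abs_add_le _ _).trans ?_
    have e2 := abs_add_le (2 * (τ - 1) * Real.sin (τ * y)) (2 * (Real.sin (τ * y) - Real.sin y))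
    rw [abs_mul, abs_mul, abs_mul, abs_two, abs_sub_comm τ, abs_of_nonneg (by linarith : 0 ≤ 1 - τ)]
      at e2
    have e3 := Real.abs_sin_le_one (τ * y)
    have e4 : 2 * (1 - τ) * |Real.sin (τ * y)| ≤ 2 * ω * 1 := by gcongr
    have e5 : τ * (43 * ω * M) ≤ 1 * (129 * ω) := by
      apply mul_le_mul hτ1 _ (by positivity) zero_le_one
      linarith
    linarith
  refine ⟨(hM y).trans hM3, ?_, ?_, ?_, ?_, ?_⟩
  · have e1 := abs_add_le (deriv h₁ y + deriv h₂ y - 2 * τ * Real.sin (τ * y))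
      (2 * τ * Real.sin (τ * y))
    rw [sub_add_cancel] at e1
    have e2 : |2 * τ * Real.sin (τ * y)| ≤ 2 := by
      rw [abs_mul, abs_mul, abs_two, abs_of_nonneg hτ0]
      have := Real.abs_sin_le_one (τ * y)
      nlinarith [abs_nonneg (Real.sin (τ * y))]
    have e5 : τ * (43 * ω * M) ≤ 1 * (129 * ω) := by
      apply mul_le_mul hτ1 _ (by positivity) zero_le_one
      linarith
    linarith
  · have e1 := abs_add_le (h₁ y + h₂ y + 2 * Real.cos (τ * y)) (2 * (Real.cos y - Real.cos (τ * y)))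
    rw [abs_mul, abs_two, abs_sub_comm (Real.cos y)] at e1
    have e : h₁ y + h₂ y + 2 * Real.cos y = h₁ y + h₂ y + 2 * Real.cos (τ * y)
      + 2 * (Real.cos y - Real.cos (τ * y)) := by ring
    rw [e]
    linarith
  · linarith
  · have := (hv y).1; nlinarith
  · have := (hv y).2; nlinarith

/-! ### Second-order normal form

For a solution `(W₁, W₂)` of the transformed system at frequency `1 - a` put `u = W₁ + W₂` and
`v = W₁ - W₂`. The quadratic source `(G₁, G₂)` equals `(L₊ A - 2 (1 - a) B, L₋ B - 2 (1 - a) A)`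
for explicit quadratic forms `A`, `B` in the jets of `u`, `v`, up to an error of order `ω`. -/

/-- First component of the mode in terms of the jets of `u` and `v`. -/
noncomputable def modeFst (Q R w a u u₁ v v₁ : ℝ) : ℝ :=
  (2 - Q ^ 2 - 2 / 3 * w * Q ^ 4) * ((u + v) / 2) - (1 - a) * ((u - v) / 2) + R * (u₁ + v₁)

/-- Second component of the mode in terms of the jets of `u` and `v`. -/
noncomputable def modeSnd (Q R w a u u₁ v v₁ : ℝ) : ℝ :=
  (2 + 2 / 3 * w * Q ^ 4) * ((u - v) / 2) - (1 - a) * ((u + v) / 2) + R * (u₁ - v₁)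

/-- The first quadratic source. -/
noncomputable def srcFst (Q R w a u u₁ v v₁ : ℝ) : ℝ :=
  Q * (modeFst Q R w a u u₁ v v₁ ^ 2 * (3 + 10 * w * Q ^ 2)
    - modeSnd Q R w a u u₁ v v₁ ^ 2 * (1 + 2 * w * Q ^ 2))

/-- The second quadratic source. -/
noncomputable def srcSnd (Q R w a u u₁ v v₁ : ℝ) : ℝ :=
  Q * (2 * modeFst Q R w a u u₁ v v₁ * modeSnd Q R w a u u₁ v v₁ * (1 + 2 * w * Q ^ 2))

/-- First component of the normal form corrector. -/
noncomputable def corrFst (Q R u u₁ v v₁ : ℝ) : ℝ :=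
  Q * (-3 / 2 * u * v - 1 / 4 * u ^ 2 - R * u * v₁ - 1 / 2 * R * u * u₁ + 1 / 2 * Q ^ 2 * u * v + 1
    / 4 * Q ^ 2 * u ^ 2)

/-- Second component of the normal form corrector. -/
noncomputable def corrSnd (Q R u u₁ v v₁ : ℝ) : ℝ :=
  Q * (1 / 2 * u * v - 1 / 4 * u ^ 2 + 1 / 2 * R * u * v₁ - 1 / 2 * R * u * u₁)

/-- The derivative of `corrFst` along the flow. -/
noncomputable def corrFst' (Q R w a u u₁ v v₁ : ℝ) : ℝ :=
  Q * (-3 / 2 * u₁ * v - 5 / 2 * u * v₁ - u * u₁ - R * u₁ * v₁ - 1 / 2 * R * u₁ ^ 2 - 7 / 2 * R * u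
    * v - 1 / 4 * R * u ^ 2 + R * a * u * v - 1 / 2 * R * a * u ^ 2 + 1 / 2 * Q ^ 2 * u₁ * v + 3
    / 2 * Q ^ 2 * u * v₁ + Q ^ 2 * u * u₁ + 3 / 2 * Q ^ 2 * R * u * v + 3 / 4 * Q ^ 2 * R * u ^ 2
    + Q ^ 4 * w * u * v₁ + 1 / 2 * Q ^ 4 * w * u * u₁ - 1 / 2 * Q ^ 4 * R * w * u ^ 2)

/-- The derivative of `corrSnd` along the flow. -/
noncomputable def corrSnd' (Q R w a u u₁ v v₁ : ℝ) : ℝ :=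
  Q * (1 / 2 * u₁ * v + u * v₁ - u * u₁ + 1 / 2 * R * u₁ * v₁ - 1 / 2 * R * u₁ ^ 2 + 3 / 2 * R * u *
    v - 1 / 4 * R * u ^ 2 - 1 / 2 * R * a * u * v - 1 / 2 * R * a * u ^ 2 - 1 / 2 * Q ^ 2 * u *
    v₁ + 1 / 2 * Q ^ 2 * u * u₁ - 1 / 2 * Q ^ 4 * w * u * v₁ + 1 / 2 * Q ^ 4 * w * u * u₁ - 1 / 2
    * Q ^ 4 * R * w * u * v + 1 / 2 * Q ^ 4 * R * w * u ^ 2)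

/-- Second-order remainder of the first equation, in rescaled variables. -/
noncomputable def remFst (Q R w a u u₁ v v₁ : ℝ) : ℝ :=
  2 * v₁ ^ 2 + 9 / 2 * v ^ 2 + 3 * u₁ * v₁ + 1 / 2 * u₁ ^ 2 + 5 * w * a * u * v - 3 * w ^ 2 * a *
  v ^ 2 + 1 / 2 * w ^ 2 * a ^ 2 * u ^ 2 - 2 * w ^ 3 * a ^ 2 * u * v + 1 / 2 * w ^ 4 * a ^ 2 * v ^
  2 + 6 * R * v * v₁ + 5 * R * u₁ * v + 3 * R * w * a * u * v₁ + R * w * a * u * u₁ - 2 * R * w ^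
  2 * a * v * v₁ - 2 * R * w ^ 2 * a * u₁ * v - Q ^ 2 * v₁ ^ 2 - 9 / 2 * Q ^ 2 * v ^ 2 - Q ^ 2 *
  u₁ * v₁ + 1 / 2 * Q ^ 2 * u₁ ^ 2 + 18 * Q ^ 2 * u * v + 8 * Q ^ 2 * w * v₁ ^ 2 + 18 * Q ^ 2 * w
  * v ^ 2 + 24 * Q ^ 2 * w * u₁ * v₁ + 8 * Q ^ 2 * w * u₁ ^ 2 - 2 * Q ^ 2 * w * a * u * v + 4 * Q
  ^ 2 * w * a * u ^ 2 + 3 / 2 * Q ^ 2 * w ^ 2 * a * v ^ 2 + 12 * Q ^ 2 * w ^ 2 * a * u * v - 12 *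
  Q ^ 2 * w ^ 3 * a * v ^ 2 + 2 * Q ^ 2 * w ^ 3 * a ^ 2 * u ^ 2 - 6 * Q ^ 2 * w ^ 4 * a ^ 2 * u *
  v + 2 * Q ^ 2 * w ^ 5 * a ^ 2 * v ^ 2 - 3 * Q ^ 2 * R * v * v₁ + 12 * Q ^ 2 * R * u * v₁ + 8 *
  Q ^ 2 * R * u * u₁ + 24 * Q ^ 2 * R * w * v * v₁ + 36 * Q ^ 2 * R * w * u₁ * v + 12 * Q ^ 2 * R
  * w ^ 2 * a * u * v₁ + 8 * Q ^ 2 * R * w ^ 2 * a * u * u₁ - 8 * Q ^ 2 * R * w ^ 3 * a * v * v₁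
  - 12 * Q ^ 2 * R * w ^ 3 * a * u₁ * v + 3 / 4 * Q ^ 4 * v ^ 2 - 24 * Q ^ 4 * u * v - 14 / 3 * Q
  ^ 4 * w * v₁ ^ 2 - 20 * Q ^ 4 * w * v ^ 2 - 38 / 3 * Q ^ 4 * w * u₁ * v₁ - 11 / 3 * Q ^ 4 * w *
  u₁ ^ 2 - 16 / 3 * Q ^ 4 * w * a * u ^ 2 - 2 * Q ^ 4 * w ^ 2 * a * u * v + 19 / 3 * Q ^ 4 * w ^
  3 * a * v ^ 2 - 11 * Q ^ 4 * R * u * v₁ - 14 * Q ^ 4 * R * u * u₁ - 40 / 3 * Q ^ 4 * R * w * v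
  * v₁ - 35 / 3 * Q ^ 4 * R * w * u₁ * v + 7 * Q ^ 6 * u * v - 4 * Q ^ 6 * u ^ 2 + 23 / 6 * Q ^ 6
  * w * v ^ 2 - 32 / 3 * Q ^ 6 * w * u * v - 8 / 3 * Q ^ 6 * w ^ 2 * v₁ ^ 2 - 12 * Q ^ 6 * w ^ 2
  * v ^ 2 - 8 * Q ^ 6 * w ^ 2 * u₁ * v₁ - 8 / 3 * Q ^ 6 * w ^ 2 * u₁ ^ 2 - 4 * Q ^ 6 * w ^ 2 * a
  * u ^ 2 + 4 * Q ^ 6 * w ^ 4 * a * v ^ 2 - 16 / 3 * Q ^ 6 * R * w * u * v₁ - 8 * Q ^ 6 * R * w *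
  u * u₁ - 8 * Q ^ 6 * R * w ^ 2 * v * v₁ - 16 / 3 * Q ^ 6 * R * w ^ 2 * u₁ * v + 47 / 9 * Q ^ 8
  * u ^ 2 + 68 / 9 * Q ^ 8 * w * u * v + 32 / 9 * Q ^ 8 * w ^ 2 * v ^ 2 + 8 / 9 * Q ^ 10 * w * u
  ^ 2 + 8 / 3 * Q ^ 10 * w ^ 2 * u * v + 8 / 9 * Q ^ 10 * w ^ 3 * v ^ 2

/-- Second-order remainder of the second equation, in rescaled variables. -/
noncomputable def remSnd (Q R w a u u₁ v v₁ : ℝ) : ℝ :=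
  -2 * v₁ ^ 2 - 9 / 2 * v ^ 2 + 2 * u₁ * v₁ + 1 / 2 * u₁ ^ 2 + 2 * w * a * u * v + 3 * w ^ 2 * a
  * v ^ 2 + 1 / 2 * w ^ 2 * a ^ 2 * u ^ 2 - 1 / 2 * w ^ 4 * a ^ 2 * v ^ 2 - 6 * R * v * v₁ + 3 *
  R * u₁ * v + 2 * R * w * a * u * v₁ + R * w * a * u * u₁ + 2 * R * w ^ 2 * a * v * v₁ - R * w ^
  2 * a * u₁ * v + Q ^ 2 * v₁ ^ 2 + 3 / 2 * Q ^ 2 * v ^ 2 - Q ^ 2 * u₁ * v₁ - 4 * Q ^ 2 * w * v₁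
  ^ 2 - 9 * Q ^ 2 * w * v ^ 2 + 4 * Q ^ 2 * w * u₁ ^ 2 - Q ^ 2 * w * a * u * v + 2 * Q ^ 2 * w *
  a * u ^ 2 - 1 / 2 * Q ^ 2 * w ^ 2 * a * v ^ 2 + 6 * Q ^ 2 * w ^ 3 * a * v ^ 2 + Q ^ 2 * w ^ 3 *
  a ^ 2 * u ^ 2 - Q ^ 2 * w ^ 5 * a ^ 2 * v ^ 2 + Q ^ 2 * R * v * v₁ - Q ^ 2 * R * u₁ * v + 4 * Q
  ^ 2 * R * u * u₁ - 12 * Q ^ 2 * R * w * v * v₁ + 4 * Q ^ 2 * R * w ^ 2 * a * u * u₁ + 4 * Q ^ 2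
  * R * w ^ 3 * a * v * v₁ - 7 / 3 * Q ^ 4 * u * v + 8 / 3 * Q ^ 4 * w * v₁ ^ 2 + 10 / 3 * Q ^ 4
  * w * v ^ 2 - Q ^ 4 * w * u₁ * v₁ - 5 / 3 * Q ^ 4 * w * u₁ ^ 2 - 7 / 3 * Q ^ 4 * w ^ 2 * a * u
  * v - Q ^ 4 * w ^ 3 * a * v ^ 2 + 2 / 3 * Q ^ 4 * R * u * v₁ + 5 / 3 * Q ^ 4 * R * u * u₁ + 7 /
  3 * Q ^ 4 * R * w * v * v₁ - 14 / 3 * Q ^ 4 * R * w * u₁ * v + 2 * Q ^ 6 * u * v + 1 / 3 * Q ^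
  6 * w * v ^ 2 + 8 / 3 * Q ^ 6 * w * u * v + 4 / 3 * Q ^ 6 * w ^ 2 * v₁ ^ 2 - 4 / 3 * Q ^ 6 * w
  ^ 2 * u₁ ^ 2 - 8 / 3 * Q ^ 6 * w ^ 3 * a * u * v + 8 / 3 * Q ^ 6 * R * w * u * v₁ - 8 / 3 * Q ^
  6 * R * w ^ 2 * u₁ * v - 23 / 9 * Q ^ 8 * u ^ 2 + 5 / 3 * Q ^ 8 * w * u * v + 8 / 9 * Q ^ 8 * w
  ^ 2 * v ^ 2 - 4 / 9 * Q ^ 10 * w * u ^ 2 + 4 / 9 * Q ^ 10 * w ^ 3 * v ^ 2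

/-- The error of the first corrector equation. -/
noncomputable def errFst (Q R w a u u₁ v v₁ : ℝ) : ℝ :=
  Q * (w * u ^ 2 * (2 * Q ^ 2 - 67 / 6 * Q ^ 4 + 17 / 3 * Q ^ 6)
    + w ^ 2 * remFst Q R w (a / w ^ 2) u (u₁ / w) (v / w) (v₁ / w))

/-- The error of the second corrector equation. -/
noncomputable def errSnd (Q R w a u u₁ v v₁ : ℝ) : ℝ :=
  Q * (w * u ^ 2 * (Q ^ 2 + 5 / 2 * Q ^ 4 - 7 / 3 * Q ^ 6)
    + w ^ 2 * remSnd Q R w (a / w ^ 2) u (u₁ / w) (v / w) (v₁ / w))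

/-- The second derivative of `corrFst` along the flow. -/
noncomputable def corrFst'' (Q R w a u u₁ v v₁ : ℝ) : ℝ :=
  corrFst Q R u u₁ v v₁ * (1 - 3 * Q ^ 2 - 5 * w * Q ^ 4) - 2 * (1 - a) * corrSnd Q R u u₁ v v₁
    - srcFst Q R w a u u₁ v v₁ + errFst Q R w a u u₁ v v₁

/-- The second derivative of `corrSnd` along the flow. -/
noncomputable def corrSnd'' (Q R w a u u₁ v v₁ : ℝ) : ℝ :=
  corrSnd Q R u u₁ v v₁ * (1 - Q ^ 2 - w * Q ^ 4) - 2 * (1 - a) * corrFst Q R u u₁ v v₁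
    - srcSnd Q R w a u u₁ v v₁ + errSnd Q R w a u u₁ v v₁

section Corrector

variable {ω a : ℝ} {u u' v v' : ℝ → ℝ}

/-- The flow is imposed as hypotheses on four functions with a general parameter a; the mode enters
with a = α². -/
lemma hasDerivAt_corrFst (hω : 0 < ω) (hu : ∀ y, HasDerivAt u (u' y) y)
    (hu' : ∀ y, HasDerivAt u' (a * u y - ω / 3 * Qw ω y ^ 4 * (u y - 2 * v y)) y)
    (hv : ∀ y, HasDerivAt v (v' y) y)
    (hv' : ∀ y, HasDerivAt v' ((2 - a) * v y + ω / 3 * Qw ω y ^ 4 * (2 * u y - v y)) y) (y : ℝ) :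
    HasDerivAt (fun y => corrFst (Qw ω y) (Rw ω y) (u y) (u' y) (v y) (v' y))
      (corrFst' (Qw ω y) (Rw ω y) ω a (u y) (u' y) (v y) (v' y)) y := by
  unfold corrFst corrFst'
  have hQ := hasDerivAt_Qw ω y
  have hR := hasDerivAt_Rw hω y
  have H := hQ.fun_mul (((((((HasDerivAt.const_mul (-3 / 2) (hu y)).fun_mul (hv y)).fun_sub
    (HasDerivAt.const_mul (1 / 4) ((hu y).fun_pow 2))).fun_sub ((hR.fun_mul (hu y)).fun_mul (hv'
    y))).fun_sub (((HasDerivAt.const_mul (1 / 2) hR).fun_mul (hu y)).fun_mul (hu' y))).fun_add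
    (((HasDerivAt.const_mul (1 / 2) ((hQ).fun_pow 2)).fun_mul (hu y)).fun_mul (hv y))).fun_add
    ((HasDerivAt.const_mul (1 / 4) ((hQ).fun_pow 2)).fun_mul ((hu y).fun_pow 2)))
  refine H.congr_deriv ?_
  have hRs := Rw_sq hω y
  push_cast
  generalize Qw ω y = Q at *
  generalize Rw ω y = R at *
  linear_combination (-Q * u y * v' y - 1 / 2 * Q * u y * u' y) * hRs

lemma hasDerivAt_corrSnd (hω : 0 < ω) (hu : ∀ y, HasDerivAt u (u' y) y)
    (hu' : ∀ y, HasDerivAt u' (a * u y - ω / 3 * Qw ω y ^ 4 * (u y - 2 * v y)) y)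
    (hv : ∀ y, HasDerivAt v (v' y) y)
    (hv' : ∀ y, HasDerivAt v' ((2 - a) * v y + ω / 3 * Qw ω y ^ 4 * (2 * u y - v y)) y) (y : ℝ) :
    HasDerivAt (fun y => corrSnd (Qw ω y) (Rw ω y) (u y) (u' y) (v y) (v' y))
      (corrSnd' (Qw ω y) (Rw ω y) ω a (u y) (u' y) (v y) (v' y)) y := by
  unfold corrSnd corrSnd'
  have hQ := hasDerivAt_Qw ω y
  have hR := hasDerivAt_Rw hω y
  have H := hQ.fun_mul (((((HasDerivAt.const_mul (1 / 2) (hu y)).fun_mul (hv y)).fun_sub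
    (HasDerivAt.const_mul (1 / 4) ((hu y).fun_pow 2))).fun_add (((HasDerivAt.const_mul (1 / 2)
    hR).fun_mul (hu y)).fun_mul (hv' y))).fun_sub (((HasDerivAt.const_mul (1 / 2) hR).fun_mul (hu
    y)).fun_mul (hu' y)))
  refine H.congr_deriv ?_
  have hRs := Rw_sq hω y
  push_cast
  generalize Qw ω y = Q at *
  generalize Rw ω y = R at *
  linear_combination (1 / 2 * Q * u y * v' y - 1 / 2 * Q * u y * u' y) * hRs

/-- The first normal form identity, equivalent to L₊A − 2(1 − a)B = G₁ − error. It is exact; the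
error is small only because u', v, v' are O(ω) and a is O(ω²) along the mode. -/
lemma hasDerivAt_corrFst' (hω : 0 < ω) (hu : ∀ y, HasDerivAt u (u' y) y)
    (hu' : ∀ y, HasDerivAt u' (a * u y - ω / 3 * Qw ω y ^ 4 * (u y - 2 * v y)) y)
    (hv : ∀ y, HasDerivAt v (v' y) y)
    (hv' : ∀ y, HasDerivAt v' ((2 - a) * v y + ω / 3 * Qw ω y ^ 4 * (2 * u y - v y)) y) (y : ℝ) :
    HasDerivAt (fun y => corrFst' (Qw ω y) (Rw ω y) ω a (u y) (u' y) (v y) (v' y))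
      (corrFst'' (Qw ω y) (Rw ω y) ω a (u y) (u' y) (v y) (v' y)) y := by
  unfold corrFst'
  have hQ := hasDerivAt_Qw ω y
  have hR := hasDerivAt_Rw hω y
  have H := hQ.fun_mul ((((((((((((((((((HasDerivAt.const_mul (-3 / 2) (hu' y)).fun_mul (hv y)).fun_sub
    ((HasDerivAt.const_mul (5 / 2) (hu y)).fun_mul (hv' y))).fun_sub ((hu y).fun_mul (hu'
    y))).fun_sub ((hR.fun_mul (hu' y)).fun_mul (hv' y))).fun_sub ((HasDerivAt.const_mul (1 / 2)
    hR).fun_mul ((hu' y).fun_pow 2))).fun_sub (((HasDerivAt.const_mul (7 / 2) hR).fun_mul (hu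
    y)).fun_mul (hv y))).fun_sub ((HasDerivAt.const_mul (1 / 4) hR).fun_mul ((hu y).fun_pow
    2))).fun_add (((hR.mul_const (a)).fun_mul (hu y)).fun_mul (hv y))).fun_sub
    (((HasDerivAt.const_mul (1 / 2) hR).mul_const (a)).fun_mul ((hu y).fun_pow 2))).fun_add
    (((HasDerivAt.const_mul (1 / 2) ((hQ).fun_pow 2)).fun_mul (hu' y)).fun_mul (hv y))).fun_add
    (((HasDerivAt.const_mul (3 / 2) ((hQ).fun_pow 2)).fun_mul (hu y)).fun_mul (hv' y))).fun_add
    ((((hQ).fun_pow 2).fun_mul (hu y)).fun_mul (hu' y))).fun_add ((((HasDerivAt.const_mul (3 / 2)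
    ((hQ).fun_pow 2)).fun_mul hR).fun_mul (hu y)).fun_mul (hv y))).fun_add
    (((HasDerivAt.const_mul (3 / 4) ((hQ).fun_pow 2)).fun_mul hR).fun_mul ((hu y).fun_pow
    2))).fun_add (((((hQ).fun_pow 4).mul_const (ω)).fun_mul (hu y)).fun_mul (hv' y))).fun_add
    ((((HasDerivAt.const_mul (1 / 2) ((hQ).fun_pow 4)).mul_const (ω)).fun_mul (hu y)).fun_mul
    (hu' y))).fun_sub ((((HasDerivAt.const_mul (1 / 2) ((hQ).fun_pow 4)).fun_mul hR).mul_const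
    (ω)).fun_mul ((hu y).fun_pow 2)))
  refine H.congr_deriv ?_
  have hRs := Rw_sq hω y
  unfold corrFst'' corrFst corrSnd srcFst errFst remFst modeFst modeSnd
  push_cast
  -- Passing to the rescaled variables of the remainder clears all divisions by ω and leaves a
  -- polynomial identity.
  obtain ⟨b, rfl⟩ : ∃ b, a = ω ^ 2 * b := ⟨a / ω ^ 2, by field_simp⟩
  obtain ⟨U, hU⟩ : ∃ U, u' y = ω * U := ⟨u' y / ω, by field_simp⟩
  obtain ⟨V, hV⟩ : ∃ V, v y = ω * V := ⟨v y / ω, by field_simp⟩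
  obtain ⟨V₁, hV₁⟩ : ∃ V₁, v' y = ω * V₁ := ⟨v' y / ω, by field_simp⟩
  rw [hU, hV, hV₁, mul_div_cancel_left₀ _ (pow_ne_zero 2 hω.ne'), mul_div_cancel_left₀ _ hω.ne',
    mul_div_cancel_left₀ _ hω.ne', mul_div_cancel_left₀ _ hω.ne']
  clear H hU hV hV₁ hQ hR hu hu' hv hv'
  generalize Qw ω y = Q at *
  generalize Rw ω y = R at *
  generalize u y = z
  linear_combination (-1 / 4 * Q * z ^ 2 - 7 / 2 * Q * ω * z * V + 2 * Q * ω ^ 2 * V₁ ^ 2 + 7 * Q * ω ^ 2 * U * V₁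
    + 3 / 2 * Q * ω ^ 2 * U ^ 2 - 1 / 2 * Q * ω ^ 2 * b * z ^ 2 + Q * ω ^ 3 * b * z * V + 9 / 4 *
    Q ^ 3 * z ^ 2 + 9 / 2 * Q ^ 3 * ω * z * V + 8 * Q ^ 3 * ω ^ 3 * V₁ ^ 2 + 24 * Q ^ 3 * ω ^ 3 *
    U * V₁ + 8 * Q ^ 3 * ω ^ 3 * U ^ 2 - 5 / 2 * Q ^ 5 * ω * z ^ 2) * hRs

/-- The companion identity L₋B − 2(1 − a)A = G₂ − error. -/
lemma hasDerivAt_corrSnd' (hω : 0 < ω) (hu : ∀ y, HasDerivAt u (u' y) y)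
    (hu' : ∀ y, HasDerivAt u' (a * u y - ω / 3 * Qw ω y ^ 4 * (u y - 2 * v y)) y)
    (hv : ∀ y, HasDerivAt v (v' y) y)
    (hv' : ∀ y, HasDerivAt v' ((2 - a) * v y + ω / 3 * Qw ω y ^ 4 * (2 * u y - v y)) y) (y : ℝ) :
    HasDerivAt (fun y => corrSnd' (Qw ω y) (Rw ω y) ω a (u y) (u' y) (v y) (v' y))
      (corrSnd'' (Qw ω y) (Rw ω y) ω a (u y) (u' y) (v y) (v' y)) y := by
  unfold corrSnd'
  have hQ := hasDerivAt_Qw ω y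
  have hR := hasDerivAt_Rw hω y
  have H := hQ.fun_mul ((((((((((((((((HasDerivAt.const_mul (1 / 2) (hu' y)).fun_mul (hv y)).fun_add ((hu
    y).fun_mul (hv' y))).fun_sub ((hu y).fun_mul (hu' y))).fun_add (((HasDerivAt.const_mul (1 /
    2) hR).fun_mul (hu' y)).fun_mul (hv' y))).fun_sub ((HasDerivAt.const_mul (1 / 2) hR).fun_mul
    ((hu' y).fun_pow 2))).fun_add (((HasDerivAt.const_mul (3 / 2) hR).fun_mul (hu y)).fun_mul (hv
    y))).fun_sub ((HasDerivAt.const_mul (1 / 4) hR).fun_mul ((hu y).fun_pow 2))).fun_sub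
    ((((HasDerivAt.const_mul (1 / 2) hR).mul_const (a)).fun_mul (hu y)).fun_mul (hv y))).fun_sub
    (((HasDerivAt.const_mul (1 / 2) hR).mul_const (a)).fun_mul ((hu y).fun_pow 2))).fun_sub
    (((HasDerivAt.const_mul (1 / 2) ((hQ).fun_pow 2)).fun_mul (hu y)).fun_mul (hv' y))).fun_add
    (((HasDerivAt.const_mul (1 / 2) ((hQ).fun_pow 2)).fun_mul (hu y)).fun_mul (hu' y))).fun_sub
    ((((HasDerivAt.const_mul (1 / 2) ((hQ).fun_pow 4)).mul_const (ω)).fun_mul (hu y)).fun_mul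
    (hv' y))).fun_add ((((HasDerivAt.const_mul (1 / 2) ((hQ).fun_pow 4)).mul_const (ω)).fun_mul
    (hu y)).fun_mul (hu' y))).fun_sub (((((HasDerivAt.const_mul (1 / 2) ((hQ).fun_pow 4)).fun_mul
    hR).mul_const (ω)).fun_mul (hu y)).fun_mul (hv y))).fun_add ((((HasDerivAt.const_mul (1 / 2)
    ((hQ).fun_pow 4)).fun_mul hR).mul_const (ω)).fun_mul ((hu y).fun_pow 2)))
  refine H.congr_deriv ?_
  have hRs := Rw_sq hω y
  unfold corrSnd'' corrFst corrSnd srcSnd errSnd remSnd modeFst modeSnd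
  push_cast
  obtain ⟨b, rfl⟩ : ∃ b, a = ω ^ 2 * b := ⟨a / ω ^ 2, by field_simp⟩
  obtain ⟨U, hU⟩ : ∃ U, u' y = ω * U := ⟨u' y / ω, by field_simp⟩
  obtain ⟨V, hV⟩ : ∃ V, v y = ω * V := ⟨v y / ω, by field_simp⟩
  obtain ⟨V₁, hV₁⟩ : ∃ V₁, v' y = ω * V₁ := ⟨v' y / ω, by field_simp⟩
  rw [hU, hV, hV₁, mul_div_cancel_left₀ _ (pow_ne_zero 2 hω.ne'), mul_div_cancel_left₀ _ hω.ne',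
    mul_div_cancel_left₀ _ hω.ne', mul_div_cancel_left₀ _ hω.ne']
  clear H hU hV hV₁ hQ hR hu hu' hv hv'
  generalize Qw ω y = Q at *
  generalize Rw ω y = R at *
  generalize u y = z
  linear_combination (-1 / 4 * Q * z ^ 2 + 3 / 2 * Q * ω * z * V - 2 * Q * ω ^ 2 * V₁ ^ 2 + 1 / 2 * Q * ω ^ 2 * U *
    V₁ + 3 / 2 * Q * ω ^ 2 * U ^ 2 - 1 / 2 * Q * ω ^ 2 * b * z ^ 2 - 1 / 2 * Q * ω ^ 3 * b * z *
    V - 4 * Q ^ 3 * ω ^ 3 * V₁ ^ 2 + 4 * Q ^ 3 * ω ^ 3 * U ^ 2 + 5 / 2 * Q ^ 5 * ω * z ^ 2 - 5 /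
    2 * Q ^ 5 * ω ^ 2 * z * V) * hRs

end Corrector

/-! ### Decay of the mode and of the correctors -/

/-- Comparison on the half line bounds w, interpolation on unit intervals bounds w', and parity
covers negative y. -/
lemma expDecay_of_source {w w' g : ℝ → ℝ} {c F β : ℝ} (hβ : 0 < β) (hc : β ^ 2 < c) (hF : 0 ≤ F)
    (hw : ∀ y, HasDerivAt w (w' y) y) (hw' : ∀ y, HasDerivAt w' (c * w y + g y) y)
    (he : Function.Even w) (hlim : Tendsto w (cocompact ℝ) (𝓝 0))
    (hg : ∀ y, |g y| ≤ F * Real.exp (-(β * |y|))) : ExpDecay β w ∧ ExpDecay β w' := by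
  have hc0 : 0 < c := (sq_nonneg β).trans_lt hc
  set K := |w 0| + (F + 1) / (c - β ^ 2) with hK
  have hK0 : 0 ≤ K := by
    have : 0 < c - β ^ 2 := by linarith
    positivity
  have h1 : ∀ y, |w y| ≤ K * Real.exp (-(β * |y|)) := fun y => by
    rw [← even_apply_abs he y]
    refine abs_le_exp_of_source_exp hβ hc hF hw hw' (hlim.mono_left atTop_le_cocompact)
      (fun z hz => ?_) (abs_nonneg y)
    rw [add_sub_cancel_left]
    simpa only [abs_of_pos hz] using hg z
  refine ⟨⟨K, h1⟩, 2 * K + (c * K + F), fun y => ?_⟩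
  have key : ∀ y ≥ 0, |w' y| ≤ (2 * K + (c * K + F)) * Real.exp (-(β * y)) := fun y hy => by
    have hexp : ∀ z ∈ Icc y (y + 1), Real.exp (-(β * |z|)) ≤ Real.exp (-(β * y)) := fun z hz => by
      rw [abs_of_nonneg (hy.trans hz.1)]
      exact Real.exp_le_exp.2 (by nlinarith [hz.1])
    have := abs_deriv_le_of_bounds (y := y) hw hw' (a := K * Real.exp (-(β * y)))
      (b := (c * K + F) * Real.exp (-(β * y)))
      (fun z hz => (h1 z).trans (mul_le_mul_of_nonneg_left (hexp z hz) hK0)) (fun z hz => by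
        refine (abs_add_le _ _).trans ?_
        rw [abs_mul, abs_of_pos hc0, add_mul, mul_assoc]
        exact add_le_add (mul_le_mul_of_nonneg_left
          ((h1 z).trans (mul_le_mul_of_nonneg_left (hexp z hz) hK0)) hc0.le)
          ((hg z).trans (mul_le_mul_of_nonneg_left (hexp z hz) hF)))
    linarith
  rcases le_total 0 y with hy | hy
  · rw [abs_of_nonneg hy]; exact key y hy
  · rw [abs_of_nonpos hy, ← abs_neg, ← odd_of_hasDerivAt_even hw he]
    exact key (-y) (by linarith)

/-- The rate α/2 lies strictly below the natural rates α of the sum and √(2 − α²) of the difference,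
as the comparison requires. It degenerates with α, so it only justifies integrability and
integration by parts; quantitative bounds use the decay of Q. -/
lemma IsInternalMode.expDecay {ω α : ℝ} {W₁ W₂ : ℝ → ℝ} (hω : 0 < ω)
    (h : IsInternalMode ω α W₁ W₂) : ∃ β > 0, ExpDecay β W₁ ∧ ExpDecay β W₂ ∧
      ExpDecay β (deriv W₁) ∧ ExpDecay β (deriv W₂) := by
  obtain ⟨hα0, hα1⟩ := h.alpha_mem
  have d1 := hasDerivAt_of_smooth h.smooth₁
  have d2 := hasDerivAt_of_smooth h.smooth₂
  obtain ⟨M₁, hM₁⟩ := bounded_of_tendsto_cocompact h.smooth₁.continuous h.decay₁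
  obtain ⟨M₂, hM₂⟩ := bounded_of_tendsto_cocompact h.smooth₂.continuous h.decay₂
  have hM : 0 ≤ 4 * (M₁ + M₂) := by
    linarith [(abs_nonneg _).trans (hM₁ 0), (abs_nonneg _).trans (hM₂ 0)]
  have src : ∀ t y, |t| ≤ 4 * (M₁ + M₂) → |ω / 3 * Qw ω y ^ 4 * t| ≤
      64 / 3 * ω * (4 * (M₁ + M₂)) * Real.exp (-(α / 2 * |y|)) := fun t y ht => by
    refine (abs_potential_le hω y t).trans ?_
    have : Real.exp (-(4 * |y|)) ≤ Real.exp (-(α / 2 * |y|)) :=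
      Real.exp_le_exp.2 (by nlinarith [abs_nonneg y])
    gcongr
  have hu := expDecay_of_source (β := α / 2) (c := α ^ 2)
    (F := 64 / 3 * ω * (4 * (M₁ + M₂)))
    (g := fun y => -(ω / 3 * Qw ω y ^ 4 * (W₁ y + W₂ y - 2 * (W₁ y - W₂ y)))) (by positivity)
    (by nlinarith) (by positivity) (fun y => (d1 y).fun_add (d2 y))
    (fun y => (h.solves.hasDerivAt_add h.smooth₁ h.smooth₂ y).congr_deriv (by rw [freq]; ring))
    (fun y => by simp only [h.even₁ y, h.even₂ y]) (by simpa using h.decay₁.add h.decay₂)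
    (fun y => by
      rw [abs_neg]
      refine src _ y ?_
      have e1 := abs_le.1 (hM₁ y)
      have e2 := abs_le.1 (hM₂ y)
      exact abs_le.2 ⟨by linarith, by linarith⟩)
  have hv := expDecay_of_source (β := α / 2) (c := 2 - α ^ 2)
    (F := 64 / 3 * ω * (4 * (M₁ + M₂)))
    (g := fun y => ω / 3 * Qw ω y ^ 4 * (2 * (W₁ y + W₂ y) - (W₁ y - W₂ y))) (by positivity)
    (by nlinarith) (by positivity) (fun y => (d1 y).fun_sub (d2 y))
    (fun y => (h.solves.hasDerivAt_sub h.smooth₁ h.smooth₂ y).congr_deriv (by rw [freq]; ring))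
    (fun y => by simp only [h.even₁ y, h.even₂ y]) (by simpa using h.decay₁.sub h.decay₂)
    (fun y => by
      refine src _ y ?_
      have e1 := abs_le.1 (hM₁ y)
      have e2 := abs_le.1 (hM₂ y)
      exact abs_le.2 ⟨by linarith, by linarith⟩)
  have half : ∀ f g : ℝ → ℝ, ExpDecay (α / 2) (fun y => f y + g y) →
      ExpDecay (α / 2) (fun y => f y - g y) → ExpDecay (α / 2) f ∧ ExpDecay (α / 2) g := by
    intro f g hs hd
    constructor
    · have := (hs.add hd).mul_bdd (ExpDecay.const (1 / 2))
      obtain ⟨K, hK⟩ := this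
      exact ⟨K, fun y => by convert hK y using 2; ring⟩
    · have := (hs.sub hd).mul_bdd (ExpDecay.const (1 / 2))
      obtain ⟨K, hK⟩ := this
      exact ⟨K, fun y => by convert hK y using 2; ring⟩
  obtain ⟨k1, k2⟩ := half _ _ hu.1 hv.1
  obtain ⟨k3, k4⟩ := half _ _ hu.2 hv.2
  exact ⟨α / 2, by positivity, k1, k2, k3, k4⟩

lemma expDecay_Qw {ω : ℝ} (hω : 0 < ω) : ExpDecay 1 (Qw ω) :=
  ⟨3, fun y => by rw [abs_of_pos (Qw_pos ω y), one_mul]; exact Qw_le_exp hω y⟩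

lemma expDecay_zero_Qw {ω : ℝ} (hω : 0 < ω) : ExpDecay 0 (Qw ω) :=
  (expDecay_Qw hω).mono zero_le_one

lemma expDecay_zero_Rw {ω : ℝ} (hω : 0 < ω) : ExpDecay 0 (Rw ω) :=
  ExpDecay.of_bound (abs_Rw_le hω)

/-- Compactness of a cube supplies constants for the long polynomials, uniform in all parameters,
without computing them. -/
lemma exists_bound_of_continuous {n : ℕ} {F : (Fin n → ℝ) → ℝ} (hF : Continuous F) (M : ℝ) :
    ∃ C, ∀ x : Fin n → ℝ, (∀ i, |x i| ≤ M) → |F x| ≤ C := by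
  obtain ⟨C, hC⟩ := (isCompact_univ_pi fun _ : Fin n =>
    isCompact_Icc (a := -M) (b := M)).exists_bound_of_continuousOn hF.continuousOn
  exact ⟨C, fun x hx => hC x fun i _ => abs_le.1 (hx i)⟩

lemma ExpDecay.div_const {β : ℝ} {f : ℝ → ℝ} (hf : ExpDecay β f) (c : ℝ) :
    ExpDecay β fun y => f y / c := by
  simpa only [div_eq_mul_inv] using hf.mul_bdd (ExpDecay.const c⁻¹)

section CorrectorDecay

variable {ω a : ℝ} {u u' v v' : ℝ → ℝ}

/-- The explicit factor Q supplies the decay here and in the next lemmas, so boundedness of the jets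
suffices. -/
lemma expDecay_corrFst (hω : 0 < ω) (hu : ExpDecay 0 u) (hu' : ExpDecay 0 u')
    (hv : ExpDecay 0 v) (hv' : ExpDecay 0 v') :
    ExpDecay 1 fun y => corrFst (Qw ω y) (Rw ω y) (u y) (u' y) (v y) (v' y) := by
  have hQ := expDecay_zero_Qw hω
  have hR := expDecay_zero_Rw hω
  unfold corrFst
  refine (expDecay_Qw hω).mul_bdd ?_
  repeat' first
    | with_reducible assumption
    | with_reducible exact ExpDecay.const _
    | with_reducible apply ExpDecay.add
    | with_reducible apply ExpDecay.sub
    | with_reducible apply ExpDecay.mul_bdd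
    | with_reducible apply ExpDecay.pow

lemma expDecay_corrSnd (hω : 0 < ω) (hu : ExpDecay 0 u) (hu' : ExpDecay 0 u')
    (hv : ExpDecay 0 v) (hv' : ExpDecay 0 v') :
    ExpDecay 1 fun y => corrSnd (Qw ω y) (Rw ω y) (u y) (u' y) (v y) (v' y) := by
  have hQ := expDecay_zero_Qw hω
  have hR := expDecay_zero_Rw hω
  unfold corrSnd
  refine (expDecay_Qw hω).mul_bdd ?_
  repeat' first
    | with_reducible assumption
    | with_reducible exact ExpDecay.const _
    | with_reducible apply ExpDecay.add
    | with_reducible apply ExpDecay.sub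
    | with_reducible apply ExpDecay.mul_bdd
    | with_reducible apply ExpDecay.pow

lemma expDecay_corrFst' (hω : 0 < ω) (hu : ExpDecay 0 u) (hu' : ExpDecay 0 u')
    (hv : ExpDecay 0 v) (hv' : ExpDecay 0 v') :
    ExpDecay 1 fun y => corrFst' (Qw ω y) (Rw ω y) ω a (u y) (u' y) (v y) (v' y) := by
  have hQ := expDecay_zero_Qw hω
  have hR := expDecay_zero_Rw hω
  unfold corrFst'
  refine (expDecay_Qw hω).mul_bdd ?_
  repeat' first
    | with_reducible assumption
    | with_reducible exact ExpDecay.const _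
    | with_reducible apply ExpDecay.add
    | with_reducible apply ExpDecay.sub
    | with_reducible apply ExpDecay.mul_bdd
    | with_reducible apply ExpDecay.pow

lemma expDecay_corrSnd' (hω : 0 < ω) (hu : ExpDecay 0 u) (hu' : ExpDecay 0 u')
    (hv : ExpDecay 0 v) (hv' : ExpDecay 0 v') :
    ExpDecay 1 fun y => corrSnd' (Qw ω y) (Rw ω y) ω a (u y) (u' y) (v y) (v' y) := by
  have hQ := expDecay_zero_Qw hω
  have hR := expDecay_zero_Rw hω
  unfold corrSnd'
  refine (expDecay_Qw hω).mul_bdd ?_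
  repeat' first
    | with_reducible assumption
    | with_reducible exact ExpDecay.const _
    | with_reducible apply ExpDecay.add
    | with_reducible apply ExpDecay.sub
    | with_reducible apply ExpDecay.mul_bdd
    | with_reducible apply ExpDecay.pow

lemma expDecay_srcFst (hω : 0 < ω) (hu : ExpDecay 0 u) (hu' : ExpDecay 0 u')
    (hv : ExpDecay 0 v) (hv' : ExpDecay 0 v') :
    ExpDecay 1 fun y => srcFst (Qw ω y) (Rw ω y) ω a (u y) (u' y) (v y) (v' y) := by
  have hQ := expDecay_zero_Qw hω
  have hR := expDecay_zero_Rw hω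
  unfold srcFst modeFst modeSnd
  refine (expDecay_Qw hω).mul_bdd ?_
  repeat' first
    | with_reducible assumption
    | with_reducible exact ExpDecay.const _
    | with_reducible apply ExpDecay.add
    | with_reducible apply ExpDecay.sub
    | with_reducible apply ExpDecay.mul_bdd
    | with_reducible apply ExpDecay.pow
    | with_reducible apply ExpDecay.neg
    | with_reducible apply ExpDecay.div_const

lemma expDecay_srcSnd (hω : 0 < ω) (hu : ExpDecay 0 u) (hu' : ExpDecay 0 u')
    (hv : ExpDecay 0 v) (hv' : ExpDecay 0 v') :
    ExpDecay 1 fun y => srcSnd (Qw ω y) (Rw ω y) ω a (u y) (u' y) (v y) (v' y) := by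
  have hQ := expDecay_zero_Qw hω
  have hR := expDecay_zero_Rw hω
  unfold srcSnd modeFst modeSnd
  refine (expDecay_Qw hω).mul_bdd ?_
  repeat' first
    | with_reducible assumption
    | with_reducible exact ExpDecay.const _
    | with_reducible apply ExpDecay.add
    | with_reducible apply ExpDecay.sub
    | with_reducible apply ExpDecay.mul_bdd
    | with_reducible apply ExpDecay.pow
    | with_reducible apply ExpDecay.neg
    | with_reducible apply ExpDecay.div_const

lemma expDecay_errFst (hω : 0 < ω) (hu : ExpDecay 0 u) (hu' : ExpDecay 0 u')
    (hv : ExpDecay 0 v) (hv' : ExpDecay 0 v') :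
    ExpDecay 1 fun y => errFst (Qw ω y) (Rw ω y) ω a (u y) (u' y) (v y) (v' y) := by
  have hQ := expDecay_zero_Qw hω
  have hR := expDecay_zero_Rw hω
  unfold errFst remFst
  refine (expDecay_Qw hω).mul_bdd ?_
  repeat' first
    | with_reducible assumption
    | with_reducible exact ExpDecay.const _
    | with_reducible apply ExpDecay.add
    | with_reducible apply ExpDecay.sub
    | with_reducible apply ExpDecay.mul_bdd
    | with_reducible apply ExpDecay.pow
    | with_reducible apply ExpDecay.neg
    | with_reducible apply ExpDecay.div_const

lemma expDecay_errSnd (hω : 0 < ω) (hu : ExpDecay 0 u) (hu' : ExpDecay 0 u')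
    (hv : ExpDecay 0 v) (hv' : ExpDecay 0 v') :
    ExpDecay 1 fun y => errSnd (Qw ω y) (Rw ω y) ω a (u y) (u' y) (v y) (v' y) := by
  have hQ := expDecay_zero_Qw hω
  have hR := expDecay_zero_Rw hω
  unfold errSnd remSnd
  refine (expDecay_Qw hω).mul_bdd ?_
  repeat' first
    | with_reducible assumption
    | with_reducible exact ExpDecay.const _
    | with_reducible apply ExpDecay.add
    | with_reducible apply ExpDecay.sub
    | with_reducible apply ExpDecay.mul_bdd
    | with_reducible apply ExpDecay.pow
    | with_reducible apply ExpDecay.neg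
    | with_reducible apply ExpDecay.div_const

end CorrectorDecay

/-! ### Green's identities for the linearised operators -/

/-- Only f has to decay. This is what permits pairing localised functions with g₁, g₂, which are
merely bounded. -/
lemma integral_green {β : ℝ} (hβ : 0 < β) {f f' f'' g g' g'' : ℝ → ℝ}
    (hf : ∀ y, HasDerivAt f (f' y) y) (hf' : ∀ y, HasDerivAt f' (f'' y) y)
    (hg : ∀ y, HasDerivAt g (g' y) y) (hg' : ∀ y, HasDerivAt g' (g'' y) y)
    (cf'' : Continuous f'') (cg'' : Continuous g'') (df : ExpDecay β f) (df' : ExpDecay β f')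
    (df'' : ExpDecay β f'') (dg : ExpDecay 0 g) (dg' : ExpDecay 0 g') (dg'' : ExpDecay 0 g'') :
    Integrable (fun y => f y * g'' y - f'' y * g y) ∧ ∫ y, (f y * g'' y - f'' y * g y) = 0 := by
  have i1 := (df.mul_bdd dg'').integrable hβ ((continuous_of_hasDerivAt hf).mul cg'')
  have i2 := (df''.mul_bdd dg).integrable hβ (cf''.mul (continuous_of_hasDerivAt hg))
  refine ⟨i1.sub i2, ?_⟩
  rw [integral_sub i1 i2, integral_mul_second_deriv_comm hβ hf hf' hg hg' cf'' cg'' df df' df''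
    dg dg' dg'', sub_self]

section Forms

variable {ω ν β : ℝ} {f₁ f₂ : ℝ → ℝ}

lemma expDecay_coeff (hω : 0 < ω) (a b c : ℝ) :
    ExpDecay 0 fun y => a + b * Qw ω y ^ 2 + c * Qw ω y ^ 4 :=
  ((ExpDecay.const a).add ((ExpDecay.const b).bdd_mul ((expDecay_zero_Qw hω).pow 2))).add
    ((ExpDecay.const c).bdd_mul ((expDecay_zero_Qw hω).pow 4))

lemma ExpDecay.congr {f g : ℝ → ℝ} (hf : ExpDecay β f) (h : ∀ y, f y = g y) : ExpDecay β g := by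
  rwa [← funext h]

lemma expDecay_forms (hω : 0 < ω) (h₁ : ExpDecay β f₁) (h₂ : ExpDecay β f₂)
    (d₁ : ExpDecay β (deriv f₁)) (d₂ : ExpDecay β (deriv f₂)) :
    ExpDecay β (fstForm ω ν f₁ f₂) ∧ ExpDecay β (sndForm ω ν f₁ f₂) ∧
      ExpDecay β (fstForm' ω ν f₁ f₂) ∧ ExpDecay β (sndForm' ω ν f₁ f₂) := by
  have hR := expDecay_zero_Rw hω
  have hk := fun c : ℝ => ExpDecay.const c
  refine ⟨?_, ?_, ?_, ?_⟩
  · refine ((((expDecay_coeff hω 2 (-1) (-(2 / 3 * ω))).bdd_mul h₁).sub ((hk ν).bdd_mul h₂)).add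
      (((hk 2).bdd_mul hR).bdd_mul d₁)).congr fun y => ?_
    rw [fstForm]; ring
  · refine ((((expDecay_coeff hω 2 0 (2 / 3 * ω)).bdd_mul h₂).sub ((hk ν).bdd_mul h₁)).add
      (((hk 2).bdd_mul hR).bdd_mul d₂)).congr fun y => ?_
    rw [sndForm]; ring
  · refine (((expDecay_coeff hω 2 (-2) (-(2 * ω))).bdd_mul (d₁.add (hR.bdd_mul h₁))).sub
      ((hk ν).bdd_mul (d₂.add (((hk 2).bdd_mul hR).bdd_mul h₂)))).congr fun y => ?_
    rw [fstForm']; ring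
  · refine (((((expDecay_coeff hω 2 0 (2 / 3 * ω)).bdd_mul hR).bdd_mul h₂).add
      ((expDecay_coeff hω 2 (-1) (-(2 / 3 * ω))).bdd_mul d₂)).sub
      ((hk ν).bdd_mul (d₁.add (((hk 2).bdd_mul hR).bdd_mul h₁)))).congr fun y => ?_
    rw [sndForm']; ring

lemma expDecay_forms_second (hω : 0 < ω) {g₁ g₂ : ℝ → ℝ} (h₁ : ExpDecay β g₁)
    (h₂ : ExpDecay β g₂) :
    ExpDecay β (fun y => g₁ y - 3 * Qw ω y ^ 2 * g₁ y - 5 * ω * Qw ω y ^ 4 * g₁ y - ν * g₂ y) ∧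
      ExpDecay β (fun y => g₂ y - Qw ω y ^ 2 * g₂ y - ω * Qw ω y ^ 4 * g₂ y - ν * g₁ y) := by
  have hk := fun c : ℝ => ExpDecay.const c
  constructor
  · refine (((expDecay_coeff hω 1 (-3) (-(5 * ω))).bdd_mul h₁).sub ((hk ν).bdd_mul h₂)).congr
      fun y => ?_
    ring
  · refine (((expDecay_coeff hω 1 (-1) (-ω)).bdd_mul h₂).sub ((hk ν).bdd_mul h₁)).congr
      fun y => ?_
    ring

end Forms

/-! ### Vanishing cross pairings and nonvanishing of ⟨V₁, V₂⟩. -/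

section Orthogonality

variable {ω ν : ℝ} {f₁ f₂ h₁ h₂ : ℝ → ℝ}

/-- Solutions at frequencies `ν` and `2 ν` are orthogonal in both cross pairings. -/
lemma cross_pairings_eq_zero {β : ℝ} (hβ : 0 < β) (hω : 0 < ω) (hν : ν ≠ 0)
    (hf : SolvesM ω ν f₁ f₂) (sf₁ : ContDiff ℝ (⊤ : ℕ∞) f₁) (sf₂ : ContDiff ℝ (⊤ : ℕ∞) f₂)
    (hh : SolvesM ω (2 * ν) h₁ h₂) (sh₁ : ContDiff ℝ (⊤ : ℕ∞) h₁) (sh₂ : ContDiff ℝ (⊤ : ℕ∞) h₂)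
    (df₁ : ExpDecay β f₁) (df₂ : ExpDecay β f₂) (df₁' : ExpDecay β (deriv f₁))
    (df₂' : ExpDecay β (deriv f₂)) (dh₁ : ExpDecay 0 h₁) (dh₂ : ExpDecay 0 h₂)
    (dh₁' : ExpDecay 0 (deriv h₁)) (dh₂' : ExpDecay 0 (deriv h₂)) :
    ∫ y, sndForm ω ν f₁ f₂ y * fstForm ω (2 * ν) h₁ h₂ y = 0 ∧
      ∫ y, fstForm ω ν f₁ f₂ y * sndForm ω (2 * ν) h₁ h₂ y = 0 := by
  obtain ⟨D1, D2, D1', D2'⟩ := expDecay_forms (ν := ν) hω df₁ df₂ df₁' df₂'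
  obtain ⟨E1, E2, E1', E2'⟩ := expDecay_forms (ν := 2 * ν) hω dh₁ dh₂ dh₁' dh₂'
  obtain ⟨D1'', D2''⟩ := expDecay_forms_second (ν := ν) hω D1 D2
  obtain ⟨E1'', E2''⟩ := expDecay_forms_second (ν := 2 * ν) hω E1 E2
  have hV1 := hasDerivAt_fstForm hω hf sf₁ sf₂
  have hV2 := hasDerivAt_sndForm hω hf sf₁ sf₂
  have hg1 := hasDerivAt_fstForm hω hh sh₁ sh₂
  have hg2 := hasDerivAt_sndForm hω hh sh₁ sh₂
  have cV1 := continuous_of_hasDerivAt hV1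
  have cV2 := continuous_of_hasDerivAt hV2
  have cg1 := continuous_of_hasDerivAt hg1
  have cg2 := continuous_of_hasDerivAt hg2
  have cQ := continuous_Qw ω
  have G1 := (integral_green hβ hV1 (hasDerivAt_fstForm' hω hf sf₁ sf₂) hg1
    (hasDerivAt_fstForm' hω hh sh₁ sh₂) (by fun_prop) (by fun_prop) D1 D1' D1'' E1 E1' E1'').2
  have G2 := (integral_green hβ hV2 (hasDerivAt_sndForm' hω hf sf₁ sf₂) hg2
    (hasDerivAt_sndForm' hω hh sh₁ sh₂) (by fun_prop) (by fun_prop) D2 D2' D2'' E2 E2' E2'').2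
  have i1 := (D2.mul_bdd E1).integrable hβ (cV2.mul cg1)
  have i2 := (D1.mul_bdd E2).integrable hβ (cV1.mul cg2)
  set I1 := ∫ y, sndForm ω ν f₁ f₂ y * fstForm ω (2 * ν) h₁ h₂ y
  set I2 := ∫ y, fstForm ω ν f₁ f₂ y * sndForm ω (2 * ν) h₁ h₂ y
  -- The potentials cancel in Green's identity and only the frequency terms survive. The two
  -- resulting relations I1 = 2·I2 and I2 = 2·I1 force both to vanish.
  have e1 : ν * I1 - 2 * ν * I2 = 0 := by
    rw [← integral_const_mul, ← integral_const_mul,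
      ← integral_sub (i1.const_mul _) (i2.const_mul _), ← G1]
    congr 1
    funext y
    ring
  have e2 : ν * I2 - 2 * ν * I1 = 0 := by
    rw [← integral_const_mul, ← integral_const_mul,
      ← integral_sub (i2.const_mul _) (i1.const_mul _), ← G2]
    congr 1
    funext y
    ring
  have e3 : I1 = 2 * I2 := mul_left_cancel₀ hν (by linarith)
  have e4 : I2 = 2 * I1 := mul_left_cancel₀ hν (by linarith)
  constructor <;> linarith

/-- The form `⟨L₋ V₂, V₂⟩` is positive unless the mode vanishes. -/
lemma pairing_forms_ne_zero {β : ℝ} (hβ : 0 < β) (hω : 0 < ω)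
    (hf : SolvesM ω ν f₁ f₂) (sf₁ : ContDiff ℝ (⊤ : ℕ∞) f₁) (sf₂ : ContDiff ℝ (⊤ : ℕ∞) f₂)
    (df₁ : ExpDecay β f₁) (df₂ : ExpDecay β f₂) (df₁' : ExpDecay β (deriv f₁))
    (df₂' : ExpDecay β (deriv f₂)) (hne : ν * fstForm ω ν f₁ f₂ 0 ≠ 0) :
    pairing (fstForm ω ν f₁ f₂) (sndForm ω ν f₁ f₂) ≠ 0 := by
  obtain ⟨D1, D2, D1', D2'⟩ := expDecay_forms (ν := ν) hω df₁ df₂ df₁' df₂'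
  have hV1 := hasDerivAt_fstForm hω hf sf₁ sf₂
  have hV2 := hasDerivAt_sndForm hω hf sf₁ sf₂
  have hV2' := hasDerivAt_sndForm' hω hf sf₁ sf₂
  have cV1 := continuous_of_hasDerivAt hV1
  have cV2 := continuous_of_hasDerivAt hV2
  have cV2' := continuous_of_hasDerivAt hV2'
  have cR := continuous_Rw hω
  have hR := expDecay_zero_Rw hω
  set V := sndForm ω ν f₁ f₂
  set V' := sndForm' ω ν f₁ f₂
  set U := fstForm ω ν f₁ f₂
  intro h0
  have d0 : ∀ γ : ℝ, ∀ f : ℝ → ℝ, ExpDecay β f → ExpDecay 0 f := fun _ f hf => hf.mono hβ.le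
  have dT : ExpDecay β fun y => V' y - Rw ω y * V y := D2'.sub (hR.bdd_mul D2)
  have iT2 : Integrable fun y => (V' y - Rw ω y * V y) * (V' y - Rw ω y * V y) :=
    (dT.mul_bdd (d0 0 _ dT)).integrable hβ (by fun_prop)
  have iT : Integrable fun y => (V' y - Rw ω y * V y) * V y :=
    (dT.mul_bdd (d0 0 _ D2)).integrable hβ (by fun_prop)
  have iUV : Integrable fun y => U y * V y := (D1.mul_bdd (d0 0 _ D2)).integrable hβ (by fun_prop)
  -- The factorisation L₋ = (−∂ − R)(∂ − R), written as a total derivative; integrating it gives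
  -- ν⟨U, V⟩ = ∫(V' − RV)².
  have hder : ∀ y, HasDerivAt (fun y => (V' y - Rw ω y * V y) * V y)
      ((V' y - Rw ω y * V y) * (V' y - Rw ω y * V y) - ν * (U y * V y)) y := fun y => by
    refine (((hV2' y).sub ((hasDerivAt_Rw hω y).mul (hV2 y))).mul (hV2 y)).congr_deriv ?_
    have hRs := Rw_sq hω y
    simp only [Pi.sub_apply, Pi.mul_apply]
    linear_combination (-V y ^ 2) * hRs
  have hz := integral_eq_zero_of_hasDerivAt_of_integrable hder (iT2.sub (iUV.const_mul ν)) iT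
  rw [integral_sub iT2 (iUV.const_mul ν), integral_const_mul, show ∫ y, U y * V y = 0 from h0,
    mul_zero, sub_zero, integral_eq_zero_iff_of_nonneg (fun y => mul_self_nonneg _) iT2] at hz
  have hT : ∀ y, V' y = Rw ω y * V y := fun y => by
    have cT : Continuous fun y => (V' y - Rw ω y * V y) * (V' y - Rw ω y * V y) := by fun_prop
    have := congrFun ((Continuous.ae_eq_iff_eq volume cT continuous_zero).1 hz) y
    have := mul_self_eq_zero.1 this
    linarith
  -- If V' = RV everywhere then L₋V = 0; comparing with L₋V = νU at the origin yields νU(0) = 0.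
  have h2 : HasDerivAt V' (ν * U 0 + (V 0 - Qw ω 0 ^ 2 * V 0 - ω * Qw ω 0 ^ 4 * V 0 - ν * U 0)) 0 :=
    by
    rw [show V' = fun y => Rw ω y * V y from funext hT]
    refine ((hasDerivAt_Rw hω 0).mul (hV2 0)).congr_deriv ?_
    have hRs := Rw_sq hω 0
    rw [hT 0]
    linear_combination V 0 * hRs
  have := h2.unique (hV2' 0)
  exact hne (by linarith)

end Orthogonality

/-! ### The leading part of the error pairing -/

/-- The leading profile of the error pairing, as a function of `Q`, `R`, `cos y`, `sin y`. -/
noncomputable def leadTerm (Q R c s : ℝ) : ℝ :=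
  8 * Q * ((2 * Q ^ 2 - 67 / 6 * Q ^ 4 + 17 / 3 * Q ^ 6) * (Q ^ 2 / 2 * c + R * s)
    + (Q ^ 2 + 5 / 2 * Q ^ 4 - 7 / 3 * Q ^ 6) * (R * s))

/-- A localised primitive of the leading profile, up to `(32 / 3) Q cos` and terms of order `ω`. -/
noncomputable def leadPrimitive (ω y : ℝ) : ℝ :=
  Qw ω y * ((-(16 / 3) + 20 / 3 * Qw ω y ^ 2 - 40 / 3 * Qw ω y ^ 4 + 3 * Qw ω y ^ 6) * Real.sin y
    - (16 / 3 + 4 * Qw ω y ^ 2 - 8 / 3 * Qw ω y ^ 4 + 17 / 3 * Qw ω y ^ 6)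
      * (Rw ω y * Real.cos y))

/-- Repeated integration by parts lowers the powers of Q multiplying cos and R sin until Q cos alone
remains. The coefficients of the primitive solve the resulting linear system at ω = 0; the (ω/3)Q⁴
part of R² and the ω-term of R' leave the O(ω) remainder. -/
lemma hasDerivAt_leadPrimitive {ω : ℝ} (hω : 0 < ω) (y : ℝ) :
    HasDerivAt (leadPrimitive ω) (leadTerm (Qw ω y) (Rw ω y) (Real.cos y) (Real.sin y)
      - 32 / 3 * (Qw ω y * Real.cos y) + ω * (Qw ω y * (16 / 3 * Qw ω y ^ 4
        + 20 / 3 * Qw ω y ^ 6 - 56 / 9 * Qw ω y ^ 8 + 17 * Qw ω y ^ 10) * Real.cos y)) y := by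
  unfold leadPrimitive leadTerm
  have hQ := hasDerivAt_Qw ω y
  have hR := hasDerivAt_Rw hω y
  have hs := Real.hasDerivAt_sin y
  have hc := Real.hasDerivAt_cos y
  have H := hQ.fun_mul ((((((hQ.fun_pow 2).const_mul (20 / 3)).const_add (-(16 / 3))).fun_sub
    ((hQ.fun_pow 4).const_mul (40 / 3))).fun_add ((hQ.fun_pow 6).const_mul 3)).fun_mul hs
    |>.fun_sub ((((((hQ.fun_pow 2).const_mul 4).const_add (16 / 3)).fun_sub
    ((hQ.fun_pow 4).const_mul (8 / 3))).fun_add ((hQ.fun_pow 6).const_mul (17 / 3))).fun_mul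
    (hR.fun_mul hc)))
  refine H.congr_deriv ?_
  have hRs := Rw_sq hω y
  push_cast
  generalize Qw ω y = Q at *
  generalize Rw ω y = R at *
  generalize Real.sin y = s at *
  generalize Real.cos y = c at *
  linear_combination (-(16 / 3 * Q + 12 * Q ^ 3 - 40 / 3 * Q ^ 5 + 119 / 3 * Q ^ 7) * c) * hRs

/-- Uniform control of the error pairing by its leading profile. -/
lemma exists_error_pairing_bound : ∃ C, ∀ w Q R a u u₁ v v₁ p p₁ q q₁ c s t : ℝ,
    0 < w → w ≤ 1 → 0 ≤ Q → Q ≤ 2 → |R| ≤ 1 → 0 ≤ a → a ≤ 400 * w ^ 2 →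
    |u| ≤ 3 → |u₁| ≤ 100 * w → |v| ≤ 12 * w → |v₁| ≤ 72 * w →
    |p| ≤ 3 → |p₁| ≤ 5 → |q| ≤ 12 * w → |q₁| ≤ 72 * w → 1 ≤ t →
    |u - 2| ≤ 100 * w * t → |p + 2 * c| ≤ 1000 * w * t → |p₁ - 2 * s| ≤ 2000 * w * t →
    |errFst Q R w a u u₁ v v₁ * modeFst Q R w (2 * a - 1) p p₁ q q₁
      + errSnd Q R w a u u₁ v v₁ * modeSnd Q R w (2 * a - 1) p p₁ q q₁
      - w * leadTerm Q R c s| ≤ C * w ^ 2 * (Q * t) := by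
  -- The part of the pairing that carries ω² explicitly, in variables rescaled so that each is
  -- bounded by 400, the bound for a/w². The constants C₂ and C₃ then control the coefficients of
  -- u²p + 8c and u²p₁ − 8s, which measure the deviation from u = 2, p = −2c, p₁ = 2s.
  obtain ⟨C₁, hC₁⟩ := exists_bound_of_continuous (n := 12) (F := fun x =>
    (fun Q R w b u u₁ v v₁ p p₁ q q₁ : ℝ =>
      u ^ 2 * ((2 * Q ^ 2 - 67 / 6 * Q ^ 4 + 17 / 3 * Q ^ 6) * (-(1 / 3) * Q ^ 4 * p
        + (2 - Q ^ 2 / 2 - w / 3 * Q ^ 4) * q + w * b * (p - w * q) + R * q₁)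
        + (Q ^ 2 + 5 / 2 * Q ^ 4 - 7 / 3 * Q ^ 6) * (1 / 3 * Q ^ 4 * p
        - (2 + w / 3 * Q ^ 4) * q + w * b * (p + w * q) - R * q₁))
      + remFst Q R w b u u₁ v v₁ * modeFst Q R w (2 * (w ^ 2 * b) - 1) p p₁ (w * q) (w * q₁)
      + remSnd Q R w b u u₁ v v₁ * modeSnd Q R w (2 * (w ^ 2 * b) - 1) p p₁ (w * q) (w * q₁))
    (x 0) (x 1) (x 2) (x 3) (x 4) (x 5) (x 6) (x 7) (x 8) (x 9) (x 10) (x 11))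
    (by unfold remFst remSnd modeFst modeSnd; fun_prop) 400
  obtain ⟨C₂, hC₂⟩ := exists_bound_of_continuous (n := 2) (F := fun x =>
    (fun Q _R : ℝ => -(Q ^ 2 / 2) * (2 * Q ^ 2 - 67 / 6 * Q ^ 4 + 17 / 3 * Q ^ 6)) (x 0) (x 1))
    (by fun_prop) 2
  obtain ⟨C₃, hC₃⟩ := exists_bound_of_continuous (n := 2) (F := fun x =>
    (fun Q R : ℝ => R * (3 * Q ^ 2 - 26 / 3 * Q ^ 4 + 10 / 3 * Q ^ 6)) (x 0) (x 1))
    (by fun_prop) 2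
  refine ⟨C₁ + 5500 * C₂ + 10500 * C₃, ?_⟩
  intro w Q R a u u₁ v v₁ p p₁ q q₁ c s t hw hw1 hQ0 hQ hR ha0 ha hu hu₁ hv hv₁ hp hp₁ hq hq₁ ht
    hu2 hpc hps
  obtain ⟨b, rfl⟩ : ∃ b, a = w ^ 2 * b := ⟨a / w ^ 2, by field_simp⟩
  obtain ⟨U, rfl⟩ : ∃ U, u₁ = w * U := ⟨u₁ / w, by field_simp⟩
  obtain ⟨V, rfl⟩ : ∃ V, v = w * V := ⟨v / w, by field_simp⟩
  obtain ⟨V₁, rfl⟩ : ∃ V₁, v₁ = w * V₁ := ⟨v₁ / w, by field_simp⟩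
  obtain ⟨q, rfl⟩ : ∃ z, q = w * z := ⟨q / w, by field_simp⟩
  obtain ⟨q₁, rfl⟩ : ∃ z, q₁ = w * z := ⟨q₁ / w, by field_simp⟩
  have scale : ∀ z K : ℝ, |w * z| ≤ K * w → |z| ≤ K := fun z K h => by
    rw [abs_mul, abs_of_pos hw, mul_comm] at h
    exact le_of_mul_le_mul_right h hw
  have hb : |b| ≤ 400 := by
    have hw2 : 0 < w ^ 2 := by positivity
    rw [abs_of_nonneg (nonneg_of_mul_nonneg_right ha0 hw2)]
    rw [mul_comm] at ha
    exact le_of_mul_le_mul_right ha hw2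
  have hU := scale _ _ hu₁
  have hV := scale _ _ hv
  have hV₁ := scale _ _ hv₁
  have hq' := scale _ _ hq
  have hq₁' := scale _ _ hq₁
  have hQa : |Q| ≤ 2 := by rwa [abs_of_nonneg hQ0]
  have hwa : |w| ≤ 1 := by rwa [abs_of_pos hw]
  have B₁ := hC₁ ![Q, R, w, b, u, U, V, V₁, p, p₁, q, q₁] (fun i => by
    fin_cases i <;> simp <;> linarith)
  have B₂ := hC₂ ![Q, R] (fun i => by fin_cases i <;> simp <;> linarith)
  have B₃ := hC₃ ![Q, R] (fun i => by fin_cases i <;> simp <;> linarith)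
  simp only [Matrix.cons_val] at B₁ B₂ B₃
  have e1 : |u ^ 2 * p + 8 * c| ≤ 5500 * (w * t) := by
    have h1 : |(u - 2) * ((u + 2) * p)| ≤ 100 * w * t * (5 * 3) := by
      rw [abs_mul, abs_mul]
      have : |u + 2| ≤ 5 := (abs_add_le _ _).trans (by rw [abs_two]; linarith)
      gcongr
    have h2 := abs_add_le ((u - 2) * ((u + 2) * p)) (4 * (p + 2 * c))
    rw [abs_mul 4, abs_of_pos (by norm_num : (0 : ℝ) < 4)] at h2
    rw [show u ^ 2 * p + 8 * c = (u - 2) * ((u + 2) * p) + 4 * (p + 2 * c) by ring]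
    linarith
  have e2 : |u ^ 2 * p₁ - 8 * s| ≤ 10500 * (w * t) := by
    have h1 : |(u - 2) * ((u + 2) * p₁)| ≤ 100 * w * t * (5 * 5) := by
      rw [abs_mul, abs_mul]
      have : |u + 2| ≤ 5 := (abs_add_le _ _).trans (by rw [abs_two]; linarith)
      gcongr
    have h2 := abs_add_le ((u - 2) * ((u + 2) * p₁)) (4 * (p₁ - 2 * s))
    rw [abs_mul 4, abs_of_pos (by norm_num : (0 : ℝ) < 4)] at h2
    rw [show u ^ 2 * p₁ - 8 * s = (u - 2) * ((u + 2) * p₁) + 4 * (p₁ - 2 * s) by ring]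
    linarith
  set r₁ := remFst Q R w b u U V V₁ with hr₁
  set r₂ := remSnd Q R w b u U V V₁ with hr₂
  -- The two remainders stay opaque in this identity, so only their linear occurrence matters.
  have split : errFst Q R w (w ^ 2 * b) u (w * U) (w * V) (w * V₁)
        * modeFst Q R w (2 * (w ^ 2 * b) - 1) p p₁ (w * q) (w * q₁)
      + errSnd Q R w (w ^ 2 * b) u (w * U) (w * V) (w * V₁)
        * modeSnd Q R w (2 * (w ^ 2 * b) - 1) p p₁ (w * q) (w * q₁) - w * leadTerm Q R c s =
      w ^ 2 * Q * (u ^ 2 * ((2 * Q ^ 2 - 67 / 6 * Q ^ 4 + 17 / 3 * Q ^ 6) * (-(1 / 3) * Q ^ 4 * p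
        + (2 - Q ^ 2 / 2 - w / 3 * Q ^ 4) * q + w * b * (p - w * q) + R * q₁)
        + (Q ^ 2 + 5 / 2 * Q ^ 4 - 7 / 3 * Q ^ 6) * (1 / 3 * Q ^ 4 * p
        - (2 + w / 3 * Q ^ 4) * q + w * b * (p + w * q) - R * q₁))
      + r₁ * modeFst Q R w (2 * (w ^ 2 * b) - 1) p p₁ (w * q) (w * q₁)
      + r₂ * modeSnd Q R w (2 * (w ^ 2 * b) - 1) p p₁ (w * q) (w * q₁))
      + w * Q * ((-(Q ^ 2 / 2) * (2 * Q ^ 2 - 67 / 6 * Q ^ 4 + 17 / 3 * Q ^ 6))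
          * (u ^ 2 * p + 8 * c))
      + w * Q * (R * (3 * Q ^ 2 - 26 / 3 * Q ^ 4 + 10 / 3 * Q ^ 6) * (u ^ 2 * p₁ - 8 * s)) := by
    unfold errFst errSnd leadTerm
    rw [mul_div_cancel_left₀ _ (pow_ne_zero 2 hw.ne'), mul_div_cancel_left₀ _ hw.ne',
      mul_div_cancel_left₀ _ hw.ne', mul_div_cancel_left₀ _ hw.ne', ← hr₁, ← hr₂]
    clear_value r₁ r₂
    unfold modeFst modeSnd
    ring
  rw [split]
  have hC₁0 : 0 ≤ C₁ := (abs_nonneg _).trans B₁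
  have hwQ : 0 ≤ w * Q := by positivity
  have hw2Q : 0 ≤ w ^ 2 * Q := by positivity
  refine (abs_add_three _ _ _).trans ?_
  rw [abs_mul (w ^ 2 * Q), abs_mul (w * Q), abs_mul (w * Q), abs_of_nonneg hwQ,
    abs_of_nonneg hw2Q]
  have f1 := mul_le_mul_of_nonneg_left B₁ hw2Q
  have f2 := mul_le_mul_of_nonneg_left (mul_le_mul B₂ e1 (abs_nonneg _) ((abs_nonneg _).trans B₂)) hwQ
  have f3 := mul_le_mul_of_nonneg_left (mul_le_mul B₃ e2 (abs_nonneg _) ((abs_nonneg _).trans B₃)) hwQ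
  rw [← abs_mul] at f2 f3
  have f4 : w ^ 2 * Q * C₁ ≤ w ^ 2 * Q * C₁ * t := le_mul_of_one_le_right (by positivity) ht
  linarith

lemma integral_exp_neg_half_abs : ∫ y : ℝ, Real.exp (-(1 / 2 * |y|)) = 4 := by
  rw [integral_comp_abs (f := fun y => Real.exp (-(1 / 2 * y))),
    integral_exp_neg_mul (by norm_num) 0]
  norm_num

/-- The profile absorbs the linear growth of the approximation errors and still leaves an integrable
bound uniform in ω. -/
lemma Qw_mul_one_add_abs_le {ω : ℝ} (hω : 0 < ω) (y : ℝ) :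
    Qw ω y * (1 + |y|) ≤ 6 * Real.exp (-(1 / 2 * |y|)) := by
  have h1 := Qw_le_exp hω y
  have h2 : 1 + |y| ≤ 2 * Real.exp (1 / 2 * |y|) := by
    linarith [Real.add_one_le_exp (1 / 2 * |y|)]
  calc Qw ω y * (1 + |y|) ≤ (3 * Real.exp (-|y|)) * (2 * Real.exp (1 / 2 * |y|)) := by
        have := abs_nonneg y
        gcongr
    _ = 6 * (Real.exp (-|y|) * Real.exp (1 / 2 * |y|)) := by ring
    _ = _ := by rw [← Real.exp_add]; ring_nf

lemma fstForm_eq_modeFst {ω ν a : ℝ} {f₁ f₂ : ℝ → ℝ} (hν : ν = 1 - a) (y : ℝ) :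
    fstForm ω ν f₁ f₂ y = modeFst (Qw ω y) (Rw ω y) ω a (f₁ y + f₂ y) (deriv f₁ y + deriv f₂ y)
      (f₁ y - f₂ y) (deriv f₁ y - deriv f₂ y) := by
  rw [fstForm, modeFst, hν]; ring

lemma sndForm_eq_modeSnd {ω ν a : ℝ} {f₁ f₂ : ℝ → ℝ} (hν : ν = 1 - a) (y : ℝ) :
    sndForm ω ν f₁ f₂ y = modeSnd (Qw ω y) (Rw ω y) ω a (f₁ y + f₂ y) (deriv f₁ y + deriv f₂ y)
      (f₁ y - f₂ y) (deriv f₁ y - deriv f₂ y) := by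
  rw [sndForm, modeSnd, hν]; ring

lemma expDecay_leadPrimitive {ω : ℝ} (hω : 0 < ω) : ExpDecay 1 (leadPrimitive ω) := by
  have hQ := expDecay_zero_Qw hω
  have hR := expDecay_zero_Rw hω
  have hs : ExpDecay 0 Real.sin := ExpDecay.of_bound Real.abs_sin_le_one
  have hc : ExpDecay 0 Real.cos := ExpDecay.of_bound Real.abs_cos_le_one
  unfold leadPrimitive
  refine (expDecay_Qw hω).mul_bdd ?_
  repeat' first
    | with_reducible assumption
    | with_reducible exact ExpDecay.const _
    | with_reducible apply ExpDecay.add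
    | with_reducible apply ExpDecay.sub
    | with_reducible apply ExpDecay.mul_bdd
    | with_reducible apply ExpDecay.pow

lemma expDecay_leadPrimitive_deriv {ω : ℝ} (hω : 0 < ω) : ExpDecay 1 fun y =>
    leadTerm (Qw ω y) (Rw ω y) (Real.cos y) (Real.sin y) - 32 / 3 * (Qw ω y * Real.cos y)
      + ω * (Qw ω y * (16 / 3 * Qw ω y ^ 4 + 20 / 3 * Qw ω y ^ 6 - 56 / 9 * Qw ω y ^ 8
        + 17 * Qw ω y ^ 10) * Real.cos y) := by
  have hQ := expDecay_zero_Qw hω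
  have hR := expDecay_zero_Rw hω
  have hs : ExpDecay 0 Real.sin := ExpDecay.of_bound Real.abs_sin_le_one
  have hc : ExpDecay 0 Real.cos := ExpDecay.of_bound Real.abs_cos_le_one
  have key : ExpDecay 1 fun y => Qw ω y * (8 * ((2 * Qw ω y ^ 2 - 67 / 6 * Qw ω y ^ 4
      + 17 / 3 * Qw ω y ^ 6) * (Qw ω y ^ 2 * (1 / 2) * Real.cos y + Rw ω y * Real.sin y)
      + (Qw ω y ^ 2 + 5 / 2 * Qw ω y ^ 4 - 7 / 3 * Qw ω y ^ 6) * (Rw ω y * Real.sin y))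
      - 32 / 3 * Real.cos y
      + ω * ((16 / 3 * Qw ω y ^ 4 + 20 / 3 * Qw ω y ^ 6 - 56 / 9 * Qw ω y ^ 8
        + 17 * Qw ω y ^ 10) * Real.cos y)) := by
    refine (expDecay_Qw hω).mul_bdd ?_
    repeat' first
      | with_reducible assumption
      | with_reducible exact ExpDecay.const _
      | with_reducible apply ExpDecay.add
      | with_reducible apply ExpDecay.sub
      | with_reducible apply ExpDecay.mul_bdd
      | with_reducible apply ExpDecay.pow
  refine key.congr fun y => ?_
  rw [leadTerm]
  ring

/-- The error pairing equals `(32 / 3) ω ∫ Q cos` up to `O(ω²)`. -/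
lemma exists_integral_error_bound : ∃ C, ∀ ω α : ℝ, ∀ W₁ W₂ h₁ h₂ : ℝ → ℝ, 0 < ω → ω ≤ 1 / 1000 →
    IsInternalMode ω α W₁ W₂ → IsBoundedSolution ω α h₁ h₂ → ∀ E : ℝ → ℝ,
    (∀ y, E y = errFst (Qw ω y) (Rw ω y) ω (α ^ 2) (W₁ y + W₂ y) (deriv W₁ y + deriv W₂ y)
        (W₁ y - W₂ y) (deriv W₁ y - deriv W₂ y) * fstForm ω (2 * freq α) h₁ h₂ y
      + errSnd (Qw ω y) (Rw ω y) ω (α ^ 2) (W₁ y + W₂ y) (deriv W₁ y + deriv W₂ y)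
        (W₁ y - W₂ y) (deriv W₁ y - deriv W₂ y) * sndForm ω (2 * freq α) h₁ h₂ y) →
    Integrable E → |(∫ y, E y) - 32 / 3 * ω * ∫ y, Qw ω y * Real.cos y| ≤ C * ω ^ 2 := by
  obtain ⟨C, hC⟩ := exists_error_pairing_bound
  obtain ⟨K, hK⟩ := exists_bound_of_continuous (n := 1) (F := fun x =>
    16 / 3 * x 0 ^ 4 + 20 / 3 * x 0 ^ 6 - 56 / 9 * x 0 ^ 8 + 17 * x 0 ^ 10) (by fun_prop) 2
  -- The pointwise constant 6 from `Qw_mul_one_add_abs_le` times the integral 4 of e^{−|y|/2}.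
  refine ⟨24 * (|C| + |K|), ?_⟩
  intro ω α W₁ W₂ h₁ h₂ hω hω1 hW hh E hE iE
  obtain ⟨hα0, -⟩ := hW.alpha_mem
  obtain ⟨hα, bW⟩ := hW.bounds hω hω1
  have bh := hh.bounds hω hω1 hα0 hα
  have cQ := continuous_Qw ω
  have cR := continuous_Rw hω
  set P : ℝ → ℝ := fun y =>
    leadTerm (Qw ω y) (Rw ω y) (Real.cos y) (Real.sin y) - 32 / 3 * (Qw ω y * Real.cos y)
      + ω * (Qw ω y * (16 / 3 * Qw ω y ^ 4 + 20 / 3 * Qw ω y ^ 6 - 56 / 9 * Qw ω y ^ 8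
        + 17 * Qw ω y ^ 10) * Real.cos y) with hP
  have cP : Continuous P := by
    rw [hP]
    unfold leadTerm
    fun_prop
  have iP : Integrable P := (expDecay_leadPrimitive_deriv hω).integrable one_pos cP
  have dL := hasDerivAt_leadPrimitive hω
  have iL := (expDecay_leadPrimitive hω).integrable one_pos (continuous_of_hasDerivAt dL)
  have zP : ∫ y, P y = 0 := integral_eq_zero_of_hasDerivAt_of_integrable dL iP iL
  have iQ : Integrable fun y => Qw ω y * Real.cos y :=
    ((expDecay_Qw hω).mul_bdd (ExpDecay.of_bound Real.abs_cos_le_one)).integrable one_pos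
      (cQ.mul Real.continuous_cos)
  have iEP : Integrable fun y => E y - ω * P y := iE.sub (iP.const_mul ω)
  have eq : (∫ y, E y) - 32 / 3 * ω * ∫ y, Qw ω y * Real.cos y =
      ∫ y, (E y - ω * P y - 32 / 3 * ω * (Qw ω y * Real.cos y)) := by
    rw [integral_sub iEP (iQ.const_mul _), integral_sub iE (iP.const_mul ω),
      integral_const_mul, integral_const_mul, zP, mul_zero, sub_zero]
  rw [eq]
  have bound : ∀ y, ‖E y - ω * P y - 32 / 3 * ω * (Qw ω y * Real.cos y)‖ ≤
      6 * (|C| + |K|) * ω ^ 2 * Real.exp (-(1 / 2 * |y|)) := fun y => by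
    obtain ⟨b1, b2, b3, b4, b5⟩ := bW y
    obtain ⟨c1, c2, c3, c4, c5, c6⟩ := bh y
    have hQ0 := (Qw_pos ω y).le
    have ht : 1 ≤ 1 + |y| := by linarith [abs_nonneg y]
    have main := hC ω (Qw ω y) (Rw ω y) (α ^ 2) (W₁ y + W₂ y) (deriv W₁ y + deriv W₂ y)
      (W₁ y - W₂ y) (deriv W₁ y - deriv W₂ y) (h₁ y + h₂ y) (deriv h₁ y + deriv h₂ y)
      (h₁ y - h₂ y) (deriv h₁ y - deriv h₂ y) (Real.cos y) (Real.sin y) (1 + |y|) hω (by linarith)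
      hQ0 (Qw_le_two hω y) (abs_Rw_le hω y) (sq_nonneg α) (by nlinarith) b1 b3 b4 b5 c1 c2 c5 c6 ht
      b2 c3 c4
    have hν : 2 * freq α = 1 - (2 * α ^ 2 - 1) := by rw [freq]; ring
    rw [← fstForm_eq_modeFst hν, ← sndForm_eq_modeSnd hν, ← hE y] at main
    have hk := hK (fun _ => Qw ω y) (fun _ => by
      rw [abs_of_nonneg hQ0]; exact Qw_le_two hω y)
    have e : E y - ω * P y - 32 / 3 * ω * (Qw ω y * Real.cos y) =
        (E y - ω * leadTerm (Qw ω y) (Rw ω y) (Real.cos y) (Real.sin y))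
        - ω ^ 2 * (Qw ω y * ((16 / 3 * Qw ω y ^ 4 + 20 / 3 * Qw ω y ^ 6 - 56 / 9 * Qw ω y ^ 8
        + 17 * Qw ω y ^ 10) * Real.cos y)) := by
      rw [hP]; ring
    rw [e, Real.norm_eq_abs]
    refine (abs_sub _ _).trans ?_
    have f1 : |ω ^ 2 * (Qw ω y * ((16 / 3 * Qw ω y ^ 4 + 20 / 3 * Qw ω y ^ 6 - 56 / 9 * Qw ω y ^ 8
        + 17 * Qw ω y ^ 10) * Real.cos y))| ≤ ω ^ 2 * (Qw ω y * (1 + |y|) * |K|) := by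
      rw [abs_mul, abs_mul, abs_mul, abs_of_nonneg hQ0, abs_of_nonneg (sq_nonneg ω)]
      refine mul_le_mul_of_nonneg_left ?_ (sq_nonneg ω)
      rw [mul_assoc]
      refine mul_le_mul_of_nonneg_left ?_ hQ0
      have h3 := mul_le_mul (hk.trans (le_abs_self K)) (Real.abs_cos_le_one y) (abs_nonneg _)
        (abs_nonneg K)
      refine h3.trans ?_
      rw [mul_one]
      exact le_mul_of_one_le_left (abs_nonneg K) ht
    have f2 : C * ω ^ 2 * (Qw ω y * (1 + |y|)) ≤ |C| * ω ^ 2 * (Qw ω y * (1 + |y|)) := by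
      have := le_abs_self C
      gcongr
    have f3 := Qw_mul_one_add_abs_le hω y
    have f4 := mul_le_mul_of_nonneg_left f3 (by positivity : 0 ≤ (|C| + |K|) * ω ^ 2)
    linarith
  refine (norm_integral_le_of_norm_le
    ((integrable_exp_neg_abs (by norm_num)).const_mul _) (Eventually.of_forall bound)).trans_eq ?_
  rw [integral_const_mul, integral_exp_neg_half_abs]
  ring

/-! ### Assembly: from Γ to the pairing of the error. -/

lemma freq_ne_zero {α : ℝ} (hα : α ∈ Ioo (0 : ℝ) 1) : freq α ≠ 0 := by
  unfold freq
  nlinarith [hα.1, hα.2]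

lemma continuous_G₁ {ω : ℝ} {V₁ V₂ : ℝ → ℝ} (c1 : Continuous V₁) (c2 : Continuous V₂) :
    Continuous (G₁ ω V₁ V₂) := by
  have := continuous_Qw ω
  unfold G₁
  fun_prop

lemma continuous_G₂ {ω : ℝ} {V₁ V₂ : ℝ → ℝ} (c1 : Continuous V₁) (c2 : Continuous V₂) :
    Continuous (G₂ ω V₁ V₂) := by
  have := continuous_Qw ω
  unfold G₂
  fun_prop

lemma expDecay_G {ω : ℝ} (hω : 0 < ω) {V₁ V₂ : ℝ → ℝ} (d1 : ExpDecay 0 V₁) (d2 : ExpDecay 0 V₂) :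
    ExpDecay 1 (G₁ ω V₁ V₂) ∧ ExpDecay 1 (G₂ ω V₁ V₂) := by
  have hQ := expDecay_zero_Qw hω
  constructor
  · have : ExpDecay 1 fun y => Qw ω y * (V₁ y ^ 2 * (3 + 10 * ω * Qw ω y ^ 2)
        - V₂ y ^ 2 * (1 + 2 * ω * Qw ω y ^ 2)) := by
      refine (expDecay_Qw hω).mul_bdd ?_
      repeat' first
        | with_reducible assumption
        | with_reducible exact ExpDecay.const _
        | with_reducible apply ExpDecay.add
        | with_reducible apply ExpDecay.sub
        | with_reducible apply ExpDecay.mul_bdd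
        | with_reducible apply ExpDecay.pow
    refine this.congr fun y => ?_
    rw [G₁]; ring
  · have : ExpDecay 1 fun y => Qw ω y * (2 * V₁ y * V₂ y * (1 + 2 * ω * Qw ω y ^ 2)) := by
      refine (expDecay_Qw hω).mul_bdd ?_
      repeat' first
        | with_reducible assumption
        | with_reducible exact ExpDecay.const _
        | with_reducible apply ExpDecay.add
        | with_reducible apply ExpDecay.mul_bdd
        | with_reducible apply ExpDecay.pow
    refine this.congr fun y => ?_
    rw [G₂]; ring

/-- At the origin R = 0 and Q² = 2 + O(ω), so the coefficient of f₁ nearly cancels and the form is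
essentially −ν f₂(0). This shows V₁(0) ≠ 0 and g₁(0) ≠ 0. -/
lemma abs_form_zero_lower {ω ν : ℝ} (hω : 0 < ω) (hω1 : ω ≤ 1 / 1000) {f₁ f₂ : ℝ → ℝ} :
    |fstForm ω ν f₁ f₂ 0 + ν * f₂ 0| ≤ 8 * ω * |f₁ 0| := by
  have hR : Rw ω 0 = 0 := by simp [Rw]
  have h2 := Qw_sq_le_two hω 0
  have h4 := Qw_four_le hω 0
  have hlow : 2 - 16 / 3 * ω ≤ Qw ω 0 ^ 2 := by
    rw [Qw_sq, le_div_iff₀ (den_pos ω 0)]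
    have ha : aw ω ≤ 1 + 8 / 3 * ω := by
      unfold aw
      refine Real.sqrt_le_iff.2 ⟨by linarith, by nlinarith⟩
    simp only [mul_zero, Real.cosh_zero, mul_one]
    nlinarith [one_le_aw hω]
  have hQ4 : 0 ≤ Qw ω 0 ^ 4 := by positivity
  rw [show fstForm ω ν f₁ f₂ 0 + ν * f₂ 0 =
    (2 - Qw ω 0 ^ 2 - 2 / 3 * ω * Qw ω 0 ^ 4) * f₁ 0 by rw [fstForm, hR]; ring, abs_mul]
  refine mul_le_mul_of_nonneg_right ?_ (abs_nonneg _)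
  rw [abs_le]
  constructor <;> nlinarith

lemma IsBoundedSolution.expDecay {ω α : ℝ} {h₁ h₂ : ℝ → ℝ} (hω : 0 < ω) (hω1 : ω ≤ 1 / 1000)
    (hα0 : 0 < α) (hα : α ≤ 18 * ω) (h : IsBoundedSolution ω α h₁ h₂) :
    ExpDecay 0 h₁ ∧ ExpDecay 0 h₂ ∧ ExpDecay 0 (deriv h₁) ∧ ExpDecay 0 (deriv h₂) := by
  have b := h.bounds hω hω1 hα0 hα
  obtain ⟨M, hM⟩ := h.bounded
  refine ⟨ExpDecay.of_bound fun y => (hM y).1, ExpDecay.of_bound fun y => (hM y).2,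
    ExpDecay.of_bound (K := 5) fun y => ?_, ExpDecay.of_bound (K := 5) fun y => ?_⟩ <;>
  · obtain ⟨-, b2, -, -, -, b6⟩ := b y
    have e1 := abs_le.1 b2
    have e2 := abs_le.1 b6
    exact abs_le.2 ⟨by linarith, by linarith⟩

/-- The quadratic pairing reduces to the pairing of the corrector errors. -/
lemma integral_source_eq_integral_error {β ω α : ℝ} (hβ : 0 < β) (hω : 0 < ω)
    {W₁ W₂ h₁ h₂ : ℝ → ℝ} (hW : IsInternalMode ω α W₁ W₂) (hh : IsBoundedSolution ω α h₁ h₂)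
    (dW₁ : ExpDecay β W₁) (dW₂ : ExpDecay β W₂) (dW₁' : ExpDecay β (deriv W₁))
    (dW₂' : ExpDecay β (deriv W₂)) (dh₁ : ExpDecay 0 h₁) (dh₂ : ExpDecay 0 h₂)
    (dh₁' : ExpDecay 0 (deriv h₁)) (dh₂' : ExpDecay 0 (deriv h₂)) {E : ℝ → ℝ}
    (hE : ∀ y, E y = errFst (Qw ω y) (Rw ω y) ω (α ^ 2) (W₁ y + W₂ y) (deriv W₁ y + deriv W₂ y)
        (W₁ y - W₂ y) (deriv W₁ y - deriv W₂ y) * fstForm ω (2 * freq α) h₁ h₂ y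
      + errSnd (Qw ω y) (Rw ω y) ω (α ^ 2) (W₁ y + W₂ y) (deriv W₁ y + deriv W₂ y)
        (W₁ y - W₂ y) (deriv W₁ y - deriv W₂ y) * sndForm ω (2 * freq α) h₁ h₂ y) :
    Integrable E ∧
    ∫ y, (G₁ ω (fstForm ω (freq α) W₁ W₂) (sndForm ω (freq α) W₁ W₂) y
        * fstForm ω (2 * freq α) h₁ h₂ y
      + G₂ ω (fstForm ω (freq α) W₁ W₂) (sndForm ω (freq α) W₁ W₂) y
        * sndForm ω (2 * freq α) h₁ h₂ y) = ∫ y, E y := by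
  have z : ∀ f : ℝ → ℝ, ExpDecay β f → ExpDecay 0 f := fun f hf => hf.mono hβ.le
  have du := (z _ dW₁).add (z _ dW₂)
  have du' := (z _ dW₁').add (z _ dW₂')
  have dv := (z _ dW₁).sub (z _ dW₂)
  have dv' := (z _ dW₁').sub (z _ dW₂')
  have c1 := hW.smooth₁.continuous
  have c2 := hW.smooth₂.continuous
  have c3 := (contDiff_deriv_of_smooth hW.smooth₁).continuous
  have c4 := (contDiff_deriv_of_smooth hW.smooth₂).continuous
  have cQ := continuous_Qw ω
  have cR := continuous_Rw hω
  have hu : ∀ y, HasDerivAt (fun y => W₁ y + W₂ y) (deriv W₁ y + deriv W₂ y) y := fun y =>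
    (hasDerivAt_of_smooth hW.smooth₁ y).fun_add (hasDerivAt_of_smooth hW.smooth₂ y)
  have hv : ∀ y, HasDerivAt (fun y => W₁ y - W₂ y) (deriv W₁ y - deriv W₂ y) y := fun y =>
    (hasDerivAt_of_smooth hW.smooth₁ y).fun_sub (hasDerivAt_of_smooth hW.smooth₂ y)
  have hu' : ∀ y, HasDerivAt (fun y => deriv W₁ y + deriv W₂ y) (α ^ 2 * (W₁ y + W₂ y)
      - ω / 3 * Qw ω y ^ 4 * (W₁ y + W₂ y - 2 * (W₁ y - W₂ y))) y := fun y =>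
    (hW.solves.hasDerivAt_add hW.smooth₁ hW.smooth₂ y).congr_deriv (by rw [freq]; ring)
  have hv' : ∀ y, HasDerivAt (fun y => deriv W₁ y - deriv W₂ y) ((2 - α ^ 2) * (W₁ y - W₂ y)
      + ω / 3 * Qw ω y ^ 4 * (2 * (W₁ y + W₂ y) - (W₁ y - W₂ y))) y := fun y =>
    (hW.solves.hasDerivAt_sub hW.smooth₁ hW.smooth₂ y).congr_deriv (by rw [freq]; ring)
  obtain ⟨E1, E2, E1', E2'⟩ := expDecay_forms (ν := 2 * freq α) hω dh₁ dh₂ dh₁' dh₂'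
  obtain ⟨E1'', E2''⟩ := expDecay_forms_second (ν := 2 * freq α) hω E1 E2
  have hg1 := hasDerivAt_fstForm hω hh.solves hh.smooth₁ hh.smooth₂
  have hg2 := hasDerivAt_sndForm hω hh.solves hh.smooth₁ hh.smooth₂
  have hg1' := hasDerivAt_fstForm' hω hh.solves hh.smooth₁ hh.smooth₂
  have hg2' := hasDerivAt_sndForm' hω hh.solves hh.smooth₁ hh.smooth₂
  have cg1 := continuous_of_hasDerivAt hg1
  have cg2 := continuous_of_hasDerivAt hg2
  have dA := expDecay_corrFst hω du du' dv dv'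
  have dB := expDecay_corrSnd hω du du' dv dv'
  have dA' := expDecay_corrFst' (a := α ^ 2) hω du du' dv dv'
  have dB' := expDecay_corrSnd' (a := α ^ 2) hω du du' dv dv'
  have dS1 := expDecay_srcFst (a := α ^ 2) hω du du' dv dv'
  have dS2 := expDecay_srcSnd (a := α ^ 2) hω du du' dv dv'
  have dE1 := expDecay_errFst (a := α ^ 2) hω du du' dv dv'
  have dE2 := expDecay_errSnd (a := α ^ 2) hω du du' dv dv'
  have hk := fun c : ℝ => ExpDecay.const c
  have dA'' : ExpDecay 1 fun y => corrFst'' (Qw ω y) (Rw ω y) ω (α ^ 2) (W₁ y + W₂ y)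
      (deriv W₁ y + deriv W₂ y) (W₁ y - W₂ y) (deriv W₁ y - deriv W₂ y) := by
    refine ((((dA.mul_bdd (expDecay_coeff hω 1 (-3) (-(5 * ω)))).sub
      ((hk (2 * (1 - α ^ 2))).bdd_mul dB)).sub dS1).add dE1).congr fun y => ?_
    rw [corrFst'']; ring
  have dB'' : ExpDecay 1 fun y => corrSnd'' (Qw ω y) (Rw ω y) ω (α ^ 2) (W₁ y + W₂ y)
      (deriv W₁ y + deriv W₂ y) (W₁ y - W₂ y) (deriv W₁ y - deriv W₂ y) := by
    refine ((((dB.mul_bdd (expDecay_coeff hω 1 (-1) (-ω))).sub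
      ((hk (2 * (1 - α ^ 2))).bdd_mul dA)).sub dS2).add dE2).congr fun y => ?_
    rw [corrSnd'']; ring
  have cE1 : Continuous fun y => errFst (Qw ω y) (Rw ω y) ω (α ^ 2) (W₁ y + W₂ y)
      (deriv W₁ y + deriv W₂ y) (W₁ y - W₂ y) (deriv W₁ y - deriv W₂ y) := by
    unfold errFst remFst; fun_prop
  have cE2 : Continuous fun y => errSnd (Qw ω y) (Rw ω y) ω (α ^ 2) (W₁ y + W₂ y)
      (deriv W₁ y + deriv W₂ y) (W₁ y - W₂ y) (deriv W₁ y - deriv W₂ y) := by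
    unfold errSnd remSnd; fun_prop
  have cA'' : Continuous fun y => corrFst'' (Qw ω y) (Rw ω y) ω (α ^ 2) (W₁ y + W₂ y)
      (deriv W₁ y + deriv W₂ y) (W₁ y - W₂ y) (deriv W₁ y - deriv W₂ y) := by
    unfold corrFst'' corrFst corrSnd srcFst modeFst modeSnd; fun_prop
  have cB'' : Continuous fun y => corrSnd'' (Qw ω y) (Rw ω y) ω (α ^ 2) (W₁ y + W₂ y)
      (deriv W₁ y + deriv W₂ y) (W₁ y - W₂ y) (deriv W₁ y - deriv W₂ y) := by
    unfold corrSnd'' corrFst corrSnd srcSnd modeFst modeSnd; fun_prop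
  obtain ⟨iA, zA⟩ := integral_green one_pos (hasDerivAt_corrFst hω hu hu' hv hv')
    (hasDerivAt_corrFst' hω hu hu' hv hv') hg1 hg1' cA'' (by fun_prop) dA dA' dA'' E1 E1' E1''
  obtain ⟨iB, zB⟩ := integral_green one_pos (hasDerivAt_corrSnd hω hu hu' hv hv')
    (hasDerivAt_corrSnd' hω hu hu' hv hv') hg2 hg2' cB'' (by fun_prop) dB dB' dB'' E2 E2' E2''
  have iE : Integrable E := by
    rw [show E = _ from funext hE]
    exact ((dE1.mul_bdd E1).integrable one_pos (cE1.mul cg1)).add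
      ((dE2.mul_bdd E2).integrable one_pos (cE2.mul cg2))
  refine ⟨iE, ?_⟩
  -- Adding the two Green integrands, each of integral zero, to E turns it pointwise into G₁g₁ +
  -- G₂g₂.
  have e1 := integral_add iE iA
  have e2 := integral_add (iE.add iA) iB
  rw [zA, add_zero] at e1
  rw [zB, add_zero] at e2
  refine Eq.trans ?_ (e2.trans e1)
  congr 1
  funext y
  have hν : freq α = 1 - α ^ 2 := rfl
  rw [Pi.add_apply, hE y, G₁, G₂, corrFst'', corrSnd'', srcFst, srcSnd, fstForm_eq_modeFst hν,
    sndForm_eq_modeSnd hν, hν]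
  ring

/-- All assertions about a choice of objects, with the main term written as `∫ Q cos`. -/
lemma exists_gam_bound : ∃ C, ∀ ω α : ℝ, ∀ W₁ W₂ h₁ h₂ V₁ V₂ g₁ g₂ : ℝ → ℝ, 0 < ω →
    ω ≤ 1 / 1000 → IsInternalMode ω α W₁ W₂ → IsBoundedSolution ω α h₁ h₂ →
    V₁ = fstComp ω W₁ → V₂ = sndComp ω (freq α) W₁ →
    g₁ = fstComp ω h₁ → g₂ = sndComp ω (2 * freq α) h₁ →
    SolvesL ω (freq α) V₁ V₂ ∧ SolvesL ω (2 * freq α) g₁ g₂ ∧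
    (∃ M : ℝ, ∀ y, |g₁ y| ≤ M ∧ |g₂ y| ≤ M) ∧ (∃ y, g₁ y ≠ 0) ∧
    Integrable (fun y => V₁ y * V₂ y) ∧ pairing V₁ V₂ ≠ 0 ∧
    Integrable (fun y => G₁ ω V₁ V₂ y * V₁ y) ∧ Integrable (fun y => G₂ ω V₁ V₂ y * V₂ y) ∧
    Integrable (fermiIntegrand ω V₁ V₂ g₁ g₂) ∧
    |Gam ω V₁ V₂ g₁ g₂ - 32 / 3 * ω * ∫ y, Qw ω y * Real.cos y| ≤ C * ω ^ 2 := by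
  obtain ⟨C, hC⟩ := exists_integral_error_bound
  refine ⟨C, ?_⟩
  intro ω α W₁ W₂ h₁ h₂ V₁ V₂ g₁ g₂ hω hω1 hW hh eV₁ eV₂ eg₁ eg₂
  obtain ⟨hα, bW⟩ := hW.bounds hω hω1
  have hα0 := hW.alpha_mem.1
  have bh := hh.bounds hω hω1 hα0 hα
  have hfr := freq_ne_zero hW.alpha_mem
  have hfr2 : 2 * freq α ≠ 0 := mul_ne_zero two_ne_zero hfr
  rw [fstComp_eq hω hW.solves hW.smooth₁] at eV₁
  rw [sndComp_eq hω hfr hW.solves hW.smooth₁ hW.smooth₂] at eV₂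
  rw [fstComp_eq hω hh.solves hh.smooth₁] at eg₁
  rw [sndComp_eq hω hfr2 hh.solves hh.smooth₁ hh.smooth₂] at eg₂
  obtain ⟨β, hβ, dW₁, dW₂, dW₁', dW₂'⟩ := hW.expDecay hω
  obtain ⟨dh₁, dh₂, dh₁', dh₂'⟩ := hh.expDecay hω hω1 hα0 hα
  obtain ⟨D1, D2, -, -⟩ := expDecay_forms (ν := freq α) hω dW₁ dW₂ dW₁' dW₂'
  obtain ⟨E1, E2, -, -⟩ := expDecay_forms (ν := 2 * freq α) hω dh₁ dh₂ dh₁' dh₂'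
  have cV1 := continuous_of_hasDerivAt (hasDerivAt_fstForm hω hW.solves hW.smooth₁ hW.smooth₂)
  have cV2 := continuous_of_hasDerivAt (hasDerivAt_sndForm hω hW.solves hW.smooth₁ hW.smooth₂)
  have cg1 := continuous_of_hasDerivAt (hasDerivAt_fstForm hω hh.solves hh.smooth₁ hh.smooth₂)
  have cg2 := continuous_of_hasDerivAt (hasDerivAt_sndForm hω hh.solves hh.smooth₁ hh.smooth₂)
  have cross := cross_pairings_eq_zero hβ hω hfr hW.solves hW.smooth₁ hW.smooth₂ hh.solves
    hh.smooth₁ hh.smooth₂ dW₁ dW₂ dW₁' dW₂' dh₁ dh₂ dh₁' dh₂'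
  have red := integral_source_eq_integral_error hβ hω hW hh dW₁ dW₂ dW₁' dW₂' dh₁ dh₂ dh₁' dh₂'
    (fun y => rfl)
  have fin := hC ω α W₁ W₂ h₁ h₂ hω hω1 hW hh _ (fun y => rfl) red.1
  rw [← red.2] at fin
  have hα2 : α ^ 2 ≤ 1 / 1000 := by nlinarith
  have hV0 : freq α * fstForm ω (freq α) W₁ W₂ 0 ≠ 0 := by
    refine mul_ne_zero hfr ?_
    obtain ⟨-, b2, -, b4, -⟩ := bW 0
    rw [abs_zero, add_zero, mul_one] at b2
    have e2 := abs_le.1 b2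
    have e4 := abs_le.1 b4
    have e5 := abs_form_zero_lower (ν := freq α) hω hω1 (f₁ := W₁) (f₂ := W₂)
    have e6 : |W₁ 0| ≤ 2 := abs_le.2 ⟨by linarith, by linarith⟩
    have e7 := (abs_le.1 (e5.trans (mul_le_mul_of_nonneg_left e6 (by positivity)))).2
    have e8 : 9 / 10 * (9 / 10) ≤ freq α * W₂ 0 := by
      refine mul_le_mul ?_ ?_ (by norm_num) ?_ <;> first | linarith | (unfold freq; linarith)
    intro h0
    rw [h0] at e7
    linarith
  have hg0 : fstForm ω (2 * freq α) h₁ h₂ 0 ≠ 0 := by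
    obtain ⟨-, -, -, -, b5, -⟩ := bh 0
    have e1 := hh.normalised
    have e4 := abs_le.1 b5
    have e5 := abs_form_zero_lower (ν := 2 * freq α) hω hω1 (f₁ := h₁) (f₂ := h₂)
    have e6 : |h₁ 0| ≤ 2 := abs_le.2 ⟨by linarith, by linarith⟩
    have e7 := (abs_le.1 (e5.trans (mul_le_mul_of_nonneg_left e6 (by positivity)))).1
    have e8 : 9 / 10 * (9 / 10) ≤ freq α * (-h₂ 0) := by
      refine mul_le_mul ?_ ?_ (by norm_num) ?_ <;> first | linarith | (unfold freq; linarith)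
    intro h0
    rw [h0] at e7
    linarith
  have hpair := pairing_forms_ne_zero hβ hω hW.solves hW.smooth₁ hW.smooth₂ dW₁ dW₂ dW₁' dW₂' hV0
  have sV := solvesL_forms hω hW.solves hW.smooth₁ hW.smooth₂
  have sg := solvesL_forms hω hh.solves hh.smooth₁ hh.smooth₂
  rw [← eV₁] at D1 cV1 cross fin hpair sV
  rw [← eV₂] at D2 cV2 cross fin hpair sV
  rw [← eg₁] at E1 cg1 cross fin hg0 sg
  rw [← eg₂] at E2 cg2 cross fin sg
  have D1z := D1.mono hβ.le
  have D2z := D2.mono hβ.le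
  obtain ⟨dG1, dG2⟩ := expDecay_G hω D1z D2z
  have cG1 := continuous_G₁ (ω := ω) cV1 cV2
  have cG2 := continuous_G₂ (ω := ω) cV1 cV2
  obtain ⟨M, hM⟩ := E1.bound
  obtain ⟨N, hN⟩ := E2.bound
  have i1 := ((dG1.mul_bdd E1).integrable one_pos (cG1.mul cg1)).add
    ((dG2.mul_bdd E2).integrable one_pos (cG2.mul cg2))
  have i2 := ((D2.mul_bdd E1).integrable hβ (cV2.mul cg1)).const_mul
    (pairing (G₁ ω V₁ V₂) V₁ / pairing V₁ V₂)
  have i3 := ((D1.mul_bdd E2).integrable hβ (cV1.mul cg2)).const_mul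
    (pairing (G₂ ω V₁ V₂) V₂ / pairing V₁ V₂)
  have hI : fermiIntegrand ω V₁ V₂ g₁ g₂ = fun y => (G₁ ω V₁ V₂ y * g₁ y + G₂ ω V₁ V₂ y * g₂ y)
      - pairing (G₁ ω V₁ V₂) V₁ / pairing V₁ V₂ * (V₂ y * g₁ y)
      - pairing (G₂ ω V₁ V₂) V₂ / pairing V₁ V₂ * (V₁ y * g₂ y) := by
    funext y
    rw [fermiIntegrand, G₁top, G₂perp]
    ring
  -- The projection terms are multiples of the vanishing cross pairings, whatever the coefficients
  -- are.
  have hGam : Gam ω V₁ V₂ g₁ g₂ = ∫ y, (G₁ ω V₁ V₂ y * g₁ y + G₂ ω V₁ V₂ y * g₂ y) := by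
    have i12 := i1.sub i2
    simp only [Gam, hI]
    refine (integral_sub i12 i3).trans ?_
    rw [integral_const_mul, cross.2, mul_zero, sub_zero]
    refine (integral_sub i1 i2).trans ?_
    rw [integral_const_mul, cross.1, mul_zero, sub_zero]
    rfl
  refine ⟨sV, sg, ⟨max M N, fun y => ⟨(hM y).trans (le_max_left _ _),
    (hN y).trans (le_max_right _ _)⟩⟩, ⟨0, hg0⟩, (D1.mul_bdd D2z).integrable hβ (cV1.mul cV2), hpair,
    (dG1.mul_bdd D1z).integrable one_pos (cG1.mul cV1),
    (dG2.mul_bdd D2z).integrable one_pos (cG2.mul cV2), ?_, ?_⟩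
  · rw [hI]
    exact (i1.sub i2).sub i3
  · rw [hGam]
    exact fin

/-! ### The integral of Q cos at leading order. -/

lemma hasDerivAt_logistic (y : ℝ) : HasDerivAt (fun y => (1 + Real.exp (-(2 * y)))⁻¹)
    ((2 * Real.cosh y ^ 2)⁻¹) y := by
  have h : HasDerivAt (fun y => 1 + Real.exp (-(2 * y))) (-2 * Real.exp (-(2 * y))) y :=
    ((hasDerivAt_exp_neg_mul 2 y).const_add 1).congr_deriv (by ring)
  have hp : 0 < 1 + Real.exp (-(2 * y)) := by positivity
  refine (h.inv hp.ne').congr_deriv ?_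
  have hc : 2 * Real.cosh y = Real.exp y * (1 + Real.exp (-(2 * y))) := by
    rw [Real.cosh_eq, mul_add, ← Real.exp_add]
    ring_nf
  have he : Real.exp (-(2 * y)) * Real.exp y ^ 2 = 1 := by
    rw [← Real.exp_nat_mul, ← Real.exp_add, ← Real.exp_zero]
    congr 1
    push_cast
    ring
  rw [show 2 * Real.cosh y ^ 2 = (2 * Real.cosh y) ^ 2 / 2 by ring, hc, neg_mul, neg_neg]
  have := Real.exp_pos y
  field_simp
  linear_combination he

lemma image_logistic : (fun y : ℝ => (1 + Real.exp (-(2 * y)))⁻¹) '' univ = Ioo 0 1 := by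
  ext x
  simp only [image_univ, mem_range, mem_Ioo]
  constructor
  · rintro ⟨y, rfl⟩
    have := Real.exp_pos (-(2 * y))
    exact ⟨by positivity, inv_lt_one_of_one_lt₀ (by linarith)⟩
  · rintro ⟨h0, h1⟩
    refine ⟨-(Real.log (x⁻¹ - 1) / 2), ?_⟩
    have : 0 < x⁻¹ - 1 := sub_pos.2 ((one_lt_inv₀ h0).2 h1)
    rw [show -(2 * -(Real.log (x⁻¹ - 1) / 2)) = Real.log (x⁻¹ - 1) by ring, Real.exp_log this]
    simp

/-- With x the logistic function, x/(1 − x) = e^{2y} and x(1 − x) = 1/(4 cosh² y). The Beta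
integrand with exponents 1/2 ± i/2 times dx/dy therefore collapses. -/
lemma logistic_cpow (y : ℝ) : |(2 * Real.cosh y ^ 2)⁻¹| •
    (((1 + Real.exp (-(2 * y)))⁻¹ : ℝ) : ℂ) ^ ((1 / 2 + Complex.I / 2 : ℂ) - 1)
      * (1 - (((1 + Real.exp (-(2 * y)))⁻¹ : ℝ) : ℂ)) ^ ((1 / 2 - Complex.I / 2 : ℂ) - 1)
    = Complex.exp (y * Complex.I) / (Real.cosh y : ℂ) := by
  have hp : 0 < 1 + Real.exp (-(2 * y)) := by positivity
  have hpc : 0 < Real.cosh y := Real.cosh_pos y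
  set L := Real.log (1 + Real.exp (-(2 * y))) with hL
  have e1 : (1 + Real.exp (-(2 * y)))⁻¹ = Real.exp (-L) := by
    rw [Real.exp_neg L, Real.exp_log hp]
  have e2 : 1 - (1 + Real.exp (-(2 * y)))⁻¹ = Real.exp (-(2 * y) - L) := by
    rw [Real.exp_sub, Real.exp_log hp]
    field_simp
    ring
  have hc : 2 * Real.cosh y = Real.exp (y + L) := by
    rw [Real.exp_add, Real.exp_log hp, Real.cosh_eq, mul_add, ← Real.exp_add]
    ring_nf
  have hcpow : ∀ t : ℝ, ∀ s : ℂ, ((Real.exp t : ℝ) : ℂ) ^ s = Complex.exp (t * s) := fun t s => by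
    rw [Complex.cpow_def_of_ne_zero (by exact_mod_cast (Real.exp_pos t).ne'),
      ← Complex.ofReal_log (Real.exp_pos t).le, Real.log_exp]
  rw [← Complex.ofReal_one, ← Complex.ofReal_sub, e2, e1, hcpow, hcpow, abs_of_pos (by positivity),
    Complex.real_smul, mul_assoc, ← Complex.exp_add,
    show ((-L : ℝ) : ℂ) * ((1 : ℝ) / 2 + Complex.I / 2 - (1 : ℝ)) +
      ((-(2 * y) - L : ℝ) : ℂ) * ((1 : ℝ) / 2 - Complex.I / 2 - (1 : ℝ)) =
      ((y + L : ℝ) : ℂ) + y * Complex.I by push_cast; ring, Complex.exp_add, ← Complex.ofReal_exp,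
    ← hc]
  have : (Real.cosh y : ℂ) ≠ 0 := by exact_mod_cast hpc.ne'
  push_cast at this ⊢
  field_simp

/-- The integral equals B(s, 1 − s) = Γ(s)Γ(1 − s) = π / sin(πs) at s = 1/2 + i/2, where the sine is
cosh(π/2). -/
lemma integral_exp_mul_I_div_cosh :
    ∫ y : ℝ, Complex.exp (y * Complex.I) / (Real.cosh y : ℂ) =
      ((Real.pi / Real.cosh (Real.pi / 2) : ℝ) : ℂ) := by
  have hre : ((1 : ℂ) / 2 + Complex.I / 2).re = 1 / 2 := by simp
  have hre' : ((1 : ℂ) / 2 - Complex.I / 2).re = 1 / 2 := by simp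
  have h1 := Complex.Gamma_mul_Gamma_eq_betaIntegral (s := 1 / 2 + Complex.I / 2)
    (t := 1 / 2 - Complex.I / 2) (by rw [hre]; norm_num) (by rw [hre']; norm_num)
  have h2 := Complex.Gamma_mul_Gamma_one_sub (1 / 2 + Complex.I / 2)
  rw [show (1 : ℂ) - (1 / 2 + Complex.I / 2) = 1 / 2 - Complex.I / 2 by ring, h1,
    show (1 / 2 + Complex.I / 2 : ℂ) + (1 / 2 - Complex.I / 2) = 1 by ring, Complex.Gamma_one,
    one_mul] at h2
  have h3 : Complex.sin (Real.pi * (1 / 2 + Complex.I / 2)) = (Real.cosh (Real.pi / 2) : ℝ) := by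
    rw [show (Real.pi : ℂ) * (1 / 2 + Complex.I / 2) =
      (Real.pi / 2 : ℂ) * Complex.I + Real.pi / 2 by ring, Complex.sin_add_pi_div_two,
      Complex.cos_mul_I]
    push_cast
    rfl
  rw [h3, Complex.betaIntegral, intervalIntegral.integral_of_le zero_le_one,
    integral_Ioc_eq_integral_Ioo, ← image_logistic,
    integral_image_eq_integral_abs_deriv_smul MeasurableSet.univ
      (fun y _ => (hasDerivAt_logistic y).hasDerivWithinAt), setIntegral_univ] at h2
  · rw [Complex.ofReal_div, ← h2]
    congr 1
    funext y
    rw [← logistic_cpow y, smul_mul_assoc]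
  · refine StrictMono.injective ?_ |>.injOn
    refine strictMono_of_deriv_pos fun y => ?_
    rw [(hasDerivAt_logistic y).deriv]
    have := Real.cosh_pos y
    positivity

lemma integral_cos_div_cosh :
    ∫ y : ℝ, Real.cos y / Real.cosh y = Real.pi / Real.cosh (Real.pi / 2) := by
  have h := integral_exp_mul_I_div_cosh
  have hi : Integrable fun y : ℝ => Complex.exp (y * Complex.I) / (Real.cosh y : ℂ) := by
    -- A non-integrable function would have integral 0 by convention, contradicting the positive
    -- value just computed.
    by_contra hn
    rw [integral_undef hn] at h
    have h0 : (0 : ℝ) < Real.pi / Real.cosh (Real.pi / 2) :=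
      div_pos Real.pi_pos (Real.cosh_pos _)
    exact h0.ne (by exact_mod_cast h)
  have h2 := Complex.reCLM.integral_comp_comm hi
  rw [h] at h2
  simp only [Complex.reCLM_apply, Complex.ofReal_re] at h2
  rw [← h2]
  congr 1
  funext y
  rw [Complex.div_ofReal_re, Complex.exp_ofReal_mul_I_re]

/-- The squares of the two profiles differ by the relative amount at most a − 1 = O(ω); dividing by
their sum transfers this to the profiles and keeps the decay of 1/cosh. -/
lemma abs_Qw_sub_le {ω : ℝ} (hω : 0 < ω) (y : ℝ) :
    |Qw ω y - Real.sqrt 2 / Real.cosh y| ≤ 8 * ω * Real.exp (-|y|) := by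
  have hc := Real.cosh_pos y
  have hc2 : Real.cosh (2 * y) = 2 * Real.cosh y ^ 2 - 1 := by
    rw [Real.cosh_two_mul, Real.sinh_sq]; ring
  have h2 := Real.sq_sqrt (zero_le_two (α := ℝ))
  have ha1 := one_le_aw hω
  have ha : aw ω - 1 ≤ 8 / 3 * ω := by nlinarith [aw_sq hω]
  have hs : Real.sqrt 2 ≤ 3 / 2 := Real.sqrt_le_left (by norm_num) |>.2 (by norm_num)
  set q := Real.sqrt 2 / Real.cosh y with hq
  have hq0 : 0 < q := by positivity
  have hq2 : q ^ 2 = 2 / Real.cosh y ^ 2 := by rw [hq, div_pow, h2]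
  have hQ := Qw_pos ω y
  have hQ2 := Qw_sq ω y
  have hd := den_pos ω y
  have hc1 := Real.one_le_cosh y
  have hdiff : q ^ 2 - Qw ω y ^ 2 = (aw ω - 1) * (Real.cosh (2 * y) / (1 + aw ω * Real.cosh (2 * y)))
      * q ^ 2 := by
    rw [hq2, hQ2]
    field_simp
    rw [hc2]
    ring
  have hr0 : 0 ≤ Real.cosh (2 * y) / (1 + aw ω * Real.cosh (2 * y)) :=
    div_nonneg (Real.cosh_pos _).le hd.le
  have hr1 : Real.cosh (2 * y) / (1 + aw ω * Real.cosh (2 * y)) ≤ 1 := by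
    rw [div_le_one hd]
    nlinarith [Real.cosh_pos (2 * y)]
  set r := Real.cosh (2 * y) / (1 + aw ω * Real.cosh (2 * y))
  have hle : Qw ω y ≤ q := by
    refine le_of_sq_le_sq ?_ hq0.le
    have : 0 ≤ (aw ω - 1) * r * q ^ 2 := mul_nonneg (mul_nonneg (by linarith) hr0) (sq_nonneg _)
    linarith
  have h4 : q - Qw ω y ≤ 8 / 3 * ω * q := by
    refine le_of_mul_le_mul_right ?_ hq0
    have e1 : (q - Qw ω y) * q ≤ q ^ 2 - Qw ω y ^ 2 := by nlinarith
    have e2 : (aw ω - 1) * r ≤ 8 / 3 * ω := by nlinarith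
    have e3 := mul_le_mul_of_nonneg_right e2 (sq_nonneg q)
    linarith
  have hinv : (Real.cosh y)⁻¹ ≤ 2 * Real.exp (-|y|) := by
    rw [inv_le_comm₀ hc (by positivity), mul_inv, ← Real.exp_neg, neg_neg, ← Real.cosh_abs,
      Real.cosh_eq]
    have := Real.exp_pos (-|y|)
    linarith
  have hq3 : q ≤ 3 * Real.exp (-|y|) := by
    rw [hq, div_eq_mul_inv]
    calc _ ≤ 3 / 2 * (2 * Real.exp (-|y|)) := by gcongr
      _ = _ := by ring
  rw [abs_sub_comm, abs_of_nonneg (by linarith)]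
  calc _ ≤ _ := h4
    _ ≤ 8 / 3 * ω * (3 * Real.exp (-|y|)) := by gcongr
    _ = _ := by ring

lemma exists_integral_Qw_mul_cos_bound : ∃ C, ∀ ω : ℝ, 0 < ω →
    |(∫ y, Qw ω y * Real.cos y) - Real.sqrt 2 * (Real.pi / Real.cosh (Real.pi / 2))| ≤ C * ω := by
  have hE : Integrable fun y : ℝ => Real.exp (-|y|) := by
    simpa only [one_mul] using integrable_exp_neg_abs one_pos
  refine ⟨8 * ∫ y : ℝ, Real.exp (-|y|), fun ω hω => ?_⟩
  have cQ := continuous_Qw ω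
  have i1 : Integrable fun y => Qw ω y * Real.cos y :=
    (hE.const_mul 3).mono' (by fun_prop) (Eventually.of_forall fun y => by
      rw [norm_mul, Real.norm_of_nonneg (Qw_pos ω y).le]
      exact (mul_le_of_le_one_right (Qw_pos ω y).le (Real.abs_cos_le_one y)).trans (Qw_le_exp hω y))
  have hle : ∀ y, |(Qw ω y - Real.sqrt 2 / Real.cosh y) * Real.cos y| ≤
      8 * ω * Real.exp (-|y|) := fun y => by
    rw [abs_mul]
    exact (mul_le_of_le_one_right (abs_nonneg _) (Real.abs_cos_le_one y)).trans (abs_Qw_sub_le hω y)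
  have cc : Continuous fun y => (Qw ω y - Real.sqrt 2 / Real.cosh y) * Real.cos y :=
    (cQ.sub (continuous_const.div Real.continuous_cosh fun y => (Real.cosh_pos y).ne')).mul
      Real.continuous_cos
  have i2 : Integrable fun y => (Qw ω y - Real.sqrt 2 / Real.cosh y) * Real.cos y :=
    (hE.const_mul (8 * ω)).mono' cc.aestronglyMeasurable (Eventually.of_forall hle)
  have key : (∫ y, Qw ω y * Real.cos y) - Real.sqrt 2 * (Real.pi / Real.cosh (Real.pi / 2)) =
      ∫ y, (Qw ω y - Real.sqrt 2 / Real.cosh y) * Real.cos y := by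
    have e := integral_sub i1 i2
    have e' : ∫ y, (Qw ω y * Real.cos y - (Qw ω y - Real.sqrt 2 / Real.cosh y) * Real.cos y) =
        Real.sqrt 2 * (Real.pi / Real.cosh (Real.pi / 2)) := by
      rw [← integral_cos_div_cosh, ← integral_const_mul]
      congr 1
      funext y
      ring
    rw [e'] at e
    linarith
  rw [key]
  refine (norm_integral_le_of_norm_le (hE.const_mul (8 * ω)) (Eventually.of_forall fun y => by
    rw [Real.norm_eq_abs]; exact hle y)).trans_eq ?_
  rw [integral_const_mul]
  ring

/-- The quantitative half of the theorem. -/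
lemma exists_gam_expansion : ∃ C, ∀ ω α : ℝ, ∀ W₁ W₂ h₁ h₂ V₁ V₂ g₁ g₂ : ℝ → ℝ, 0 < ω →
    ω ≤ 1 / 1000 → IsInternalMode ω α W₁ W₂ → IsBoundedSolution ω α h₁ h₂ →
    V₁ = fstComp ω W₁ → V₂ = sndComp ω (freq α) W₁ →
    g₁ = fstComp ω h₁ → g₂ = sndComp ω (2 * freq α) h₁ →
    SolvesL ω (freq α) V₁ V₂ ∧ SolvesL ω (2 * freq α) g₁ g₂ ∧
    (∃ M : ℝ, ∀ y, |g₁ y| ≤ M ∧ |g₂ y| ≤ M) ∧ (∃ y, g₁ y ≠ 0) ∧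
    Integrable (fun y => V₁ y * V₂ y) ∧ pairing V₁ V₂ ≠ 0 ∧
    Integrable (fun y => G₁ ω V₁ V₂ y * V₁ y) ∧ Integrable (fun y => G₂ ω V₁ V₂ y * V₂ y) ∧
    Integrable (fermiIntegrand ω V₁ V₂ g₁ g₂) ∧
    |Gam ω V₁ V₂ g₁ g₂ - Gam₀ * ω| ≤ C * ω ^ 2 := by
  obtain ⟨C₁, hC₁⟩ := exists_gam_bound
  obtain ⟨C₂, hC₂⟩ := exists_integral_Qw_mul_cos_bound
  refine ⟨C₁ + 32 / 3 * C₂, fun ω α W₁ W₂ h₁ h₂ V₁ V₂ g₁ g₂ hω hω1 hW hh e₁ e₂ e₃ e₄ => ?_⟩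
  obtain ⟨k1, k2, k3, k4, k5, k6, k7, k8, k9, k10⟩ :=
    hC₁ ω α W₁ W₂ h₁ h₂ V₁ V₂ g₁ g₂ hω hω1 hW hh e₁ e₂ e₃ e₄
  refine ⟨k1, k2, k3, k4, k5, k6, k7, k8, k9, ?_⟩
  have h1 := abs_le.1 k10
  have h2 := abs_le.1 (hC₂ ω hω)
  have hG : Gam₀ = 32 / 3 * (Real.sqrt 2 * (Real.pi / Real.cosh (Real.pi / 2))) := by
    have := Real.cosh_pos (Real.pi / 2)
    rw [Gam₀]
    field_simp
  rw [hG]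
  exact abs_le.2 ⟨by nlinarith, by nlinarith⟩

/-! ### Existence: integral operators and the coupled linear equation. -/

lemma integrableOn_kernel_mul {k : ℝ → ℝ} {φ : ℝ → ℝ} {a b : ℝ} (hk : Continuous k)
    (hφ : Continuous φ) (ha : ∀ z, |k z| ≤ a) (hb : ∀ z, |φ z| ≤ b) :
    IntegrableOn (fun z => k z * φ z * Real.exp (-z)) (Ioi 0) :=
  integrableOn_of_le_exp (F := a * b) (b := 1) one_pos (by fun_prop) fun z _ => by
    rw [abs_mul, abs_mul, abs_of_pos (Real.exp_pos _), one_mul]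
    have := ha z
    have := hb z
    have := (abs_nonneg _).trans (ha z)
    gcongr

/-- The integral operator on `(0, ∞)` with weight `exp (-z)` and a bounded continuous kernel. -/
noncomputable def kernelApply (k : ℝ × ℝ →ᵇ ℝ) (φ : ℝ →ᵇ ℝ) : ℝ →ᵇ ℝ :=
  BoundedContinuousFunction.ofNormedAddCommGroup
    (fun y => ∫ z in Ioi (0 : ℝ), k (y, z) * φ z * Real.exp (-z))
    (by
      refine continuous_of_dominated (bound := fun z => ‖k‖ * ‖φ‖ * Real.exp (-(1 * z)))
        (fun y => ?_) (fun y => Eventually.of_forall fun z => ?_)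
        ((integrableOn_exp_neg_mul one_pos 0).const_mul _) (Eventually.of_forall fun z => ?_)
      · exact Continuous.aestronglyMeasurable (by fun_prop)
      · rw [norm_mul, norm_mul, Real.norm_of_nonneg (Real.exp_pos _).le, one_mul]
        have := k.norm_coe_le_norm (y, z)
        have := φ.norm_coe_le_norm z
        gcongr
      · fun_prop)
    (‖k‖ * ‖φ‖) (fun y => by
      refine (abs_integral_Ioi_le (F := ‖k‖ * ‖φ‖) (b := 1) (y := 0) one_pos
        fun z _ => ?_).trans_eq (by simp)
      rw [abs_mul, abs_mul, abs_of_pos (Real.exp_pos _), one_mul]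
      have := k.norm_coe_le_norm (y, z)
      have := φ.norm_coe_le_norm z
      rw [Real.norm_eq_abs] at *
      gcongr)

lemma norm_kernelApply_le (k : ℝ × ℝ →ᵇ ℝ) (φ : ℝ →ᵇ ℝ) : ‖kernelApply k φ‖ ≤ ‖k‖ * ‖φ‖ := by
  unfold kernelApply
  exact BoundedContinuousFunction.norm_ofNormedAddCommGroup_le _ (by positivity) _

lemma integrableOn_kernelApply (k : ℝ × ℝ →ᵇ ℝ) (φ : ℝ →ᵇ ℝ) (y : ℝ) :
    IntegrableOn (fun z => k (y, z) * φ z * Real.exp (-z)) (Ioi 0) :=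
  integrableOn_kernel_mul (by fun_prop) φ.continuous (fun z => k.norm_coe_le_norm (y, z))
    φ.norm_coe_le_norm

/-- `kernelApply` as a continuous bilinear map. -/
noncomputable def kernelOp : (ℝ × ℝ →ᵇ ℝ) →L[ℝ] (ℝ →ᵇ ℝ) →L[ℝ] (ℝ →ᵇ ℝ) :=
  LinearMap.mkContinuous₂ (LinearMap.mk₂ ℝ kernelApply
    (fun k l φ => by
      ext y
      refine Eq.trans ?_ (integral_add (integrableOn_kernelApply k φ y)
        (integrableOn_kernelApply l φ y))
      refine congrArg _ (funext fun z => ?_)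
      simp only [BoundedContinuousFunction.coe_add, Pi.add_apply]
      ring)
    (fun c k φ => by
      ext y
      refine Eq.trans ?_ (integral_const_mul c _)
      refine congrArg _ (funext fun z => ?_)
      simp only [BoundedContinuousFunction.coe_smul, smul_eq_mul]
      ring)
    (fun k φ ψ => by
      ext y
      refine Eq.trans ?_ (integral_add (integrableOn_kernelApply k φ y)
        (integrableOn_kernelApply k ψ y))
      refine congrArg _ (funext fun z => ?_)
      simp only [BoundedContinuousFunction.coe_add, Pi.add_apply]
      ring)
    (fun c k φ => by
      ext y
      refine Eq.trans ?_ (integral_const_mul c _)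
      refine congrArg _ (funext fun z => ?_)
      simp only [BoundedContinuousFunction.coe_smul, smul_eq_mul]
      ring)) 1
    (fun k φ => by
      rw [one_mul]
      exact norm_kernelApply_le k φ)

lemma kernelOp_apply (k : ℝ × ℝ →ᵇ ℝ) (φ : ℝ →ᵇ ℝ) (y : ℝ) :
    kernelOp k φ y = ∫ z in Ioi (0 : ℝ), k (y, z) * φ z * Real.exp (-z) := rfl

lemma norm_kernelOp_le (k : ℝ × ℝ →ᵇ ℝ) : ‖kernelOp k‖ ≤ ‖k‖ :=
  ContinuousLinearMap.opNorm_le_bound _ (norm_nonneg _) (norm_kernelApply_le k)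

section Coupled

variable {E : Type*} [NormedAddCommGroup E] [NormedSpace ℝ E]

/-- The operator `(φ, ψ) ↦ (A φ - 2 B ψ, B ψ - 2 A φ)`. -/
noncomputable def coupledOp (A B : E →L[ℝ] E) : E × E →L[ℝ] E × E :=
  (ContinuousLinearMap.inl ℝ E E).comp (A.comp (ContinuousLinearMap.fst ℝ E E)
      - (2 : ℝ) • B.comp (ContinuousLinearMap.snd ℝ E E))
    + (ContinuousLinearMap.inr ℝ E E).comp (B.comp (ContinuousLinearMap.snd ℝ E E)
      - (2 : ℝ) • A.comp (ContinuousLinearMap.fst ℝ E E))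

lemma coupledOp_apply (A B : E →L[ℝ] E) (x : E × E) :
    coupledOp A B x = (A x.1 - (2 : ℝ) • B x.2, B x.2 - (2 : ℝ) • A x.1) := by
  simp [coupledOp]

lemma norm_coupledOp_le {A B : E →L[ℝ] E} {M : ℝ} (hA : ‖A‖ ≤ M) (hB : ‖B‖ ≤ M) :
    ‖coupledOp A B‖ ≤ 3 * M := by
  have hM : 0 ≤ M := (norm_nonneg A).trans hA
  refine ContinuousLinearMap.opNorm_le_bound _ (by positivity) fun x => ?_
  have h1 : ‖A x.1‖ ≤ M * ‖x‖ := (A.le_opNorm _).trans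
    (mul_le_mul hA (norm_fst_le x) (norm_nonneg _) hM)
  have h2 : ‖B x.2‖ ≤ M * ‖x‖ := (B.le_opNorm _).trans
    (mul_le_mul hB (norm_snd_le x) (norm_nonneg _) hM)
  have h3 : ∀ z : E, ‖(2 : ℝ) • z‖ = 2 * ‖z‖ := fun z => by
    rw [norm_smul, Real.norm_of_nonneg zero_le_two]
  rw [coupledOp_apply, Prod.norm_mk]
  refine max_le ((norm_sub_le _ _).trans ?_) ((norm_sub_le _ _).trans ?_) <;>
    (rw [h3]; linarith)

/-- The solution of `φ = b + ω (A φ - 2 B ψ)`, `ψ = -2 b + ω (B ψ - 2 A φ)`. -/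
noncomputable def coupledSol (ω : ℝ) (A B : E →L[ℝ] E) (b : E) : E × E :=
  Ring.inverse (1 - ω • coupledOp A B) (b, -(2 : ℝ) • b)

lemma norm_smul_coupledOp_le {ω M : ℝ} {A B : E →L[ℝ] E} (hω : 0 ≤ ω) (hA : ‖A‖ ≤ M)
    (hB : ‖B‖ ≤ M) (h : ω * (3 * M) ≤ 1 / 2) : ‖ω • coupledOp A B‖ ≤ 1 / 2 := by
  rw [norm_smul, Real.norm_of_nonneg hω]
  exact (mul_le_mul_of_nonneg_left (norm_coupledOp_le hA hB) hω).trans h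

variable [CompleteSpace E]

/-- The coupled operator has norm at most 3M, so 1 − ω·(operator) is invertible. The last bound says
that the first component is its source up to O(ω), which is needed for the sign of the matching
integral. -/
lemma coupledSol_spec {ω M : ℝ} {A B : E →L[ℝ] E} (hω : 0 ≤ ω) (hA : ‖A‖ ≤ M) (hB : ‖B‖ ≤ M)
    (h : ω * (3 * M) ≤ 1 / 2) (b : E) :
    (coupledSol ω A B b).1 = b + ω • (A (coupledSol ω A B b).1
      - (2 : ℝ) • B (coupledSol ω A B b).2) ∧
    (coupledSol ω A B b).2 = -(2 : ℝ) • b + ω • (B (coupledSol ω A B b).2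
      - (2 : ℝ) • A (coupledSol ω A B b).1) ∧
    ‖coupledSol ω A B b‖ ≤ 4 * ‖b‖ ∧ ‖(coupledSol ω A B b).1 - b‖ ≤ ω * (12 * M) * ‖b‖ := by
  set x := coupledSol ω A B b with hx
  have hn := norm_smul_coupledOp_le hω hA hB h
  have hu : IsUnit (1 - ω • coupledOp A B) :=
    isUnit_one_sub_of_norm_lt_one (hn.trans_lt (by norm_num))
  have h1 : (1 - ω • coupledOp A B) x = (b, -(2 : ℝ) • b) := by
    rw [hx, coupledSol, ← mul_apply_eq_comp, Ring.mul_inverse_cancel _ hu,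
      one_apply_eq_self]
  have h2 : x = (b, -(2 : ℝ) • b) + ω • coupledOp A B x := by
    rw [← h1]
    simp
  have hb : ‖(b, -(2 : ℝ) • b)‖ ≤ 2 * ‖b‖ := by
    rw [Prod.norm_mk, norm_smul, norm_neg, Real.norm_of_nonneg zero_le_two]
    exact max_le (by linarith [norm_nonneg b]) le_rfl
  have hxn : ‖x‖ ≤ 4 * ‖b‖ := by
    have e1 : ‖x‖ ≤ ‖(b, -(2 : ℝ) • b)‖ + ‖(ω • coupledOp A B) x‖ := by
      conv_lhs => rw [h2]
      exact norm_add_le _ _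
    have e2 := (ω • coupledOp A B).le_of_opNorm_le hn x
    linarith
  have e1 : x.1 = b + ω • (A x.1 - (2 : ℝ) • B x.2) := by
    conv_lhs => rw [h2, coupledOp_apply]
    rfl
  have e2 : x.2 = -(2 : ℝ) • b + ω • (B x.2 - (2 : ℝ) • A x.1) := by
    conv_lhs => rw [h2, coupledOp_apply]
    rfl
  refine ⟨e1, e2, hxn, ?_⟩
  have e3 : x.1 - b = (ω • coupledOp A B x).1 := by
    rw [coupledOp_apply]
    conv_lhs => rw [e1]
    simp
  have hM : 0 ≤ M := (norm_nonneg A).trans hA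
  rw [e3]
  refine (norm_fst_le _).trans ?_
  rw [norm_smul, Real.norm_of_nonneg hω]
  have e4 := (coupledOp A B).le_of_opNorm_le (norm_coupledOp_le hA hB) x
  calc ω * ‖coupledOp A B x‖ ≤ ω * (3 * M * (4 * ‖b‖)) := by gcongr; exact e4.trans (by gcongr)
    _ = _ := by ring

/-- Inversion is continuous at units. Continuous dependence on the parameter is what the
intermediate value argument for α requires. -/
lemma continuous_coupledSol {ω M : ℝ} {A B : ℝ → E →L[ℝ] E} {b : ℝ → E} (hω : 0 ≤ ω)
    (hA : ∀ t, ‖A t‖ ≤ M) (hB : ∀ t, ‖B t‖ ≤ M) (h : ω * (3 * M) ≤ 1 / 2) (cA : Continuous A)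
    (cB : Continuous B) (cb : Continuous b) :
    Continuous fun t => coupledSol ω (A t) (B t) (b t) := by
  have c1 : Continuous fun t => 1 - ω • coupledOp (A t) (B t) := by
    unfold coupledOp
    fun_prop
  have c2 : Continuous fun t => Ring.inverse (1 - ω • coupledOp (A t) (B t)) := by
    refine continuous_iff_continuousAt.2 fun t => ?_
    have hu : IsUnit (1 - ω • coupledOp (A t) (B t)) := isUnit_one_sub_of_norm_lt_one
      ((norm_smul_coupledOp_le hω (hA t) (hB t) h).trans_lt (by norm_num))
    obtain ⟨U, hU⟩ := hu
    have h1 := NormedRing.inverse_continuousAt U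
    rw [hU] at h1
    exact ContinuousAt.comp (f := fun t => 1 - ω • coupledOp (A t) (B t)) h1 c1.continuousAt
  exact c2.clm_apply (cb.prodMk (cb.const_smul _))

end Coupled

lemma abs_exp_neg_sub_exp_neg_le {a b : ℝ} (ha : 0 ≤ a) (hb : 0 ≤ b) :
    |Real.exp (-a) - Real.exp (-b)| ≤ |a - b| := by
  wlog h : a ≤ b generalizing a b
  · rw [abs_sub_comm, abs_sub_comm a]
    exact this hb ha (le_of_not_ge h)
  have h1 : Real.exp (-b) = Real.exp (-a) * Real.exp (-(b - a)) := by
    rw [← Real.exp_add]; ring_nf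
  have h2 := Real.add_one_le_exp (-(b - a))
  have h3 : Real.exp (-a) ≤ 1 := Real.exp_le_one_iff.2 (by linarith)
  have h4 : Real.exp (-(b - a)) ≤ 1 := Real.exp_le_one_iff.2 (by linarith)
  have h5 := Real.exp_pos (-a)
  rw [abs_of_nonneg (by rw [h1]; nlinarith), abs_of_nonpos (by linarith), h1]
  nlinarith

/-! ### Kernels on the half line and their weighted bounds. -/

/-- The decaying fundamental solution `exp (-κ r) / κ`. -/
noncomputable def expRatio (κ r : ℝ) : ℝ := Real.exp (-(κ * r)) / κ

/-- The Neumann Green function of `κ² - ∂²` on the half line. -/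
noncomputable def greenKernel (κ y z : ℝ) : ℝ := (expRatio κ |y - z| + expRatio κ (y + z)) / 2

/-- The Neumann Green function with its singular part at `κ = 0` removed. -/
noncomputable def reducedKernel (κ y z : ℝ) : ℝ := greenKernel κ y z - expRatio κ y

/-- The Volterra kernel of `τ² + ∂²`. -/
noncomputable def sineKernel (τ y z : ℝ) : ℝ := -(Real.sin (τ * max (y - z) 0) / τ)

lemma expRatio_nonneg {κ : ℝ} (hκ : 0 < κ) (r : ℝ) : 0 ≤ expRatio κ r := by
  unfold expRatio; positivity

lemma expRatio_le_one {κ r : ℝ} (hκ : 1 ≤ κ) (hr : 0 ≤ r) : expRatio κ r ≤ 1 := by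
  have : Real.exp (-(κ * r)) ≤ 1 := Real.exp_le_one_iff.2 (by nlinarith)
  exact div_le_one_of_le₀ (by linarith) (by linarith)

/-- The Lipschitz constant κ of the exponential cancels the factor 1/κ, so differences stay bounded
as κ → 0. -/
lemma abs_expRatio_sub_le {κ r s : ℝ} (hκ : 0 < κ) (hr : 0 ≤ r) (hs : 0 ≤ s) :
    |expRatio κ r - expRatio κ s| ≤ |r - s| := by
  unfold expRatio
  rw [← sub_div, abs_div, abs_of_pos hκ, div_le_iff₀ hκ]
  refine (abs_exp_neg_sub_exp_neg_le (by positivity) (by positivity)).trans_eq ?_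
  rw [← mul_sub, abs_mul, abs_of_pos hκ, mul_comm]

/-- The constant degenerates with ε, which is harmless: it serves only to prove continuity in the
parameter. -/
lemma abs_expRatio_sub_param_le {a b ε r : ℝ} (hε : 0 < ε) (hε1 : ε ≤ 1) (ha : ε ≤ a) (hb : ε ≤ b)
    (hr : 0 ≤ r) : |expRatio a r - expRatio b r| ≤ |a - b| / ε ^ 2 * (1 + r) := by
  have ha0 : 0 < a := by linarith
  have hb0 : 0 < b := by linarith
  have h1 : expRatio a r - expRatio b r = (Real.exp (-(a * r)) - Real.exp (-(b * r))) / a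
      + Real.exp (-(b * r)) * ((b - a) / (a * b)) := by
    unfold expRatio
    field_simp
    ring
  have h2 : |Real.exp (-(a * r)) - Real.exp (-(b * r))| ≤ |a - b| * r := by
    refine (abs_exp_neg_sub_exp_neg_le (by positivity) (by positivity)).trans_eq ?_
    rw [← sub_mul, abs_mul, abs_of_nonneg hr]
  have h3 : |(Real.exp (-(a * r)) - Real.exp (-(b * r))) / a| ≤ |a - b| * r / ε ^ 2 := by
    rw [abs_div, abs_of_pos ha0]
    refine div_le_div₀ (by positivity) h2 (by positivity) ?_
    nlinarith
  have h4 : |Real.exp (-(b * r)) * ((b - a) / (a * b))| ≤ |a - b| / ε ^ 2 := by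
    rw [abs_mul, abs_of_pos (Real.exp_pos _), abs_div, abs_of_pos (mul_pos ha0 hb0), abs_sub_comm]
    have : Real.exp (-(b * r)) ≤ 1 := Real.exp_le_one_iff.2 (by nlinarith)
    refine (mul_le_of_le_one_left (by positivity) this).trans ?_
    exact div_le_div_of_nonneg_left (abs_nonneg _) (by positivity) (by nlinarith)
  rw [h1]
  refine (abs_add_le _ _).trans ((add_le_add h3 h4).trans_eq ?_)
  ring

lemma abs_greenKernel_le {κ y z : ℝ} (hκ : 1 ≤ κ) (hy : 0 ≤ y) (hz : 0 ≤ z) :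
    |greenKernel κ y z| ≤ 1 := by
  have h1 := expRatio_nonneg (by linarith : 0 < κ) |y - z|
  have h2 := expRatio_nonneg (by linarith : 0 < κ) (y + z)
  have h3 := expRatio_le_one hκ (abs_nonneg (y - z))
  have h4 := expRatio_le_one hκ (add_nonneg hy hz)
  unfold greenKernel
  exact abs_le.2 ⟨by linarith, by linarith⟩

lemma abs_reducedKernel_le {κ y z : ℝ} (hκ : 0 < κ) (hy : 0 ≤ y) (hz : 0 ≤ z) :
    |reducedKernel κ y z| ≤ z := by
  have h1 := abs_expRatio_sub_le hκ (abs_nonneg (y - z)) hy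
  have h2 := abs_expRatio_sub_le hκ (add_nonneg hy hz) hy
  have h3 : |(|y - z| - y)| ≤ z := by
    rcases abs_cases (y - z) with h | h <;> rw [h.1] <;> exact abs_le.2 ⟨by linarith, by linarith⟩
  rw [add_sub_cancel_left, abs_of_nonneg hz] at h2
  have h4 : reducedKernel κ y z = ((expRatio κ |y - z| - expRatio κ y)
      + (expRatio κ (y + z) - expRatio κ y)) / 2 := by
    unfold reducedKernel greenKernel; ring
  rw [h4, abs_div, abs_two, div_le_iff₀ two_pos]
  linarith [abs_add_le (expRatio κ |y - z| - expRatio κ y) (expRatio κ (y + z) - expRatio κ y)]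

lemma abs_sineKernel_le {τ y z : ℝ} (hτ : 1 / 2 ≤ τ) : |sineKernel τ y z| ≤ 2 := by
  unfold sineKernel
  have hτ0 : 0 < τ := by linarith
  rw [abs_neg, abs_div, abs_of_pos hτ0, div_le_iff₀ hτ0]
  linarith [Real.abs_sin_le_one (τ * max (y - z) 0)]

lemma abs_greenKernel_sub_le {a b ε y z : ℝ} (hε : 0 < ε) (hε1 : ε ≤ 1) (ha : ε ≤ a) (hb : ε ≤ b)
    (hy : 0 ≤ y) (hz : 0 ≤ z) :
    |greenKernel a y z - greenKernel b y z| ≤ |a - b| / ε ^ 2 * ((1 + y) * (1 + z)) := by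
  have h1 := abs_expRatio_sub_param_le hε hε1 ha hb (abs_nonneg (y - z))
  have h2 := abs_expRatio_sub_param_le hε hε1 ha hb (add_nonneg hy hz)
  have h3 : |y - z| ≤ y + z := abs_le.2 ⟨by linarith, by linarith⟩
  have h4 : greenKernel a y z - greenKernel b y z = ((expRatio a |y - z| - expRatio b |y - z|)
      + (expRatio a (y + z) - expRatio b (y + z))) / 2 := by
    unfold greenKernel; ring
  have h5 : 0 ≤ |a - b| / ε ^ 2 := by positivity
  rw [h4, abs_div, abs_two, div_le_iff₀ two_pos]
  refine (abs_add_le _ _).trans ((add_le_add h1 h2).trans ?_)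
  rw [← mul_add, mul_assoc]
  exact mul_le_mul_of_nonneg_left (by nlinarith) h5

lemma abs_reducedKernel_sub_le {a b ε y z : ℝ} (hε : 0 < ε) (hε1 : ε ≤ 1) (ha : ε ≤ a)
    (hb : ε ≤ b) (hy : 0 ≤ y) (hz : 0 ≤ z) :
    |reducedKernel a y z - reducedKernel b y z| ≤
      2 * (|a - b| / ε ^ 2) * ((1 + y) * (1 + z)) := by
  have h1 := abs_greenKernel_sub_le hε hε1 ha hb hy hz
  have h2 := abs_expRatio_sub_param_le hε hε1 ha hb hy
  have h4 : reducedKernel a y z - reducedKernel b y z = (greenKernel a y z - greenKernel b y z)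
      - (expRatio a y - expRatio b y) := by
    unfold reducedKernel; ring
  have h5 : 0 ≤ |a - b| / ε ^ 2 := by positivity
  rw [h4]
  refine (abs_sub _ _).trans ((add_le_add h1 h2).trans ?_)
  rw [← mul_add, mul_comm 2, mul_assoc]
  exact mul_le_mul_of_nonneg_left (by nlinarith) h5

lemma continuous_greenKernel (κ : ℝ) : Continuous fun p : ℝ × ℝ => greenKernel κ p.1 p.2 := by
  unfold greenKernel expRatio; fun_prop

lemma continuous_reducedKernel (κ : ℝ) : Continuous fun p : ℝ × ℝ => reducedKernel κ p.1 p.2 := by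
  unfold reducedKernel greenKernel expRatio; fun_prop

lemma continuous_sineKernel (τ : ℝ) : Continuous fun p : ℝ × ℝ => sineKernel τ p.1 p.2 := by
  unfold sineKernel; fun_prop

section Weighted

variable {ω : ℝ}

lemma Qw_sq_mul_one_add_abs_le (hω : 0 < ω) (y : ℝ) : Qw ω y ^ 2 * (1 + |y|) ≤ 8 := by
  have h1 := Qw_sq_le_exp hω y
  have h2 : 1 + |y| ≤ Real.exp (2 * |y|) := by
    linarith [Real.add_one_le_exp (2 * |y|), abs_nonneg y]
  calc Qw ω y ^ 2 * (1 + |y|) ≤ (8 * Real.exp (-(2 * |y|))) * Real.exp (2 * |y|) := by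
        have := abs_nonneg y; gcongr
    _ = 8 := by rw [mul_assoc, ← Real.exp_add]; simp

lemma Qw_sq_mul_exp_mul_one_add_abs_le (hω : 0 < ω) (z : ℝ) :
    Qw ω z ^ 2 * Real.exp |z| * (1 + |z|) ≤ 8 := by
  have h1 := Qw_sq_le_exp hω z
  have h2 : 1 + |z| ≤ Real.exp |z| := by linarith [Real.add_one_le_exp |z|]
  calc Qw ω z ^ 2 * Real.exp |z| * (1 + |z|)
      ≤ (8 * Real.exp (-(2 * |z|))) * Real.exp |z| * Real.exp |z| := by
        have := abs_nonneg z; gcongr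
    _ = 8 := by rw [mul_assoc, mul_assoc, ← Real.exp_add, ← Real.exp_add]; ring_nf; simp

/-- Splitting Q⁴ as Q²(y)·Q²(z), one factor on each side of the kernel, absorbs linear growth in
both variables and the weight e^{|z|}. -/
lemma abs_weighted_le (hω : 0 < ω) {c t y z : ℝ} (hc : 0 ≤ c)
    (h : |t| ≤ c * ((1 + |y|) * (1 + |z|))) :
    |Qw ω y ^ 2 * t * (Qw ω z ^ 2 * Real.exp |z|) / 3| ≤ 22 * c := by
  have h1 := Qw_sq_mul_one_add_abs_le hω y
  have h2 := Qw_sq_mul_exp_mul_one_add_abs_le hω z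
  have hQ := Qw_pos ω y
  have hz := Qw_pos ω z
  have e : |Qw ω y ^ 2 * t * (Qw ω z ^ 2 * Real.exp |z|) / 3| =
      Qw ω y ^ 2 * |t| * (Qw ω z ^ 2 * Real.exp |z|) / 3 := by
    rw [abs_div, abs_mul, abs_mul, abs_of_pos (by positivity : 0 < Qw ω y ^ 2),
      abs_of_pos (by positivity : 0 < Qw ω z ^ 2 * Real.exp |z|),
      abs_of_pos (by norm_num : (0 : ℝ) < 3)]
  rw [e]
  have hy' := abs_nonneg y
  have hz' := abs_nonneg z
  calc Qw ω y ^ 2 * |t| * (Qw ω z ^ 2 * Real.exp |z|) / 3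
      ≤ Qw ω y ^ 2 * (c * ((1 + |y|) * (1 + |z|))) * (Qw ω z ^ 2 * Real.exp |z|) / 3 := by gcongr
    _ = c * ((Qw ω y ^ 2 * (1 + |y|)) * (Qw ω z ^ 2 * Real.exp |z| * (1 + |z|))) / 3 := by ring
    _ ≤ c * (8 * 8) / 3 := by gcongr
    _ ≤ 22 * c := by linarith

/-- The kernel `Q(y)² k(|y|, |z|) Q(z)² exp |z| / 3`. -/
noncomputable def weightedKernel (hω : 0 < ω) (k : ℝ → ℝ → ℝ)
    (hk : Continuous fun p : ℝ × ℝ => k p.1 p.2) {c : ℝ} (hc : 0 ≤ c)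
    (h : ∀ y z, 0 ≤ y → 0 ≤ z → |k y z| ≤ c * ((1 + y) * (1 + z))) : ℝ × ℝ →ᵇ ℝ :=
  BoundedContinuousFunction.ofNormedAddCommGroup
    (fun p => Qw ω p.1 ^ 2 * k |p.1| |p.2| * (Qw ω p.2 ^ 2 * Real.exp |p.2|) / 3)
    (by
      have cQ := continuous_Qw ω
      have : Continuous fun p : ℝ × ℝ => k |p.1| |p.2| :=
        hk.comp ((continuous_abs.comp continuous_fst).prodMk (continuous_abs.comp continuous_snd))
      fun_prop)
    (22 * c) (fun p => abs_weighted_le hω hc (h _ _ (abs_nonneg _) (abs_nonneg _)))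

lemma norm_weightedKernel_le (hω : 0 < ω) {k : ℝ → ℝ → ℝ}
    (hk : Continuous fun p : ℝ × ℝ => k p.1 p.2) {c : ℝ} (hc : 0 ≤ c)
    (h : ∀ y z, 0 ≤ y → 0 ≤ z → |k y z| ≤ c * ((1 + y) * (1 + z))) :
    ‖weightedKernel hω k hk hc h‖ ≤ 22 * c := by
  unfold weightedKernel
  exact BoundedContinuousFunction.norm_ofNormedAddCommGroup_le _ (by positivity) _

lemma dist_weightedKernel_le (hω : 0 < ω) {k l : ℝ → ℝ → ℝ}
    (hk : Continuous fun p : ℝ × ℝ => k p.1 p.2) (hl : Continuous fun p : ℝ × ℝ => l p.1 p.2)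
    {c : ℝ} (hc : 0 ≤ c) (h : ∀ y z, 0 ≤ y → 0 ≤ z → |k y z| ≤ c * ((1 + y) * (1 + z)))
    (h' : ∀ y z, 0 ≤ y → 0 ≤ z → |l y z| ≤ c * ((1 + y) * (1 + z))) {δ : ℝ} (hδ : 0 ≤ δ)
    (hd : ∀ y z, 0 ≤ y → 0 ≤ z → |k y z - l y z| ≤ δ * ((1 + y) * (1 + z))) :
    dist (weightedKernel hω k hk hc h) (weightedKernel hω l hl hc h') ≤ 22 * δ := by
  rw [BoundedContinuousFunction.dist_le (by positivity)]
  intro p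
  rw [Real.dist_eq]
  refine le_trans (le_of_eq ?_) (abs_weighted_le hω hδ
    (hd |p.1| |p.2| (abs_nonneg _) (abs_nonneg _)))
  congr 1
  change Qw ω p.1 ^ 2 * k |p.1| |p.2| * (Qw ω p.2 ^ 2 * Real.exp |p.2|) / 3
    - Qw ω p.1 ^ 2 * l |p.1| |p.2| * (Qw ω p.2 ^ 2 * Real.exp |p.2|) / 3 = _
  ring

/-- The weight e^{|z|} of the kernel cancels the e^{−z} built into the operator. -/
lemma kernelOp_weightedKernel (hω : 0 < ω) {k : ℝ → ℝ → ℝ}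
    (hk : Continuous fun p : ℝ × ℝ => k p.1 p.2) {c : ℝ} (hc : 0 ≤ c)
    (h : ∀ y z, 0 ≤ y → 0 ≤ z → |k y z| ≤ c * ((1 + y) * (1 + z))) (φ : ℝ →ᵇ ℝ) (y : ℝ) :
    kernelOp (weightedKernel hω k hk hc h) φ y =
      Qw ω y ^ 2 / 3 * ∫ z in Ioi (0 : ℝ), k |y| z * (Qw ω z ^ 2 * φ z) := by
  rw [kernelOp_apply, ← integral_const_mul]
  refine setIntegral_congr_fun measurableSet_Ioi fun z hz => ?_
  change Qw ω y ^ 2 * k |y| |z| * (Qw ω z ^ 2 * Real.exp |z|) / 3 * φ z * Real.exp (-z) = _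
  rw [abs_of_pos (mem_Ioi.1 hz)]
  have := Real.exp_neg z
  have := (Real.exp_pos z).ne'
  rw [Real.exp_neg]
  field_simp

lemma abs_weightedSource_le (hω : 0 < ω) {c t y : ℝ} (hc : 0 ≤ c) (h : |t| ≤ c * (1 + |y|)) :
    |Qw ω y ^ 2 * t / 3| ≤ 3 * c := by
  have h1 := Qw_sq_mul_one_add_abs_le hω y
  have hQ := Qw_pos ω y
  rw [abs_div, abs_mul, abs_of_pos (by positivity : 0 < Qw ω y ^ 2),
    abs_of_pos (by norm_num : (0 : ℝ) < 3)]
  calc Qw ω y ^ 2 * |t| / 3 ≤ Qw ω y ^ 2 * (c * (1 + |y|)) / 3 := by gcongr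
    _ = c * (Qw ω y ^ 2 * (1 + |y|)) / 3 := by ring
    _ ≤ c * 8 / 3 := by gcongr
    _ ≤ 3 * c := by linarith

/-- The source `Q(y)² s(|y|) / 3`. -/
noncomputable def weightedSource (hω : 0 < ω) (s : ℝ → ℝ) (hs : Continuous s) {c : ℝ}
    (hc : 0 ≤ c) (h : ∀ y, 0 ≤ y → |s y| ≤ c * (1 + y)) : ℝ →ᵇ ℝ :=
  BoundedContinuousFunction.ofNormedAddCommGroup (fun y => Qw ω y ^ 2 * s |y| / 3)
    (by
      have cQ := continuous_Qw ω
      fun_prop)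
    (3 * c) (fun _ => abs_weightedSource_le hω hc (h _ (abs_nonneg _)))

lemma norm_weightedSource_le (hω : 0 < ω) {s : ℝ → ℝ} (hs : Continuous s) {c : ℝ}
    (hc : 0 ≤ c) (h : ∀ y, 0 ≤ y → |s y| ≤ c * (1 + y)) : ‖weightedSource hω s hs hc h‖ ≤ 3 * c := by
  unfold weightedSource
  exact BoundedContinuousFunction.norm_ofNormedAddCommGroup_le _ (by positivity) _

lemma dist_weightedSource_le (hω : 0 < ω) {s t : ℝ → ℝ} (hs : Continuous s) (ht : Continuous t)
    {c : ℝ} (hc : 0 ≤ c) (h : ∀ y, 0 ≤ y → |s y| ≤ c * (1 + y))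
    (h' : ∀ y, 0 ≤ y → |t y| ≤ c * (1 + y)) {δ : ℝ} (hδ : 0 ≤ δ)
    (hd : ∀ y, 0 ≤ y → |s y - t y| ≤ δ * (1 + y)) :
    dist (weightedSource hω s hs hc h) (weightedSource hω t ht hc h') ≤ 3 * δ := by
  rw [BoundedContinuousFunction.dist_le (by positivity)]
  intro y
  rw [Real.dist_eq]
  refine le_trans (le_of_eq ?_) (abs_weightedSource_le hω hδ (hd |y| (abs_nonneg _)))
  congr 1
  change Qw ω y ^ 2 * s |y| / 3 - Qw ω y ^ 2 * t |y| / 3 = _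
  ring

/-- The profile generated by the density `φ` through the kernel `k`. -/
noncomputable def potentialOf (ω : ℝ) (k : ℝ → ℝ → ℝ) (φ : ℝ → ℝ) (y : ℝ) : ℝ :=
  ω * ∫ z in Ioi (0 : ℝ), k |y| z * (Qw ω z ^ 2 * φ z)

/-- The coupled integral equations in pointwise form. -/
lemma coupledSol_weighted (hω : 0 < ω) (hω1 : ω ≤ 1 / 1000) {k l : ℝ → ℝ → ℝ} {s : ℝ → ℝ}
    (hk : Continuous fun p : ℝ × ℝ => k p.1 p.2) (hl : Continuous fun p : ℝ × ℝ => l p.1 p.2)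
    (hs : Continuous s) (bk : ∀ y z, 0 ≤ y → 0 ≤ z → |k y z| ≤ 2 * ((1 + y) * (1 + z)))
    (bl : ∀ y z, 0 ≤ y → 0 ≤ z → |l y z| ≤ 2 * ((1 + y) * (1 + z)))
    (bs : ∀ y, 0 ≤ y → |s y| ≤ 2 * (1 + y)) {x : (ℝ →ᵇ ℝ) × (ℝ →ᵇ ℝ)}
    (hx : x = coupledSol ω (kernelOp (weightedKernel hω k hk zero_le_two bk))
      (kernelOp (weightedKernel hω l hl zero_le_two bl)) (weightedSource hω s hs zero_le_two bs)) :
    (∀ y, x.1 y = Qw ω y ^ 2 / 3 * ((s |y| + potentialOf ω k x.1 y)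
      - 2 * potentialOf ω l x.2 y)) ∧
    (∀ y, x.2 y = -(Qw ω y ^ 2 / 3 * (2 * (s |y| + potentialOf ω k x.1 y)
      - potentialOf ω l x.2 y))) ∧
    (∀ y, |x.1 y| ≤ 24) ∧ (∀ y, |x.2 y| ≤ 24) ∧
    ∀ y, |x.1 y - Qw ω y ^ 2 * s |y| / 3| ≤ 3200 * ω := by
  obtain ⟨h1, h2, h3, h4⟩ := coupledSol_spec (M := 44) hω.le
    ((norm_kernelOp_le _).trans ((norm_weightedKernel_le hω hk zero_le_two bk).trans (by norm_num)))
    ((norm_kernelOp_le _).trans ((norm_weightedKernel_le hω hl zero_le_two bl).trans (by norm_num)))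
    (by linarith) (weightedSource hω s hs zero_le_two bs)
  rw [← hx] at h1 h2 h3 h4
  have hb := norm_weightedSource_le hω hs zero_le_two bs
  have hx24 : ‖x‖ ≤ 24 := by linarith
  refine ⟨fun y => ?_, fun y => ?_, fun y => ?_, fun y => ?_, fun y => ?_⟩
  · have := DFunLike.congr_fun h1 y
    simp only [BoundedContinuousFunction.coe_add, BoundedContinuousFunction.coe_smul,
      BoundedContinuousFunction.coe_sub, Pi.add_apply, Pi.sub_apply, smul_eq_mul,
      kernelOp_weightedKernel] at this
    rw [this, potentialOf, potentialOf]
    change Qw ω y ^ 2 * s |y| / 3 + _ = _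
    ring
  · have := DFunLike.congr_fun h2 y
    simp only [BoundedContinuousFunction.coe_add, BoundedContinuousFunction.coe_smul,
      BoundedContinuousFunction.coe_sub, Pi.add_apply, Pi.sub_apply, smul_eq_mul,
      kernelOp_weightedKernel] at this
    rw [this, potentialOf, potentialOf]
    change -2 * (Qw ω y ^ 2 * s |y| / 3) + _ = _
    ring
  · exact (x.1.norm_coe_le_norm y).trans ((norm_fst_le x).trans hx24)
  · exact (x.2.norm_coe_le_norm y).trans ((norm_snd_le x).trans hx24)
  · refine ((x.1 - weightedSource hω s hs zero_le_two bs).norm_coe_le_norm y).trans (h4.trans ?_)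
    nlinarith

end Weighted

/-! ### Solving the integral systems; selection of α. -/

lemma continuous_of_dist_le {X : Type*} [PseudoMetricSpace X] {F : ℝ → X} {γ : ℝ → ℝ} {L : ℝ}
    (hγ : Continuous γ) (h : ∀ s t, dist (F s) (F t) ≤ L * |γ s - γ t|) : Continuous F := by
  refine continuous_iff_continuousAt.2 fun t => tendsto_iff_dist_tendsto_zero.2 ?_
  refine squeeze_zero (fun _ => dist_nonneg) (fun s => h s t) ?_
  have : Continuous fun s => L * |γ s - γ t| := by fun_prop
  simpa using this.tendsto t

lemma integrableOn_weighted {ω : ℝ} (hω : 0 < ω) {f : ℝ → ℝ} (hf : Continuous f) {c : ℝ}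
    (hc : ∀ z, 0 < z → |f z| ≤ c) : IntegrableOn (fun z => Qw ω z ^ 2 * f z) (Ioi 0) := by
  have cQ := continuous_Qw ω
  refine integrableOn_of_le_exp (F := 8 * c) (b := 2) two_pos (by fun_prop) fun z hz => ?_
  have h1 := Qw_sq_le_exp hω z
  have h2 := hc z hz
  rw [abs_of_pos hz] at h1
  rw [abs_mul, abs_of_nonneg (sq_nonneg _)]
  calc Qw ω z ^ 2 * |f z| ≤ (8 * Real.exp (-(2 * z))) * c := by gcongr
    _ = _ := by ring

lemma abs_integral_weighted_le {ω : ℝ} (hω : 0 < ω) {f : ℝ → ℝ} {c : ℝ}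
    (hc : ∀ z, 0 < z → |f z| ≤ c) : |∫ z in Ioi (0 : ℝ), Qw ω z ^ 2 * f z| ≤ 4 * c := by
  refine (abs_integral_Ioi_le (F := 8 * c) (b := 2) two_pos fun z hz => ?_).trans_eq ?_
  · have h1 := Qw_sq_le_exp hω z
    have h2 := hc z hz
    rw [abs_of_pos hz] at h1
    rw [abs_mul, abs_of_nonneg (sq_nonneg _)]
    calc Qw ω z ^ 2 * |f z| ≤ (8 * Real.exp (-(2 * z))) * c := by gcongr
      _ = _ := by ring
  · simp; ring

/-- The coupled integral equations of the internal mode, including the matching condition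
which determines `α`. -/
lemma exists_slow_system {ω : ℝ} (hω : 0 < ω) (hω1 : ω ≤ 1 / 1000000) :
    ∃ (α : ℝ) (φ ψ : ℝ → ℝ), 0 < α ∧ α ≤ 1 / 2 ∧ Continuous φ ∧ Continuous ψ ∧
      (∀ y, |φ y| ≤ 24) ∧ (∀ y, |ψ y| ≤ 24) ∧ ω / 2 * ∫ z in Ioi (0 : ℝ), Qw ω z ^ 2 * φ z = α ∧
      (∀ y, φ y = Qw ω y ^ 2 / 3 * (potentialOf ω (greenKernel α) φ y
        - 2 * potentialOf ω (greenKernel (Real.sqrt (2 - α ^ 2))) ψ y)) ∧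
      ∀ y, ψ y = -(Qw ω y ^ 2 / 3 * (2 * potentialOf ω (greenKernel α) φ y
        - potentialOf ω (greenKernel (Real.sqrt (2 - α ^ 2))) ψ y)) := by
  -- This is the lower bound for the matching function obtained in `hlow`. Clamping α to [ε, 1]
  -- through γ and √(2 − α²) to at least 1 through σ defines the system for every real α; both
  -- clamps are inactive at the chosen α.
  set ε := ω / 20 with hε
  have hε0 : 0 < ε := by positivity
  have hε1 : ε ≤ 1 := by linarith
  set γ : ℝ → ℝ := fun α => max (min α 1) ε with hγ
  have cγ : Continuous γ := by fun_prop
  have hγε : ∀ α, ε ≤ γ α := fun α => le_max_right _ _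
  have hγ1 : ∀ α, γ α ≤ 1 := fun α => max_le (min_le_right _ _) hε1
  have hγ0 : ∀ α, 0 < γ α := fun α => hε0.trans_le (hγε α)
  set σ : ℝ → ℝ := fun α => max (Real.sqrt (2 - α ^ 2)) 1 with hσ
  have cσ : Continuous σ := by fun_prop
  have hσ1 : ∀ α, 1 ≤ σ α := fun α => le_max_right _ _
  have one_le : ∀ y z : ℝ, 0 ≤ y → 0 ≤ z → 1 + z ≤ (1 + y) * (1 + z) := fun y z hy hz => by
    nlinarith
  have bk : ∀ α y z, 0 ≤ y → 0 ≤ z → |reducedKernel (γ α) y z| ≤ 2 * ((1 + y) * (1 + z)) :=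
    fun α y z hy hz => (abs_reducedKernel_le (hγ0 α) hy hz).trans (by linarith [one_le y z hy hz])
  have bl : ∀ α y z, 0 ≤ y → 0 ≤ z → |greenKernel (σ α) y z| ≤ 2 * ((1 + y) * (1 + z)) :=
    fun α y z hy hz => (abs_greenKernel_le (hσ1 α) hy hz).trans (by linarith [one_le y z hy hz])
  have hexp1 : ∀ α y, 0 ≤ y → Real.exp (-(γ α * y)) ≤ 1 := fun α y hy =>
    Real.exp_le_one_iff.2 (by have := hγ0 α; nlinarith)
  have bs : ∀ α y, 0 ≤ y → |2 * Real.exp (-(γ α * y))| ≤ 2 * (1 + y) := fun α y hy => by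
    rw [abs_of_pos (by positivity)]
    linarith [hexp1 α y hy]
  have cs : ∀ α, Continuous fun y => 2 * Real.exp (-(γ α * y)) := fun α => by fun_prop
  set A := fun α => weightedKernel hω (reducedKernel (γ α)) (continuous_reducedKernel _)
    zero_le_two (bk α) with hA
  set B := fun α => weightedKernel hω (greenKernel (σ α)) (continuous_greenKernel _)
    zero_le_two (bl α) with hB
  set b := fun α => weightedSource hω _ (cs α) zero_le_two (bs α) with hb
  have cA : Continuous A := by
    refine continuous_of_dist_le (L := 44 / ε ^ 2) cγ fun s t => ?_
    refine (dist_weightedKernel_le hω _ _ _ _ _ (δ := 2 * (|γ s - γ t| / ε ^ 2)) (by positivity)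
      fun y z hy hz => abs_reducedKernel_sub_le hε0 hε1 (hγε s) (hγε t) hy hz).trans_eq ?_
    ring
  have cB : Continuous B := by
    refine continuous_of_dist_le (L := 22) cσ fun s t => ?_
    refine (dist_weightedKernel_le hω _ _ _ _ _ (δ := |σ s - σ t| / 1 ^ 2) (by positivity)
      fun y z hy hz => abs_greenKernel_sub_le one_pos le_rfl (hσ1 s) (hσ1 t) hy hz).trans_eq ?_
    ring
  have cb : Continuous b := by
    refine continuous_of_dist_le (L := 6) cγ fun s t => ?_
    refine (dist_weightedSource_le hω _ _ _ _ _ (δ := 2 * |γ s - γ t|) (by positivity)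
      fun y hy => ?_).trans_eq (by ring)
    rw [← mul_sub, abs_mul, abs_two, mul_assoc]
    refine mul_le_mul_of_nonneg_left ((abs_exp_neg_sub_exp_neg_le (mul_nonneg (hγ0 s).le hy)
      (mul_nonneg (hγ0 t).le hy)).trans ?_) zero_le_two
    rw [← sub_mul, abs_mul, abs_of_nonneg hy]
    exact mul_le_mul_of_nonneg_left (by linarith) (abs_nonneg _)
  set x := fun α => coupledSol ω (kernelOp (A α)) (kernelOp (B α)) (b α) with hx
  have cx : Continuous x := by
    refine continuous_coupledSol (M := 44) hω.le
      (fun α => (norm_kernelOp_le _).trans ((norm_weightedKernel_le hω _ _ _).trans (by norm_num)))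
      (fun α => (norm_kernelOp_le _).trans ((norm_weightedKernel_le hω _ _ _).trans (by norm_num)))
      (by linarith) (by fun_prop) (by fun_prop) cb
  have spec := fun α => coupledSol_weighted hω (by linarith) (continuous_reducedKernel (γ α))
    (continuous_greenKernel (σ α)) (cs α) (bk α) (bl α) (bs α) (x := x α) rfl
  set I : ℝ → ℝ := fun α => ω / 2 * ∫ z in Ioi (0 : ℝ), Qw ω z ^ 2 * (x α).1 z with hI
  have cI : Continuous I := by
    refine continuous_const.mul ?_
    have : Continuous fun α => (x α).1 := continuous_fst.comp cx
    have hint : ∀ α, IntegrableOn (fun z => Qw ω z ^ 2 * (x α).1 z) (Ioi 0) := fun α =>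
      integrableOn_weighted hω (x α).1.continuous fun z _ => (spec α).2.2.1 z
    refine continuous_iff_continuousAt.2 fun t => tendsto_iff_dist_tendsto_zero.2 ?_
    refine squeeze_zero (g := fun s => 4 * dist (x s).1 (x t).1) (fun _ => dist_nonneg)
      (fun s => ?_) ?_
    · rw [Real.dist_eq, ← integral_sub (hint s) (hint t)]
      simp only [← mul_sub]
      refine abs_integral_weighted_le hω fun z _ => ?_
      have := BoundedContinuousFunction.dist_coe_le_dist (f := (x s).1) (g := (x t).1) z
      rwa [Real.dist_eq] at this
    · have h2 : Continuous fun s => 4 * dist (x s).1 (x t).1 := by fun_prop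
      simpa using h2.tendsto t
  -- To leading order φ = (2/3)Q²e^{−γz}, and Q² ≥ e^{−2z} gives a positive integral; the O(ω)
  -- correction costs at most 12800ω. The margin 2/15 − 12800ω ≥ 1/10 is where ω ≤ 10⁻⁶ enters.
  have hlow : ∀ α, ε ≤ I α := fun α => by
    have h1 : IntegrableOn (fun z => 2 / 3 * Real.exp (-(5 * z)) -
        25600 * ω * Real.exp (-(2 * z))) (Ioi 0) :=
      ((integrableOn_exp_neg_mul (by norm_num) 0).const_mul _).sub
        ((integrableOn_exp_neg_mul two_pos 0).const_mul _)
    have h2 := setIntegral_mono_on h1 (integrableOn_weighted hω (x α).1.continuous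
      fun z _ => (spec α).2.2.1 z) measurableSet_Ioi fun z hz => by
        have hz0 : 0 < z := hz
        have e1 := (abs_le.1 ((spec α).2.2.2.2 z)).1
        have e2 := Qw_sq_le_exp hω z
        have e3 := exp_le_Qw_sq (ω := ω) (by linarith) z
        rw [abs_of_pos hz0] at e1 e2 e3
        have e4 : Real.exp (-z) ≤ Real.exp (-(γ α * z)) :=
          Real.exp_le_exp.2 (by have := hγ1 α; nlinarith)
        have e5 : Real.exp (-(5 * z)) = Real.exp (-(2 * z)) * Real.exp (-(2 * z)) * Real.exp (-z) := by
          rw [← Real.exp_add, ← Real.exp_add]; ring_nf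
        have e6 := Real.exp_pos (-(2 * z))
        have e7 := Real.exp_pos (-z)
        have e8 : Real.exp (-(5 * z)) ≤ Qw ω z ^ 2 * Qw ω z ^ 2 * Real.exp (-(γ α * z)) := by
          rw [e5]; gcongr
        have e9 : Qw ω z ^ 2 * (Qw ω z ^ 2 * (2 * Real.exp (-(γ α * z))) / 3 - 3200 * ω) ≤
            Qw ω z ^ 2 * (x α).1 z := mul_le_mul_of_nonneg_left (by linarith) (sq_nonneg _)
        have e10 := mul_le_mul_of_nonneg_right e2 (by positivity : 0 ≤ 3200 * ω)
        linarith
    rw [integral_sub ((integrableOn_exp_neg_mul (by norm_num) 0).const_mul _)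
      ((integrableOn_exp_neg_mul two_pos 0).const_mul _), integral_const_mul, integral_const_mul,
      integral_exp_neg_mul (by norm_num), integral_exp_neg_mul two_pos] at h2
    simp only [mul_zero, neg_zero, Real.exp_zero] at h2
    have h3 : 1 / 10 ≤ ∫ z in Ioi (0 : ℝ), Qw ω z ^ 2 * (x α).1 z := by linarith
    have h4 := mul_le_mul_of_nonneg_left h3 (by positivity : 0 ≤ ω / 2)
    rw [hI]
    linarith
  have hup : ∀ α, I α ≤ 1 / 2 := fun α => by
    have h1 := (abs_le.1 (abs_integral_weighted_le hω (f := (x α).1) (c := 24)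
      fun z _ => (spec α).2.2.1 z)).2
    have h4 := mul_le_mul_of_nonneg_left h1 (by positivity : 0 ≤ ω / 2)
    rw [hI]
    linarith
  -- The function α − I(α) changes sign on [ε, 1/2] because ε ≤ I ≤ 1/2 throughout.
  obtain ⟨α, hα, hIα⟩ : ∃ α ∈ Icc ε (1 / 2), α - I α = 0 :=
    intermediate_value_Icc (by linarith) (continuous_id.sub cI).continuousOn
      ⟨by simpa using hlow ε, by simpa using hup (1 / 2)⟩
  have hα0 : 0 < α := hε0.trans_le hα.1
  have eγ : γ α = α := by
    simp only [hγ]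
    rw [min_eq_left (by linarith [hα.2]), max_eq_left hα.1]
  have eσ : σ α = Real.sqrt (2 - α ^ 2) :=
    max_eq_left (Real.one_le_sqrt.2 (by nlinarith [hα.2]))
  obtain ⟨s1, s2, s3, s4, -⟩ := spec α
  have hIα' : ω / 2 * ∫ z in Ioi (0 : ℝ), Qw ω z ^ 2 * (x α).1 z = α := (sub_eq_zero.1 hIα).symm
  rw [eγ, eσ] at s1 s2
  -- The matching condition makes the removed singular part, ω e^{−α|y|}/α times ∫Q²φ, equal to
  -- 2e^{−α|y|}. The regularised equation is therefore the original one with the full Green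
  -- function.
  have key : ∀ y, 2 * Real.exp (-(α * |y|)) + potentialOf ω (reducedKernel α) (x α).1 y =
      potentialOf ω (greenKernel α) (x α).1 y := fun y => by
    have hint := integrableOn_weighted hω (x α).1.continuous fun z _ => s3 z
    have hint2 : IntegrableOn (fun z => greenKernel α |y| z * (Qw ω z ^ 2 * (x α).1 z)) (Ioi 0) := by
      have c1 : Continuous fun z => greenKernel α |y| z :=
        (continuous_greenKernel α).comp (by fun_prop : Continuous fun z : ℝ => (|y|, z))
      refine (integrableOn_weighted hω (f := fun z => greenKernel α |y| z * (x α).1 z)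
        (c := 1 / α * 24) (by fun_prop) fun z hz => ?_).congr_fun (fun z _ => by ring)
        measurableSet_Ioi
      rw [abs_mul]
      refine mul_le_mul ?_ (s3 z) (abs_nonneg _) (by positivity)
      have h1 : ∀ r, 0 ≤ r → expRatio α r ≤ 1 / α := fun r hr =>
        div_le_div_of_nonneg_right (Real.exp_le_one_iff.2 (by nlinarith)) hα0.le
      have h2 := h1 _ (abs_nonneg (|y| - z))
      have h3 := h1 (|y| + z) (by have := abs_nonneg y; linarith)
      have h4 := expRatio_nonneg hα0 |(|y| - z)|
      have h5 := expRatio_nonneg hα0 (|y| + z)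
      unfold greenKernel
      exact abs_le.2 ⟨by linarith, by linarith⟩
    have e1 : ∫ z in Ioi (0 : ℝ), reducedKernel α |y| z * (Qw ω z ^ 2 * (x α).1 z) =
        (∫ z in Ioi (0 : ℝ), greenKernel α |y| z * (Qw ω z ^ 2 * (x α).1 z))
        - expRatio α |y| * ∫ z in Ioi (0 : ℝ), Qw ω z ^ 2 * (x α).1 z := by
      rw [← integral_const_mul, ← integral_sub hint2 (hint.const_mul _)]
      congr 1
      funext z
      rw [reducedKernel]
      ring
    rw [potentialOf, potentialOf, e1, mul_sub]
    have e2 : ω * (expRatio α |y| * ∫ z in Ioi (0 : ℝ), Qw ω z ^ 2 * (x α).1 z) =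
        2 * Real.exp (-(α * |y|)) := by
      rw [show ω * (expRatio α |y| * ∫ z in Ioi (0 : ℝ), Qw ω z ^ 2 * (x α).1 z) =
        2 * expRatio α |y| * (ω / 2 * ∫ z in Ioi (0 : ℝ), Qw ω z ^ 2 * (x α).1 z) by ring, hIα',
        expRatio]
      field_simp
    rw [e2]
    ring
  simp only [key] at s1 s2
  exact ⟨α, (x α).1, (x α).2, hα0, hα.2, (x α).1.continuous, (x α).2.continuous, s3, s4, hIα', s1, s2⟩

/-- The coupled integral equations of the oscillating solution. -/
lemma exists_oscillating_system {ω τ κ : ℝ} (hω : 0 < ω) (hω1 : ω ≤ 1 / 1000) (hτ : 1 / 2 ≤ τ)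
    (hκ : 1 ≤ κ) :
    ∃ φ ψ : ℝ → ℝ, Continuous φ ∧ Continuous ψ ∧ (∀ y, |φ y| ≤ 24) ∧ (∀ y, |ψ y| ≤ 24) ∧
      (∀ y, φ y = Qw ω y ^ 2 / 3 * ((-2 * Real.cos (τ * |y|) + potentialOf ω (sineKernel τ) φ y)
        - 2 * potentialOf ω (greenKernel κ) ψ y)) ∧
      ∀ y, ψ y = -(Qw ω y ^ 2 / 3 * (2 * (-2 * Real.cos (τ * |y|)
        + potentialOf ω (sineKernel τ) φ y) - potentialOf ω (greenKernel κ) ψ y)) := by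
  have one_le : ∀ y z : ℝ, 0 ≤ y → 0 ≤ z → 1 ≤ (1 + y) * (1 + z) := fun y z hy hz => by
    nlinarith [mul_nonneg hy hz]
  obtain ⟨s1, s2, s3, s4, -⟩ := coupledSol_weighted hω hω1 (continuous_sineKernel τ)
    (continuous_greenKernel κ) (s := fun y => -2 * Real.cos (τ * y)) (by fun_prop)
    (fun y z hy hz => (abs_sineKernel_le hτ).trans (by linarith [one_le y z hy hz]))
    (fun y z hy hz => (abs_greenKernel_le hκ hy hz).trans (by linarith [one_le y z hy hz]))
    (fun y hy => by
      rw [abs_mul, abs_neg, abs_two]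
      linarith [Real.abs_cos_le_one (τ * y)]) rfl
  exact ⟨_, _, BoundedContinuousFunction.continuous _, BoundedContinuousFunction.continuous _,
    s3, s4, s1, s2⟩

/-! ### From integral equations back to differential equations. -/

/-- Variation of constants for `w'' = c w - f` with `w 0 = A`, `w' 0 = 0`, in terms of the
fundamental solutions `C` and `S`. -/
noncomputable def duhamel (C S f : ℝ → ℝ) (A y : ℝ) : ℝ :=
  A * C y - (S y * (∫ z in (0 : ℝ)..y, C z * f z) - C y * ∫ z in (0 : ℝ)..y, S z * f z)

section Duhamel

variable {C S f : ℝ → ℝ} {A c : ℝ}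

lemma hasDerivAt_duhamel (hC : ∀ y, HasDerivAt C (c * S y) y) (hS : ∀ y, HasDerivAt S (C y) y)
    (hf : Continuous f) (y : ℝ) :
    HasDerivAt (duhamel C S f A) (c * A * S y - (C y * (∫ z in (0 : ℝ)..y, C z * f z)
      - c * S y * ∫ z in (0 : ℝ)..y, S z * f z)) y := by
  have cC := continuous_of_hasDerivAt hC
  have cS := continuous_of_hasDerivAt hS
  have h1 := (cC.mul hf).integral_hasStrictDerivAt 0 y |>.hasDerivAt
  have h2 := (cS.mul hf).integral_hasStrictDerivAt 0 y |>.hasDerivAt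
  refine (((hC y).const_mul A).sub (((hS y).mul h1).sub ((hC y).mul h2))).congr_deriv ?_
  simp only [Pi.mul_apply]
  ring

lemma hasDerivAt_duhamel_deriv (hC : ∀ y, HasDerivAt C (c * S y) y)
    (hS : ∀ y, HasDerivAt S (C y) y) (hf : Continuous f) (hCS : ∀ y, C y ^ 2 - c * S y ^ 2 = 1)
    (y : ℝ) :
    HasDerivAt (fun y => c * A * S y - (C y * (∫ z in (0 : ℝ)..y, C z * f z)
      - c * S y * ∫ z in (0 : ℝ)..y, S z * f z)) (c * duhamel C S f A y - f y) y := by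
  have cC := continuous_of_hasDerivAt hC
  have cS := continuous_of_hasDerivAt hS
  have h1 := (cC.mul hf).integral_hasStrictDerivAt 0 y |>.hasDerivAt
  have h2 := (cS.mul hf).integral_hasStrictDerivAt 0 y |>.hasDerivAt
  refine (((hS y).const_mul (c * A)).sub (((hC y).mul h1).sub
    (((hS y).const_mul c).mul h2))).congr_deriv ?_
  simp only [Pi.mul_apply, duhamel]
  linear_combination (-f y) * hCS y

lemma duhamel_even (hC : Function.Even C) (hS : Function.Odd S) (hf : Function.Even f) :
    Function.Even (duhamel C S f A) := by
  intro y
  have h : ∀ g : ℝ → ℝ, ∫ z in (0 : ℝ)..(-y), g z = -∫ z in (0 : ℝ)..y, g (-z) := fun g => by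
    rw [intervalIntegral.integral_comp_neg, neg_zero, intervalIntegral.integral_symm]
  unfold duhamel
  rw [h, h]
  simp only [hC _, hS _, hf _, neg_mul, intervalIntegral.integral_neg]
  ring

/-- The Volterra integral as a half-line integral. -/
lemma integral_volterra (hC : Continuous C) (hS : Continuous S) (hf : Continuous f)
    (hS0 : S 0 = 0) (hadd : ∀ y z, S (y - z) = S y * C z - C y * S z) {y : ℝ} (hy : 0 ≤ y) :
    IntegrableOn (fun z => S (max (y - z) 0) * f z) (Ioi 0) ∧
    ∫ z in Ioi (0 : ℝ), S (max (y - z) 0) * f z =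
      S y * (∫ z in (0 : ℝ)..y, C z * f z) - C y * ∫ z in (0 : ℝ)..y, S z * f z := by
  have hz : ∀ z ∈ Ioi (0 : ℝ) \ Ioc 0 y, S (max (y - z) 0) * f z = 0 := fun z hz => by
    have : y < z := by
      by_contra hn
      exact hz.2 ⟨hz.1, not_lt.1 hn⟩
    rw [max_eq_right (by linarith), hS0, zero_mul]
  have hc : Continuous fun z => S (max (y - z) 0) * f z := by fun_prop
  refine ⟨IntegrableOn.of_forall_sdiff_eq_zero (hc.integrableOn_Ioc (a := 0) (b := y))
    measurableSet_Ioi hz, ?_⟩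
  rw [setIntegral_eq_of_subset_of_forall_sdiff_eq_zero measurableSet_Ioi
    (fun z hz => hz.1 : Ioc 0 y ⊆ Ioi 0) hz, ← intervalIntegral.integral_of_le hy,
    ← intervalIntegral.integral_const_mul, ← intervalIntegral.integral_const_mul,
    ← intervalIntegral.integral_sub (Continuous.intervalIntegrable (by fun_prop) _ _)
    (Continuous.intervalIntegrable (by fun_prop) _ _)]
  refine intervalIntegral.integral_congr fun z hz => ?_
  rw [uIcc_of_le hy] at hz
  rw [max_eq_left (by linarith [hz.2]), hadd]
  ring

end Duhamel

section Green

variable {f : ℝ → ℝ} {κ F : ℝ}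

/-- The Neumann Green function is a rank-one kernel minus a Volterra kernel. Potentials thereby take
Duhamel form and can be differentiated without meeting the kinks at z = |y| and y = 0. -/
lemma greenKernel_eq (hκ : 0 < κ) {y z : ℝ} :
    greenKernel κ y z = expRatio κ z * Real.cosh (κ * y)
      - Real.sinh (κ * max (y - z) 0) / κ := by
  unfold greenKernel expRatio
  have e1 : Real.exp (-(κ * (y + z))) = Real.exp (-(κ * z)) * Real.exp (-(κ * y)) := by
    rw [← Real.exp_add]; ring_nf
  rw [e1, Real.cosh_eq]
  rcases le_total y z with h | h
  · have e2 : Real.exp (-(κ * |y - z|)) = Real.exp (-(κ * z)) * Real.exp (κ * y) := by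
      rw [abs_of_nonpos (by linarith), ← Real.exp_add]; ring_nf
    rw [max_eq_right (by linarith), mul_zero, Real.sinh_zero, e2]
    field_simp
    ring
  · have e2 : Real.exp (-(κ * z)) * Real.exp (κ * y) = Real.exp (κ * (y - z)) := by
      rw [← Real.exp_add]; ring_nf
    rw [max_eq_left (by linarith), abs_of_nonneg (by linarith), Real.sinh_eq]
    field_simp
    linear_combination -e2

lemma integral_greenKernel_eq_duhamel (hκ : 0 < κ) (hf : Continuous f) (he : Function.Even f)
    (hF : ∀ z, |f z| ≤ F * Real.exp (-(2 * |z|))) (y : ℝ) :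
    ∫ z in Ioi (0 : ℝ), greenKernel κ |y| z * f z =
      duhamel (fun y => Real.cosh (κ * y)) (fun y => Real.sinh (κ * y) / κ) f
        (∫ z in Ioi (0 : ℝ), expRatio κ z * f z) y := by
  rw [← even_apply_abs (duhamel_even (C := fun y => Real.cosh (κ * y))
    (S := fun y => Real.sinh (κ * y) / κ) (f := f) (fun y => by simp)
    (fun y => by simp [neg_div]) he) y]
  obtain ⟨h1, h2⟩ := integral_volterra (C := fun y => Real.cosh (κ * y))
    (S := fun y => Real.sinh (κ * y) / κ) (f := f) (by fun_prop) (by fun_prop) hf (by simp)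
    (fun y z => by rw [mul_sub, Real.sinh_sub]; ring) (abs_nonneg y)
  have h3 : IntegrableOn (fun z => expRatio κ z * f z) (Ioi 0) := by
    refine integrableOn_of_le_exp (F := F / κ) (b := 2) two_pos
      (by unfold expRatio; fun_prop) fun z hz => ?_
    have h := hF z
    rw [abs_of_pos hz] at h
    rw [abs_mul, abs_of_nonneg (expRatio_nonneg hκ z)]
    have h4 : expRatio κ z ≤ 1 / κ :=
      div_le_div_of_nonneg_right (Real.exp_le_one_iff.2 (by nlinarith [hz])) hκ.le
    calc expRatio κ z * |f z| ≤ 1 / κ * (F * Real.exp (-(2 * z))) := by gcongr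
      _ = _ := by ring
  rw [duhamel, ← h2, ← integral_mul_const, ← integral_sub (h3.mul_const _) h1]
  congr 1
  funext z
  rw [greenKernel_eq hκ]
  ring

/-- The kernel is at most e^{−min(κ,1)|y|}e^{z}/κ, and the source decay e^{−2z} pays for the e^{z}.
-/
lemma abs_integral_greenKernel_le (hκ : 0 < κ) (hF : ∀ z, |f z| ≤ F * Real.exp (-(2 * |z|)))
    (y : ℝ) : |∫ z in Ioi (0 : ℝ), greenKernel κ |y| z * f z| ≤
      F / κ * Real.exp (-(min κ 1 * |y|)) := by
  have hm : 0 < min κ 1 := lt_min hκ one_pos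
  have hF0 : 0 ≤ F := by
    have := (abs_nonneg _).trans (hF 0)
    simpa using this
  refine (abs_integral_Ioi_le (F := F / κ * Real.exp (-(min κ 1 * |y|))) (b := 1) one_pos
    fun z hz => ?_).trans_eq (by simp)
  have hz0 : 0 < z := hz
  have h := hF z
  rw [abs_of_pos hz0] at h
  have h1 : ∀ r, |y| - z ≤ r → 0 ≤ r →
      expRatio κ r ≤ Real.exp (-(min κ 1 * |y|)) * Real.exp z / κ := fun r hr hr0 => by
    refine div_le_div_of_nonneg_right ?_ hκ.le
    rw [← Real.exp_add, Real.exp_le_exp]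
    have e1 : min κ 1 * r ≤ κ * r := mul_le_mul_of_nonneg_right (min_le_left _ _) hr0
    have e2 : min κ 1 * (|y| - z) ≤ min κ 1 * r := mul_le_mul_of_nonneg_left hr hm.le
    have e3 : min κ 1 * z ≤ z := mul_le_of_le_one_left hz0.le (min_le_right _ _)
    linarith
  have h2 := h1 _ (le_abs_self _) (abs_nonneg (|y| - z))
  have h3 := h1 (|y| + z) (by linarith) (by have := abs_nonneg y; linarith)
  have h4 := expRatio_nonneg hκ |(|y| - z)|
  have h5 := expRatio_nonneg hκ (|y| + z)
  have h6 : |greenKernel κ |y| z| ≤ Real.exp (-(min κ 1 * |y|)) * Real.exp z / κ := by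
    unfold greenKernel
    exact abs_le.2 ⟨by linarith, by linarith⟩
  rw [abs_mul]
  calc _ ≤ Real.exp (-(min κ 1 * |y|)) * Real.exp z / κ * (F * Real.exp (-(2 * z))) := by gcongr
    _ = F / κ * Real.exp (-(min κ 1 * |y|)) * (Real.exp z * Real.exp (-(2 * z))) := by ring
    _ = _ := by rw [← Real.exp_add]; ring_nf

end Green

section Potential

variable {ω κ τ : ℝ} {φ : ℝ → ℝ}

lemma potentialOf_eq (k : ℝ → ℝ → ℝ) (y : ℝ) : potentialOf ω k φ y =
    ∫ z in Ioi (0 : ℝ), k |y| z * (ω * (Qw ω z ^ 2 * φ z)) := by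
  rw [potentialOf, ← integral_const_mul]
  congr 1
  funext z
  ring

lemma potentialOf_even (k : ℝ → ℝ → ℝ) : Function.Even (potentialOf ω k φ) := fun y => by
  rw [potentialOf, potentialOf, abs_neg]

lemma abs_density_le (hω : 0 < ω) {c : ℝ} (hb : ∀ y, |φ y| ≤ c) (z : ℝ) :
    |ω * (Qw ω z ^ 2 * φ z)| ≤ 8 * ω * c * Real.exp (-(2 * |z|)) := by
  have h1 := Qw_sq_le_exp hω z
  have h2 := hb z
  rw [abs_mul, abs_mul, abs_of_pos hω, abs_of_nonneg (sq_nonneg _)]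
  calc ω * (Qw ω z ^ 2 * |φ z|) ≤ ω * ((8 * Real.exp (-(2 * |z|))) * c) := by gcongr
    _ = _ := by ring

/-- Evenness of the density makes the Duhamel formula even, so the half-line representation is valid
and smooth across the origin. -/
lemma hasDerivAt_potentialOf_green (hω : 0 < ω) (hκ : 0 < κ) (hφ : Continuous φ)
    (he : Function.Even φ) {c : ℝ} (hb : ∀ y, |φ y| ≤ c) :
    ∃ w' : ℝ → ℝ, (∀ y, HasDerivAt (potentialOf ω (greenKernel κ) φ) (w' y) y) ∧
      ∀ y, HasDerivAt w' (κ ^ 2 * potentialOf ω (greenKernel κ) φ y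
        - ω * (Qw ω y ^ 2 * φ y)) y := by
  have cQ := continuous_Qw ω
  have hcf : Continuous fun z => ω * (Qw ω z ^ 2 * φ z) := by fun_prop
  have hC : ∀ y, HasDerivAt (fun y => Real.cosh (κ * y)) (κ ^ 2 * (Real.sinh (κ * y) / κ)) y :=
    fun y => by
      refine ((hasDerivAt_id y).const_mul κ).cosh.congr_deriv ?_
      simp only [id]
      field_simp
  have hS : ∀ y, HasDerivAt (fun y => Real.sinh (κ * y) / κ) (Real.cosh (κ * y)) y := fun y => by
    refine (((hasDerivAt_id y).const_mul κ).sinh.div_const κ).congr_deriv ?_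
    simp only [id]
    field_simp
  have hw : potentialOf ω (greenKernel κ) φ = duhamel (fun y => Real.cosh (κ * y))
      (fun y => Real.sinh (κ * y) / κ) (fun z => ω * (Qw ω z ^ 2 * φ z))
        (∫ z in Ioi (0 : ℝ), expRatio κ z * (ω * (Qw ω z ^ 2 * φ z))) := by
    funext y
    rw [potentialOf_eq, integral_greenKernel_eq_duhamel hκ hcf
      (fun z => by simp only [Qw_even, he z]) (abs_density_le hω hb)]
  rw [hw]
  refine ⟨_, fun y => hasDerivAt_duhamel hC hS hcf y, fun y =>
    hasDerivAt_duhamel_deriv hC hS hcf (fun y => ?_) y⟩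
  have := Real.cosh_sq (κ * y)
  field_simp
  linarith

lemma tendsto_potentialOf_green (hω : 0 < ω) (hκ : 0 < κ) {c : ℝ} (hb : ∀ y, |φ y| ≤ c) :
    Tendsto (potentialOf ω (greenKernel κ) φ) (cocompact ℝ) (𝓝 0) := by
  refine squeeze_zero_norm (a := fun y => 8 * ω * c / κ * Real.exp (-(min κ 1 * |y|)))
    (fun y => ?_) ?_
  · rw [potentialOf_eq]
    exact abs_integral_greenKernel_le hκ (abs_density_le hω hb) y
  · have h : Tendsto (fun y : ℝ => |y|) (cocompact ℝ) atTop := tendsto_norm_cocompact_atTop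
    simpa using ((tendsto_exp_neg_mul (lt_min hκ one_pos)).comp h).const_mul (8 * ω * c / κ)

lemma hasDerivAt_potentialOf_sine (hτ : 0 < τ) (hφ : Continuous φ) (he : Function.Even φ) :
    ∃ w' : ℝ → ℝ, (∀ y, HasDerivAt (fun y => -2 * Real.cos (τ * |y|)
        + potentialOf ω (sineKernel τ) φ y) (w' y) y) ∧
      ∀ y, HasDerivAt w' (-τ ^ 2 * (-2 * Real.cos (τ * |y|) + potentialOf ω (sineKernel τ) φ y)
        - ω * (Qw ω y ^ 2 * φ y)) y := by
  have cQ := continuous_Qw ω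
  have hcf : Continuous fun z => ω * (Qw ω z ^ 2 * φ z) := by fun_prop
  have hC : ∀ y, HasDerivAt (fun y => Real.cos (τ * y)) (-τ ^ 2 * (Real.sin (τ * y) / τ)) y :=
    fun y => by
      refine ((hasDerivAt_id y).const_mul τ).cos.congr_deriv ?_
      simp only [id]
      field_simp
  have hS : ∀ y, HasDerivAt (fun y => Real.sin (τ * y) / τ) (Real.cos (τ * y)) y := fun y => by
    refine (((hasDerivAt_id y).const_mul τ).sin.div_const τ).congr_deriv ?_
    simp only [id]
    field_simp
  have hw : (fun y => -2 * Real.cos (τ * |y|) + potentialOf ω (sineKernel τ) φ y) =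
      duhamel (fun y => Real.cos (τ * y)) (fun y => Real.sin (τ * y) / τ)
        (fun z => ω * (Qw ω z ^ 2 * φ z)) (-2) := by
    funext y
    rw [← even_apply_abs (duhamel_even (C := fun y => Real.cos (τ * y))
      (S := fun y => Real.sin (τ * y) / τ) (f := fun z => ω * (Qw ω z ^ 2 * φ z))
      (fun y => by simp) (fun y => by simp [neg_div]) fun z => by simp only [Qw_even, he z]) y,
      duhamel, ← (integral_volterra (C := fun y => Real.cos (τ * y))
      (S := fun y => Real.sin (τ * y) / τ) (by fun_prop) (by fun_prop) hcf (by simp)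
      (fun y z => by rw [mul_sub, Real.sin_sub]; ring) (abs_nonneg y)).2, potentialOf_eq,
      sub_eq_add_neg, ← integral_neg]
    congr 2
    funext z
    rw [sineKernel]
    ring
  have hw' := fun y => congrFun hw y
  simp only [hw']
  refine ⟨_, fun y => hasDerivAt_duhamel hC hS hcf y, fun y =>
    hasDerivAt_duhamel_deriv hC hS hcf (fun y => ?_) y⟩
  have := Real.sin_sq_add_cos_sq (τ * y)
  field_simp
  linarith

end Potential

/-! ### Regularity and construction of the mode and of the bounded solution. -/

lemma contDiff_succ_of_hasDerivAt {f f' : ℝ → ℝ} {n : ℕ} (h : ∀ y, HasDerivAt f (f' y) y)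
    (hf : ContDiff ℝ n f') : ContDiff ℝ (n + 1) f := by
  refine contDiff_succ_iff_deriv.2 ⟨fun y => (h y).differentiableAt, by simp, ?_⟩
  rwa [show deriv f = f' from funext fun y => (h y).deriv]

/-- Bootstrap of regularity for the coupled system in sum and difference variables. -/
lemma contDiff_of_system {ω a b : ℝ} {u u' v v' : ℝ → ℝ} (hu : ∀ y, HasDerivAt u (u' y) y)
    (hv : ∀ y, HasDerivAt v (v' y) y)
    (hu' : ∀ y, HasDerivAt u' (a * u y - ω / 3 * Qw ω y ^ 4 * (u y - 2 * v y)) y)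
    (hv' : ∀ y, HasDerivAt v' (b * v y + ω / 3 * Qw ω y ^ 4 * (2 * u y - v y)) y) :
    ContDiff ℝ (⊤ : ℕ∞) u ∧ ContDiff ℝ (⊤ : ℕ∞) v := by
  have key : ∀ n : ℕ, (ContDiff ℝ n u ∧ ContDiff ℝ n v) ∧ ContDiff ℝ n u' ∧ ContDiff ℝ n v' := by
    intro n
    induction n with
    | zero =>
      simp only [Nat.cast_zero, contDiff_zero]
      exact ⟨⟨continuous_of_hasDerivAt hu, continuous_of_hasDerivAt hv⟩,
        continuous_of_hasDerivAt hu', continuous_of_hasDerivAt hv'⟩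
    | succ n ih =>
      obtain ⟨⟨h1, h2⟩, h3, h4⟩ := ih
      have cQ : ContDiff ℝ n (Qw ω) := (contDiff_Qw ω).of_le (by exact_mod_cast le_top)
      push_cast
      exact ⟨⟨contDiff_succ_of_hasDerivAt hu h3, contDiff_succ_of_hasDerivAt hv h4⟩,
        contDiff_succ_of_hasDerivAt hu' (by fun_prop), contDiff_succ_of_hasDerivAt hv' (by fun_prop)⟩
  exact ⟨contDiff_infty.2 fun n => (key n).1.1, contDiff_infty.2 fun n => (key n).1.2⟩

lemma solvesM_of_system {ω ν : ℝ} {u u' v v' : ℝ → ℝ} (hu : ∀ y, HasDerivAt u (u' y) y)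
    (hv : ∀ y, HasDerivAt v (v' y) y)
    (hu' : ∀ y, HasDerivAt u' ((1 - ν) * u y - ω / 3 * Qw ω y ^ 4 * (u y - 2 * v y)) y)
    (hv' : ∀ y, HasDerivAt v' ((1 + ν) * v y + ω / 3 * Qw ω y ^ 4 * (2 * u y - v y)) y) :
    SolvesM ω ν (fun y => (u y + v y) / 2) (fun y => (u y - v y) / 2) := by
  have e1 : deriv (fun y => (u y + v y) / 2) = fun y => (u' y + v' y) / 2 :=
    funext fun y => (((hu y).add (hv y)).div_const 2).deriv
  have e2 : deriv (fun y => (u y - v y) / 2) = fun y => (u' y - v' y) / 2 :=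
    funext fun y => (((hu y).sub (hv y)).div_const 2).deriv
  refine ⟨fun y => ?_, fun y => ?_⟩
  · rw [Mplus, e1, (((hu' y).fun_add (hv' y)).div_const 2).deriv]
    ring
  · rw [Mminus, e2, (((hu' y).fun_sub (hv' y)).div_const 2).deriv]
    ring

lemma even_of_eq_weighted {ω : ℝ} {φ w : ℝ → ℝ} (hw : Function.Even w)
    (h : ∀ y, φ y = Qw ω y ^ 2 * w y) : Function.Even φ := fun y => by rw [h, h, Qw_even, hw]

/-- The potentials of φ and ψ are u and v. The bound α ≤ 1/2 is recorded because it keeps 2λ − 1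
away from zero in the construction of the bounded solution. -/
lemma exists_internalMode {ω : ℝ} (hω : 0 < ω) (hω1 : ω ≤ 1 / 1000000) :
    ∃ (α : ℝ) (W₁ W₂ : ℝ → ℝ), α ≤ 1 / 2 ∧ IsInternalMode ω α W₁ W₂ := by
  obtain ⟨α, φ, ψ, hα0, hα1, cφ, cψ, bφ, bψ, hα, eφ, eψ⟩ := exists_slow_system hω hω1
  set κ := Real.sqrt (2 - α ^ 2) with hκ
  have hκ2 : κ ^ 2 = 2 - α ^ 2 := Real.sq_sqrt (by nlinarith)
  have hκ0 : 0 < κ := Real.sqrt_pos.2 (by nlinarith)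
  set u := potentialOf ω (greenKernel α) φ with hu
  set v := potentialOf ω (greenKernel κ) ψ with hv
  have ue : Function.Even u := potentialOf_even _
  have ve : Function.Even v := potentialOf_even _
  have φe : Function.Even φ := even_of_eq_weighted (w := fun y => (u y - 2 * v y) / 3)
    (fun y => by simp only [ue y, ve y]) fun y => by rw [eφ]; ring
  have ψe : Function.Even ψ := even_of_eq_weighted (w := fun y => -(2 * u y - v y) / 3)
    (fun y => by simp only [ue y, ve y]) fun y => by rw [eψ]; ring
  obtain ⟨u', hu1, hu2⟩ := hasDerivAt_potentialOf_green hω hα0 cφ φe bφ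
  obtain ⟨v', hv1, hv2⟩ := hasDerivAt_potentialOf_green hω hκ0 cψ ψe bψ
  rw [← hu] at hu1
  rw [← hv] at hv1
  simp only [← hu] at hu2
  simp only [← hv] at hv2
  have hu2' : ∀ y, HasDerivAt u' ((1 - freq α) * u y - ω / 3 * Qw ω y ^ 4 * (u y - 2 * v y)) y :=
    fun y => (hu2 y).congr_deriv (by rw [eφ, freq]; ring)
  have hv2' : ∀ y, HasDerivAt v' ((1 + freq α) * v y + ω / 3 * Qw ω y ^ 4 * (2 * u y - v y)) y :=
    fun y => (hv2 y).congr_deriv (by rw [eψ, freq, hκ2]; ring)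
  obtain ⟨su, sv⟩ := contDiff_of_system hu1 hv1 hu2' hv2'
  have tu : Tendsto u (cocompact ℝ) (𝓝 0) := tendsto_potentialOf_green hω hα0 bφ
  have tv : Tendsto v (cocompact ℝ) (𝓝 0) := tendsto_potentialOf_green hω hκ0 bψ
  refine ⟨α, fun y => (u y + v y) / 2, fun y => (u y - v y) / 2, hα1, ⟨hα0, by linarith⟩,
    (su.add sv).div_const 2, (su.sub sv).div_const 2, fun y => by simp only [ue y, ve y],
    fun y => by simp only [ue y, ve y], solvesM_of_system hu1 hv1 hu2' hv2',
    by simpa using (tu.add tv).div_const 2, by simpa using (tu.sub tv).div_const 2, ?_⟩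
  -- The normalisation is the matching condition: 3W₂ − W₁ = u − 2v and (Q²/3)(u − 2v) = φ, so the
  -- integral is six times its half-line counterpart ∫₀^∞ Q²φ = 2α/ω.
  have h1 := integral_comp_abs (f := fun y => Qw ω y ^ 2 * φ y)
  simp only [Qw_abs, even_apply_abs φe] at h1
  have h2 : ∫ y, Qw ω y ^ 4 * (3 * ((u y - v y) / 2) - (u y + v y) / 2) =
      3 * ∫ y, Qw ω y ^ 2 * φ y := by
    rw [← integral_const_mul]
    congr 1
    funext y
    rw [eφ]
    ring
  rw [h2, h1]
  linarith

lemma isBoundedSolution_of_system {ω α : ℝ} {u u' v v' : ℝ → ℝ}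
    (hu : ∀ y, HasDerivAt u (u' y) y) (hv : ∀ y, HasDerivAt v (v' y) y)
    (hu' : ∀ y, HasDerivAt u'
      ((1 - 2 * freq α) * u y - ω / 3 * Qw ω y ^ 4 * (u y - 2 * v y)) y)
    (hv' : ∀ y, HasDerivAt v'
      ((1 + 2 * freq α) * v y + ω / 3 * Qw ω y ^ 4 * (2 * u y - v y)) y)
    (ue : Function.Even u) (ve : Function.Even v) (bu : ∃ M, ∀ y, |u y| ≤ M)
    (bv : ∃ M, ∀ y, |v y| ≤ M) (u0 : u 0 = -2) :
    IsBoundedSolution ω α (fun y => (u y + v y) / 2) (fun y => (u y - v y) / 2) := by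
  obtain ⟨su, sv⟩ := contDiff_of_system hu hv hu' hv'
  obtain ⟨M, hM⟩ := bu
  obtain ⟨N, hN⟩ := bv
  refine ⟨(su.add sv).div_const 2, (su.sub sv).div_const 2, fun y => by simp only [ue y, ve y],
    fun y => by simp only [ue y, ve y], solvesM_of_system hu hv hu' hv', ⟨(M + N) / 2, fun y => ?_⟩,
    by simp only [u0]; ring⟩
  have h1 := abs_le.1 (hM y)
  have h2 := abs_le.1 (hN y)
  exact ⟨abs_le.2 ⟨by linarith, by linarith⟩, abs_le.2 ⟨by linarith, by linarith⟩⟩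

/-- Here τ² = 2λ − 1 and κ² = 2λ + 1. The sum component is propagated from y = 0 by a bounded
Volterra kernel that vanishes there, so u(0) = −2 is automatic and no matching condition arises. -/
lemma exists_boundedSolution {ω α : ℝ} (hω : 0 < ω) (hω1 : ω ≤ 1 / 1000) (hα0 : 0 < α)
    (hα1 : α ≤ 1 / 2) : ∃ h₁ h₂ : ℝ → ℝ, IsBoundedSolution ω α h₁ h₂ := by
  set τ := Real.sqrt (1 - 2 * α ^ 2) with hτ
  set κ := Real.sqrt (3 - 2 * α ^ 2) with hκ
  have hτ2 : τ ^ 2 = 1 - 2 * α ^ 2 := Real.sq_sqrt (by nlinarith)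
  have hκ2 : κ ^ 2 = 3 - 2 * α ^ 2 := Real.sq_sqrt (by nlinarith)
  have hτ1 : 1 / 2 ≤ τ := Real.le_sqrt_of_sq_le (by nlinarith)
  have hκ1 : 1 ≤ κ := Real.le_sqrt_of_sq_le (by nlinarith)
  obtain ⟨φ, ψ, cφ, cψ, bφ, bψ, eφ, eψ⟩ := exists_oscillating_system hω hω1 hτ1 hκ1
  have ue : Function.Even fun y => -2 * Real.cos (τ * |y|) + potentialOf ω (sineKernel τ) φ y :=
    fun y => by simp only [abs_neg, potentialOf_even (sineKernel τ) y]
  have ve : Function.Even (potentialOf ω (greenKernel κ) ψ) := potentialOf_even _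
  have u0 : -2 * Real.cos (τ * |0|) + potentialOf ω (sineKernel τ) φ 0 = -2 := by
    have : ∫ z in Ioi (0 : ℝ), sineKernel τ |0| z * (Qw ω z ^ 2 * φ z) = 0 :=
      setIntegral_eq_zero_of_forall_eq_zero fun z hz => by
        have hz0 : 0 < z := hz
        rw [sineKernel, abs_zero, max_eq_right (by linarith)]
        simp
    rw [potentialOf, this]
    simp
  obtain ⟨u', hu1, hu2⟩ := hasDerivAt_potentialOf_sine (ω := ω) (by linarith : 0 < τ) cφ
    (even_of_eq_weighted (w := fun y => ((-2 * Real.cos (τ * |y|)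
      + potentialOf ω (sineKernel τ) φ y) - 2 * potentialOf ω (greenKernel κ) ψ y) / 3)
      (fun y => by simp only [ue y, ve y]) fun y => by rw [eφ]; ring)
  obtain ⟨v', hv1, hv2⟩ := hasDerivAt_potentialOf_green hω (by linarith : 0 < κ) cψ
    (even_of_eq_weighted (w := fun y => -(2 * (-2 * Real.cos (τ * |y|)
      + potentialOf ω (sineKernel τ) φ y) - potentialOf ω (greenKernel κ) ψ y) / 3)
      (fun y => by simp only [ue y, ve y]) fun y => by rw [eψ]; ring) bψ
  have bv := tendsto_potentialOf_green hω (by linarith : 0 < κ) bψ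
  have bu : ∃ M, ∀ y, |-2 * Real.cos (τ * |y|) + potentialOf ω (sineKernel τ) φ y| ≤ M := by
    refine ⟨2 + ω * (4 * (2 * 24)), fun y => (abs_add_le _ _).trans (add_le_add ?_ ?_)⟩
    · rw [abs_mul, abs_neg, abs_two]
      linarith [Real.abs_cos_le_one (τ * |y|)]
    · rw [potentialOf, abs_mul, abs_of_pos hω]
      refine mul_le_mul_of_nonneg_left ?_ hω.le
      have := abs_integral_weighted_le hω (f := fun z => sineKernel τ |y| z * φ z) (c := 2 * 24)
        fun z _ => by
          rw [abs_mul]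
          exact mul_le_mul (abs_sineKernel_le hτ1) (bφ z) (abs_nonneg _) zero_le_two
      simpa only [mul_left_comm] using this
  have hu2' : ∀ y, HasDerivAt u' ((1 - 2 * freq α) * (-2 * Real.cos (τ * |y|)
      + potentialOf ω (sineKernel τ) φ y) - ω / 3 * Qw ω y ^ 4 * ((-2 * Real.cos (τ * |y|)
      + potentialOf ω (sineKernel τ) φ y) - 2 * potentialOf ω (greenKernel κ) ψ y)) y :=
    fun y => (hu2 y).congr_deriv (by rw [eφ, freq, hτ2]; ring)
  have hv2' : ∀ y, HasDerivAt v' ((1 + 2 * freq α) * potentialOf ω (greenKernel κ) ψ y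
      + ω / 3 * Qw ω y ^ 4 * (2 * (-2 * Real.cos (τ * |y|) + potentialOf ω (sineKernel τ) φ y)
      - potentialOf ω (greenKernel κ) ψ y)) y :=
    fun y => (hv2 y).congr_deriv (by rw [eψ, freq, hκ2]; ring)
  exact ⟨_, _, isBoundedSolution_of_system
    (u := fun y => -2 * Real.cos (τ * |y|) + potentialOf ω (sineKernel τ) φ y) hu1 hv1 hu2' hv2'
    ue ve bu (bounded_of_tendsto_cocompact (continuous_of_hasDerivAt hv1) bv) u0⟩

end CubicQuintic

theorem lemma15 :
    0 < Gam₀ ∧ ∃ ω₁ : ℝ, 0 < ω₁ ∧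
      (∀ ω ∈ Ioo (0 : ℝ) ω₁, ∃ (α : ℝ) (W₁ W₂ h₁ h₂ : ℝ → ℝ),
        IsInternalMode ω α W₁ W₂ ∧ IsBoundedSolution ω α h₁ h₂) ∧
      ∃ C : ℝ, ∀ ω ∈ Ioo (0 : ℝ) ω₁, ∀ (α : ℝ) (W₁ W₂ h₁ h₂ V₁ V₂ g₁ g₂ : ℝ → ℝ),
        IsInternalMode ω α W₁ W₂ → IsBoundedSolution ω α h₁ h₂ →
        V₁ = fstComp ω W₁ → V₂ = sndComp ω (freq α) W₁ →
        g₁ = fstComp ω h₁ → g₂ = sndComp ω (2 * freq α) h₁ →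
        SolvesL ω (freq α) V₁ V₂ ∧ SolvesL ω (2 * freq α) g₁ g₂ ∧
        (∃ M : ℝ, ∀ y, |g₁ y| ≤ M ∧ |g₂ y| ≤ M) ∧ (∃ y, g₁ y ≠ 0) ∧
        Integrable (fun y => V₁ y * V₂ y) ∧ pairing V₁ V₂ ≠ 0 ∧
        Integrable (fun y => G₁ ω V₁ V₂ y * V₁ y) ∧ Integrable (fun y => G₂ ω V₁ V₂ y * V₂ y) ∧
        Integrable (fermiIntegrand ω V₁ V₂ g₁ g₂) ∧
        |Gam ω V₁ V₂ g₁ g₂ - Gam₀ * ω| ≤ C * ω ^ 2 := by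
  -- The threshold is dictated by existence of the mode; the expansion itself needs only ω ≤ 1/1000.
  refine ⟨?_, 1 / 1000000, by norm_num, fun ω hω => ?_, ?_⟩
  · have := Real.cosh_pos (Real.pi / 2)
    have := Real.pi_pos
    unfold Gam₀
    positivity
  · obtain ⟨α, W₁, W₂, hα, hW⟩ := exists_internalMode hω.1 hω.2.le
    obtain ⟨h₁, h₂, hh⟩ := exists_boundedSolution hω.1 (by linarith [hω.2]) hW.alpha_mem.1 hα
    exact ⟨α, W₁, W₂, h₁, h₂, hW, hh⟩
  · obtain ⟨C, hC⟩ := exists_gam_expansion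
    exact ⟨C, fun ω hω α W₁ W₂ h₁ h₂ V₁ V₂ g₁ g₂ =>
      hC ω α W₁ W₂ h₁ h₂ V₁ V₂ g₁ g₂ hω.1 (by linarith [hω.2])⟩
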